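/- Let $A=\bigoplus_{n\in\mathbb Z}A_n$ be a $\mathbb Z$-graded ring which is commutative in the ordinary sense, let $f_1,\dots,f_r\in A$ ($r\ge 0$) be homogeneous elements and $I=(f_1,\dots,f_r)$. Let $\mathrm{Gr}(A)$ be the abelian category of $\mathbb Z$-graded $A$-modules and degree-preserving $A$-linear maps, and $\mathcal D=\mathcal D(\mathrm{Gr}(A))$ its unbounded derived category. For $f\in A$ homogeneous of degree $m$ and a complex $M$ of graded modules, let $M_f$ be the localization and $$T(M,f)=\mathrm{holim}\,\bigl[M\xleftarrow{\,f\,}M(-m)\xleftarrow{\,f\,}M(-2m)\xleftarrow{\,f\,}\cdots\bigr]$$ (the mapping cocone of the map $(x_k)_k\mapsto (x_k-f x_{k+1})_k$ on $\prod_{k\ge 0}M(-km)$). Let $\check{\mathcal C}_I(M)$ and $\mathcal E_I(M)$ be the total complexes $$\check{\mathcal C}_I(M)=\Bigl[\prod_{i}M_{f_i}\to\prod_{i<j}M_{f_if_j}\to\cdots\to M_{f_1\cdots f_r}\Bigr],\qquad \mathcal E_I(M)=\Bigl[\prod_i T(M,f_i)\leftarrow\prod_{i<j}T(M,f_if_j)\leftarrow\cdots\leftarrow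 T(M,f_1\cdots f_r)\Bigr]$$ with alternating-sign differentials and with the first displayed column in degree $0$. Let $\mathbf R\Gamma_I(M)=[M\to\prod_i M_{f_i}\to\cdots\to M_{f_1\cdots f_r}]$ and $\mathbf L\Lambda_I(M)=[M\leftarrow\prod_i T(M,f_i)\leftarrow\cdots\leftarrow T(M,f_1\cdots f_r)]$ be the total complexes with $M$ in degree $0$, i.e. the cocone of the canonical map $\eta_M:M\to\check{\mathcal C}_I(M)$ and the cone of the canonical map $\eta_M^\vee:\mathcal E_I(M)\to M$; let $\epsilon_M:\mathbf R\Gamma_I(M)\to M$ and $\epsilon^\vee_M:M\to\mathbf L\Lambda_I(M)$ be the canonical maps. All of this descends to functors $\mathcal D\to\mathcal D$ and natural transformations between them. Let $\mathcal D_{I^\infty\text{-}\mathrm{Tor}}\subset\mathcal D$ be the full subcategory of complexes all of whose cohomology modules $H$ are $I^\infty$-torsion (for all $x\in H$ and $f\in I$ there is $n>0$ with $f^nx=0$), $\mathcal D_{I\text{-}\mathrm{comp}}$ the full subcategory of the $M$ such that $T(M,f)\simeq 0$ for every homogeneous $f\in I$, and $\mathcal D_{I\text{-}\mathrm{triv}}$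 the full subcategory of the $M$ with $\mathbf R\Gamma_I(M)\simeq0$. Write $\iota$ for the inclusions of these subcategories into $\mathcal D$. Then: 1. For every $M\in\mathcal D$: $\mathbf L\Lambda_I(\check{\mathcal C}_I(M))\simeq 0$ and $\mathbf R\Gamma_I(\mathcal E_I(M))\simeq0$. 2. For every $M\in\mathcal D$: $\mathbf R\Gamma_I(M)\simeq 0$ if and only if $\mathbf L\Lambda_I(M)\simeq0$. 3. The functors $\mathbf R\Gamma_I,\mathbf L\Lambda_I,\check{\mathcal C}_I,\mathcal E_I$ are exact (triangulated), and the three subcategories are triangulated. 4. (Recollement.) $\mathbf R\Gamma_I$, $\mathbf L\Lambda_I$, $\check{\mathcal C}_I$, $\mathcal E_I$ take values in $\mathcal D_{I^\infty\text{-}\mathrm{Tor}}$, $\mathcal D_{I\text{-}\mathrm{comp}}$, $\mathcal D_{I\text{-}\mathrm{triv}}$, $\mathcal D_{I\text{-}\mathrm{triv}}$ respectively, and, as functors to these subcategories: $\mathbf R\Gamma_I$ is right adjoint to $\iota$ with counit $\epsilon$; $\mathbf L\Lambda_I$ is left adjoint to $\iota$ with unit $\epsilon^\vee$; $\check{\mathcal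 C}_I$ is left adjoint to $\iota$ with unit $\eta$; $\mathcal E_I$ is right adjoint to $\iota$ with counit $\eta^\vee$. The functors $\mathbf L\Lambda_I\circ\iota:\mathcal D_{I^\infty\text{-}\mathrm{Tor}}\to\mathcal D_{I\text{-}\mathrm{comp}}$ and $\mathbf R\Gamma_I\circ\iota:\mathcal D_{I\text{-}\mathrm{comp}}\to\mathcal D_{I^\infty\text{-}\mathrm{Tor}}$ are mutually inverse equivalences. Moreover $\mathbf R\Gamma_I:\mathcal D\to\mathcal D_{I^\infty\text{-}\mathrm{Tor}}$ has the right adjoint $\iota\circ(\mathbf L\Lambda_I\circ\iota)$, and $\mathbf L\Lambda_I:\mathcal D\to\mathcal D_{I\text{-}\mathrm{comp}}$ has the left adjoint $\iota\circ(\mathbf R\Gamma_I\circ\iota)$. 5. For every $M\in\mathcal D$, the maps $\mathbf R\Gamma_I(\epsilon^\vee_M):\mathbf R\Gamma_I(M)\to\mathbf R\Gamma_I(\mathbf L\Lambda_I(M))$ and $\mathbf L\Lambda_I(\epsilon_M):\mathbf L\Lambda_I(\mathbf R\Gamma_I(M))\to\mathbf L\Lambda_I(M)$ are isomorphisms. 6.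 (Semi-orthogonal decompositions.) Every morphism in $\mathcal D$ from an object of $\mathcal D_{I^\infty\text{-}\mathrm{Tor}}$ to an object of $\mathcal D_{I\text{-}\mathrm{triv}}$, and from an object of $\mathcal D_{I\text{-}\mathrm{triv}}$ to an object of $\mathcal D_{I\text{-}\mathrm{comp}}$, is zero; and there are exact triangles, natural in $M\in\mathcal D$, $$\mathbf R\Gamma_I(M)\xrightarrow{\epsilon_M}M\xrightarrow{\eta_M}\check{\mathcal C}_I(M)\to\mathbf R\Gamma_I(M)[1],\qquad \mathcal E_I(M)\xrightarrow{\eta^\vee_M}M\xrightarrow{\epsilon^\vee_M}\mathbf L\Lambda_I(M)\to\mathcal E_I(M)[1].$$ -/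

import Mathlib

open CategoryTheory CategoryTheory.Limits

universe u v w

noncomputable section

/-- A graded module over the `ℤ`-graded ring `A = ⨁ 𝒜 i`: a family of abelian groups `X i`
(the homogeneous components of `⨁ X i`) together with the action `𝒜 i × X j → X (i + j)`. -/
structure GrMod {A : Type u} [CommRing A] (𝒜 : ℤ → AddSubgroup A) [GradedRing 𝒜] where
  X : ℤ → Type u
  [grp : ∀ i, AddCommGroup (X i)]
  act : ∀ {i j k : ℤ}, i + j = k → 𝒜 i → X j →+ X k
  add_act : ∀ {i j k : ℤ} (h : i + j = k) (a b : 𝒜 i) (x : X j),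
    act h (a + b) x = act h a x + act h b x
  one_act : ∀ {j : ℤ} (x : X j), act (zero_add j) ⟨1, SetLike.GradedOne.one_mem⟩ x = x
  mul_act : ∀ {i j k l m n : ℤ} (h₁ : i + j = k) (h₂ : k + l = m) (h₃ : j + l = n)
    (h₄ : i + n = m) (a : 𝒜 i) (b : 𝒜 j) (x : X l),
    act h₂ ⟨a * b, h₁ ▸ SetLike.GradedMul.mul_mem a.2 b.2⟩ x = act h₄ a (act h₃ b x)

namespace GrMod

attribute [instance] GrMod.grp

section

variable {A : Type u} [CommRing A] {𝒜 : ℤ → AddSubgroup A} [GradedRing 𝒜]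

/-- Morphisms of graded modules: `A`-linear maps that are homogeneous of degree `0`. -/
@[ext]
structure Hom (M N : GrMod 𝒜) where
  app : ∀ i, M.X i →+ N.X i
  app_act : ∀ {i j k : ℤ} (h : i + j = k) (a : 𝒜 i) (x : M.X j),
    app k (M.act h a x) = N.act h a (app j x)

instance : Category (GrMod 𝒜) where
  Hom := Hom
  id M := { app := fun i => AddMonoidHom.id _, app_act := fun _ _ _ => rfl }
  comp f g :=
    { app := fun i => (g.app i).comp (f.app i)
      app_act := fun h a x => by simp [f.app_act, g.app_act] }

variable {M N L : GrMod 𝒜}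

/-- The component of a morphism in weight `i`. -/
def ev (f : M ⟶ N) (i : ℤ) : M.X i →+ N.X i := Hom.app f i

@[ext]
lemma hom_ext {f g : M ⟶ N} (h : ∀ i x, ev f i x = ev g i x) : f = g :=
  Hom.ext (funext fun i => AddMonoidHom.ext (h i))

lemma ev_act (f : M ⟶ N) {i j k : ℤ} (h : i + j = k) (a : 𝒜 i) (x : M.X j) :
    ev f k (M.act h a x) = N.act h a (ev f j x) := Hom.app_act f h a x

@[simp] lemma ev_id (i : ℤ) (x : M.X i) : ev (𝟙 M) i x = x := rfl

@[simp] lemma ev_comp (f : M ⟶ N) (g : N ⟶ L) (i : ℤ) (x : M.X i) :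
    ev (f ≫ g) i x = ev g i (ev f i x) := rfl

/-- Constructor of morphisms. -/
def mkHom (app : ∀ i, M.X i →+ N.X i)
    (h : ∀ {i j k : ℤ} (h : i + j = k) (a : 𝒜 i) (x : M.X j),
      app k (M.act h a x) = N.act h a (app j x)) : M ⟶ N :=
  { app := app, app_act := h }

@[simp] lemma ev_mkHom (app : ∀ i, M.X i →+ N.X i) (h) (i : ℤ) (x : M.X i) :
    ev (mkHom (M := M) (N := N) app h) i x = app i x := rfl

lemma act_congr (M : GrMod 𝒜) {i i' j k : ℤ} (h : i + j = k) (h' : i' + j = k) (a : 𝒜 i)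
    (b : 𝒜 i') (hab : (a : A) = b) (x : M.X j) : M.act h a x = M.act h' b x := by
  obtain rfl : i = i' := by omega
  obtain rfl : a = b := Subtype.ext hab
  rfl

lemma act_one (M : GrMod 𝒜) {i j : ℤ} (h : i + j = j) (a : 𝒜 i) (ha : (a : A) = 1)
    (x : M.X j) : M.act h a x = x := by
  conv_rhs => rw [← M.one_act x]
  exact M.act_congr _ _ _ _ ha _

lemma act_act (M : GrMod 𝒜) {i j k l m n : ℤ} (h₃ : j + l = n) (h₄ : i + n = m) (h₅ : k + l = m)
    (a : 𝒜 i) (b : 𝒜 j) (c : 𝒜 k) (h : (c : A) = a * b) (x : M.X l) :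
    M.act h₄ a (M.act h₃ b x) = M.act h₅ c x := by
  rw [← M.mul_act (show i + j = k by omega) h₅ h₃ h₄]
  exact M.act_congr _ _ _ _ h.symm _

instance : Zero (M ⟶ N) := ⟨mkHom (fun _ => 0) (fun h a x => by simp)⟩
instance : Add (M ⟶ N) := ⟨fun f g => mkHom (fun i => ev f i + ev g i) (fun h a x => by simp [ev_act])⟩
instance : Neg (M ⟶ N) := ⟨fun f => mkHom (fun i => - ev f i) (fun h a x => by simp [ev_act])⟩

instance : AddCommGroup (M ⟶ N) where
  add_assoc f g h := by ext i x; exact add_assoc _ _ _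
  zero_add f := by ext i x; exact zero_add _
  add_zero f := by ext i x; exact add_zero _
  add_comm f g := by ext i x; exact add_comm _ _
  neg_add_cancel f := by ext i x; exact neg_add_cancel _
  nsmul := nsmulRec
  zsmul := zsmulRec

@[simp] lemma ev_add (f g : M ⟶ N) (i : ℤ) (x : M.X i) : ev (f + g) i x = ev f i x + ev g i x := rfl
@[simp] lemma ev_zero (i : ℤ) (x : M.X i) : ev (0 : M ⟶ N) i x = 0 := rfl
@[simp] lemma ev_neg (f : M ⟶ N) (i : ℤ) (x : M.X i) : ev (-f) i x = -ev f i x := rfl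

instance : Preadditive (GrMod 𝒜) where
  add_comp f g h k l m := by
    ext i x
    simp
  comp_add _ _ _ _ _ _ := rfl

/-- Products of graded modules are formed in each weight. -/
def piObj {J : Type} (F : J → GrMod 𝒜) : GrMod 𝒜 where
  X i := ∀ j, (F j).X i
  act h a :=
    { toFun := fun x j => (F j).act h a (x j)
      map_zero' := by ext; simp
      map_add' := fun x y => by ext; simp }
  add_act h a b x := by ext; simp [add_act]
  one_act x := by ext; simp [one_act]
  mul_act h₁ h₂ h₃ h₄ a b x := funext fun j => (F j).mul_act h₁ h₂ h₃ h₄ a b (x j)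

instance {J : Type} (F : J → GrMod 𝒜) : HasProduct F :=
  ⟨⟨{ cone := Fan.mk (piObj F) (fun j => mkHom (M := piObj F)
        (fun i => Pi.evalAddMonoidHom (fun j => (F j).X i) j) (fun _ _ _ => rfl))
      isLimit := Fan.IsLimit.mk _
        (fun s => mkHom (M := s.pt) (N := piObj F)
          (fun i => AddMonoidHom.pi (f := fun j => (F j).X i) fun j => ev (s.proj j) i)
          (fun h a x => by funext j; exact ev_act (s.proj j) h a x))
        (fun s j => rfl)
        (fun s m hm => by
          ext i x
          funext j
          exact congrArg (fun f => ev f i x) (hm j)) }⟩⟩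

instance : HasFiniteProducts (GrMod 𝒜) where
  out _ := ⟨fun F => hasLimit_of_iso (Discrete.natIsoFunctor (F := F)).symm⟩

/-- The kernel of a morphism. -/
def kerObj (f : M ⟶ N) : GrMod 𝒜 where
  X i := (ev f i).ker
  act h a :=
    { toFun := fun x => ⟨M.act h a x.1, by
        have := x.2
        rw [AddMonoidHom.mem_ker] at this ⊢
        rw [ev_act, this, map_zero]⟩
      map_zero' := by ext; simp
      map_add' := fun x y => by ext; simp }
  add_act h a b x := by ext; simp [add_act]
  one_act x := by ext; simp [one_act]
  mul_act h₁ h₂ h₃ h₄ a b x := Subtype.ext (M.mul_act h₁ h₂ h₃ h₄ a b x.1)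

/-- The inclusion of the kernel. -/
def kerι (f : M ⟶ N) : kerObj f ⟶ M :=
  mkHom (M := kerObj f) (fun i => (ev f i).ker.subtype) (fun _ _ _ => rfl)

lemma kerι_comp (f : M ⟶ N) : kerι f ≫ f = 0 := by
  ext i x
  exact x.2

/-- The kernel is a kernel. -/
def kerIsLimit (f : M ⟶ N) : IsLimit (KernelFork.ofι (kerι f) (kerι_comp f)) :=
  KernelFork.IsLimit.ofι _ _
    (fun {W} g hg => mkHom (M := W) (N := kerObj f)
      (fun i => (ev g i).codRestrict _ (fun x => congrArg (fun q => ev q i x) hg))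
      (fun h a x => Subtype.ext (ev_act g h a x)))
    (fun g hg => rfl)
    (fun g hg m hm => by
      ext i x
      exact Subtype.ext (congrArg (fun q => ev q i x) hm))

instance : HasKernels (GrMod 𝒜) where
  has_limit f := ⟨⟨_, kerIsLimit f⟩⟩

/-- The cokernel of a morphism. -/
def cokerObj (f : M ⟶ N) : GrMod 𝒜 where
  X i := N.X i ⧸ (ev f i).range
  act {i j k} h a := QuotientAddGroup.map _ _ (N.act h a) (by
    rintro _ ⟨x, rfl⟩
    exact ⟨M.act h a x, ev_act f h a x⟩)
  add_act h a b x := by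
    obtain ⟨x, rfl⟩ := QuotientAddGroup.mk_surjective x
    simp [add_act]
  one_act x := by
    obtain ⟨x, rfl⟩ := QuotientAddGroup.mk_surjective x
    simp [one_act]
  mul_act h₁ h₂ h₃ h₄ a b x := by
    obtain ⟨x, rfl⟩ := QuotientAddGroup.mk_surjective x
    exact congrArg _ (N.mul_act h₁ h₂ h₃ h₄ a b x)

/-- The projection to the cokernel. -/
def cokerπ (f : M ⟶ N) : N ⟶ cokerObj f :=
  mkHom (N := cokerObj f) (fun _ => QuotientAddGroup.mk' _) (fun _ _ _ => rfl)

lemma comp_cokerπ (f : M ⟶ N) : f ≫ cokerπ f = 0 := by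
  ext i x
  exact (QuotientAddGroup.eq_zero_iff _).2 ⟨x, rfl⟩

/-- The cokernel is a cokernel. -/
def cokerIsColimit (f : M ⟶ N) :
    IsColimit (CokernelCofork.ofπ (cokerπ f) (comp_cokerπ f)) :=
  CokernelCofork.IsColimit.ofπ _ _
    (fun {W} g hg => mkHom (M := cokerObj f) (N := W)
      (fun i => QuotientAddGroup.lift _ (ev g i) (by
        rintro _ ⟨x, rfl⟩
        exact congrArg (fun q => ev q i x) hg))
      (fun h a x => by
        obtain ⟨x, rfl⟩ := QuotientAddGroup.mk_surjective x
        exact ev_act g h a x))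
    (fun g hg => rfl)
    (fun g hg m hm => by
      ext i x
      obtain ⟨x, rfl⟩ := QuotientAddGroup.mk_surjective x
      exact congrArg (fun q => ev q i x) hm)

instance : HasCokernels (GrMod 𝒜) where
  has_colimit f := ⟨⟨_, cokerIsColimit f⟩⟩

lemma injective_of_mono (f : M ⟶ N) [Mono f] (i : ℤ) : Function.Injective (ev f i) := by
  rw [injective_iff_map_eq_zero]
  intro x hx
  have h : kerι f = 0 := by
    rw [← cancel_mono f, kerι_comp, zero_comp]
  exact congrArg (fun q : kerObj f ⟶ M => ev q i (show (ev f i).ker from ⟨x, hx⟩)) h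

lemma surjective_of_epi (f : M ⟶ N) [Epi f] (i : ℤ) : Function.Surjective (ev f i) := by
  intro x
  have h : cokerπ f = 0 := by
    rw [← cancel_epi f, comp_cokerπ, comp_zero]
  exact (QuotientAddGroup.eq_zero_iff _).1 (congrArg (fun q => ev q i x) h)

instance : IsNormalMonoCategory (GrMod 𝒜) where
  normalMonoOfMono {M N} f _ := ⟨
    { Z := cokerObj f
      g := cokerπ f
      w := comp_cokerπ f
      isLimit := by
        have key : ∀ {W : GrMod 𝒜} (g : W ⟶ N), g ≫ cokerπ f = 0 → ∀ i x, ∃ y, ev f i y = ev g i x :=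
          fun g hg i x => (QuotientAddGroup.eq_zero_iff _).1 (congrArg (fun q => ev q i x) hg)
        have inj := injective_of_mono f
        let pre {W : GrMod 𝒜} (g : W ⟶ N) (hg : g ≫ cokerπ f = 0) (i : ℤ) (x : W.X i) : M.X i :=
          (key g hg i x).choose
        have hpre {W : GrMod 𝒜} (g : W ⟶ N) (hg : g ≫ cokerπ f = 0) (i : ℤ) (x : W.X i) :
            ev f i (pre g hg i x) = ev g i x := (key g hg i x).choose_spec
        refine KernelFork.IsLimit.ofι _ _
          (fun {W} g hg => mkHom (M := W) (N := M)
            (fun i => AddMonoidHom.mk' (pre g hg i) (fun x y => inj i (by simp [hpre])))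
            (fun {i j k} h a x => inj k (by simp [hpre, ev_act]))) ?_ ?_
        · intro W g hg
          ext i x
          exact hpre g hg i x
        · intro W g hg m hm
          rw [← cancel_mono f, hm]
          ext i x
          exact (hpre g hg i x).symm }⟩

instance : IsNormalEpiCategory (GrMod 𝒜) where
  normalEpiOfEpi {M N} f _ := ⟨
    { W := kerObj f
      g := kerι f
      w := kerι_comp f
      isColimit := by
        have key : ∀ {W : GrMod 𝒜} (g : M ⟶ W), kerι f ≫ g = 0 → ∀ i x y,
            ev f i x = ev f i y → ev g i x = ev g i y := by
          intro W g hg i x y hxy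
          rw [← sub_eq_zero, ← map_sub]
          exact congrArg (fun q : kerObj f ⟶ W => ev q i (show (ev f i).ker from ⟨x - y, by
            rw [AddMonoidHom.mem_ker, map_sub, hxy, sub_self]⟩)) hg
        have s := surjective_of_epi f
        refine CokernelCofork.IsColimit.ofπ _ _
          (fun {W} g hg => mkHom (M := N) (N := W)
            (fun i => AddMonoidHom.mk' (fun x => ev g i (s i x).choose) (fun x y => by
              rw [← map_add]
              apply key g hg
              rw [map_add, (s i _).choose_spec, (s i _).choose_spec, (s i _).choose_spec]))
            (fun {i j k} h a x => by
              change ev g _ _ = W.act h a (ev g _ _)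
              rw [← ev_act]
              apply key g hg
              rw [ev_act, (s k _).choose_spec, (s j _).choose_spec])) ?_ ?_
        · intro W g hg
          ext i x
          exact key g hg i _ _ (s i _).choose_spec
        · intro W g hg m hm
          rw [← cancel_epi f, hm]
          ext i x
          exact (key g hg i _ _ (s i _).choose_spec).symm }⟩

instance : Abelian (GrMod 𝒜) where

end

end GrMod

end

noncomputable section
namespace GrMod
section
variable {A : Type u} [CommRing A] {𝒜 : ℤ → AddSubgroup A} [GradedRing 𝒜]

lemma exact_iff (S : ShortComplex (GrMod 𝒜)) :
    S.Exact ↔ ∀ i (x : S.X₂.X i), ev S.g i x = 0 → ∃ y, ev S.f i y = x := by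
  rw [S.exact_iff_of_forks (kerIsLimit S.g) (cokerIsColimit S.f)]
  constructor
  · intro h i x hx
    exact (QuotientAddGroup.eq_zero_iff _).1 (congrArg
      (fun q : kerObj S.g ⟶ cokerObj S.f => ev q i (show (ev S.g i).ker from ⟨x, hx⟩)) h)
  · intro h
    apply hom_ext
    intro i x
    exact (QuotientAddGroup.eq_zero_iff _).2 (h i x.1 x.2)

lemma acyclic_iff (K : CochainComplex (GrMod 𝒜) ℤ) :
    K.Acyclic ↔ ∀ (p q r : ℤ) (_ : p + 1 = q) (_ : q + 1 = r) (i : ℤ) (x : (K.X q).X i),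
      ev (K.d q r) i x = 0 → ∃ y, ev (K.d p q) i y = x := by
  constructor
  · intro h p q r hp hr i x hx
    have h1 := (K.exactAt_iff' p q r (by simp; omega) (by simp; omega)).1 (h q)
    exact (exact_iff _).1 h1 i x hx
  · intro h q
    rw [K.exactAt_iff' (q - 1) q (q + 1) (by simp) (by simp), exact_iff]
    exact h (q - 1) q (q + 1) (by omega) rfl

open CochainComplex HomotopyCategory in
lemma quasiIso_iff_acyclic {K L : CochainComplex (GrMod 𝒜) ℤ} (φ : K ⟶ L) :
    QuasiIso φ ↔ (mappingCone φ).Acyclic := by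
  rw [← HomologicalComplex.mem_quasiIso_iff, ← quotient_map_mem_quasiIso_iff,
    quasiIso_eq_trW_subcategoryAcyclic,
    ← quotient_obj_mem_subcategoryAcyclic_iff_acyclic]
  exact (subcategoryAcyclic (GrMod 𝒜)).trW_iff_of_distinguished _
    (mappingCone_triangleh_distinguished φ)

open CochainComplex in
/-- Quasi-isomorphisms in terms of elements: the mapping cone is exact. -/
lemma quasiIso_iff {K L : CochainComplex (GrMod 𝒜) ℤ} (φ : K ⟶ L) :
    QuasiIso φ ↔ ∀ (p q r : ℤ) (_ : p + 1 = q) (_ : q + 1 = r) (i : ℤ)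
      (x : (K.X r).X i) (y : (L.X q).X i), ev (K.d r (r + 1)) i x = 0 →
      ev (φ.f r) i x = ev (L.d q r) i y →
      ∃ (x' : (K.X q).X i) (y' : (L.X p).X i), ev (K.d q r) i x' = x ∧
        ev (φ.f q) i x' + ev (L.d p q) i y' = y := by
  rw [quasiIso_iff_acyclic, acyclic_iff]
  have ext : ∀ (n m : ℤ) (hm : n + 1 = m) (i : ℤ) (c c' : ((mappingCone φ).X n).X i),
      ev ((mappingCone.fst φ).1.v n m hm) i c = ev ((mappingCone.fst φ).1.v n m hm) i c' →
      ev ((mappingCone.snd φ).v n n (add_zero n)) i c =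
        ev ((mappingCone.snd φ).v n n (add_zero n)) i c' → c = c' := by
    intro n m hm i c c' h1 h2
    have := mappingCone.id_X φ n m hm
    have h3 := congrArg (fun q => ev q i c) this
    have h4 := congrArg (fun q => ev q i c') this
    simp only [ev_add, ev_comp, ev_id] at h3 h4
    rw [← h3, ← h4, h1, h2]
  have d1 : ∀ (n m l : ℤ) (hm : n + 1 = m) (hl : m + 1 = l) (i : ℤ) (c : ((mappingCone φ).X n).X i),
      ev ((mappingCone.fst φ).1.v m l hl) i (ev ((mappingCone φ).d n m) i c) =
      - ev (K.d m l) i (ev ((mappingCone.fst φ).1.v n m hm) i c) := by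
    intro n m l hm hl i c
    exact congrArg (fun q => ev q i c) (mappingCone.d_fst_v φ n m l hm hl)
  have d2 : ∀ (n m : ℤ) (hm : n + 1 = m) (i : ℤ) (c : ((mappingCone φ).X n).X i),
      ev ((mappingCone.snd φ).v m m (add_zero m)) i (ev ((mappingCone φ).d n m) i c) =
      ev (φ.f m) i (ev ((mappingCone.fst φ).1.v n m hm) i c) +
        ev (L.d n m) i (ev ((mappingCone.snd φ).v n n (add_zero n)) i c) := by
    intro n m hm i c
    exact congrArg (fun q => ev q i c) (mappingCone.d_snd_v φ n m hm)
  have mk : ∀ (n m : ℤ) (hm : n + 1 = m) (i : ℤ) (x : (K.X m).X i) (y : (L.X n).X i),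
      ∃ c : ((mappingCone φ).X n).X i, ev ((mappingCone.fst φ).1.v n m hm) i c = x ∧
        ev ((mappingCone.snd φ).v n n (add_zero n)) i c = y := by
    intro n m hm i x y
    refine ⟨ev ((mappingCone.inl φ).v m n (by omega)) i x + ev ((mappingCone.inr φ).f n) i y,
      ?_, ?_⟩
    · rw [map_add, ← ev_comp, ← ev_comp]
      simp
    · rw [map_add, ← ev_comp, ← ev_comp]
      simp
  constructor
  · intro h p q r hp hr i x y hx hy
    obtain ⟨c, hc1, hc2⟩ := mk q r hr i x (-y)
    obtain ⟨b, hb⟩ := h p q r hp hr i c (ext r (r + 1) rfl i _ _ (by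
      rw [d1 q r (r + 1) hr rfl, hc1, hx, neg_zero, map_zero]) (by
      rw [d2 q r hr, hc1, hc2, hy, map_neg, add_neg_cancel, map_zero]))
    refine ⟨- ev ((mappingCone.fst φ).1.v p q hp) i b,
      - ev ((mappingCone.snd φ).v p p (add_zero p)) i b, ?_, ?_⟩
    · rw [map_neg, ← d1 p q r hp hr, hb, hc1]
    · rw [map_neg, map_neg, ← neg_add, ← d2 p q hp, hb, hc2, neg_neg]
  · intro h p q r hp hr i c hc
    obtain ⟨x', y', h1, h2⟩ := h p q r hp hr i (ev ((mappingCone.fst φ).1.v q r hr) i c)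
      (- ev ((mappingCone.snd φ).v q q (add_zero q)) i c) (by
        rw [← neg_eq_zero, ← d1 q r (r + 1) hr rfl, hc, map_zero]) (by
        rw [map_neg, eq_neg_iff_add_eq_zero, ← d2 q r hr, hc, map_zero])
    obtain ⟨b, hb1, hb2⟩ := mk p q hp i (-x') (-y')
    refine ⟨b, ext q r hr i _ _ ?_ ?_⟩
    · rw [d1 p q r hp hr, hb1, map_neg, neg_neg, h1]
    · rw [d2 p q hp, hb1, hb2, map_neg, map_neg, ← neg_add, h2, neg_neg]
end
end GrMod
end

noncomputable section
namespace GrMod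
section
variable {A : Type u} [CommRing A] {𝒜 : ℤ → AddSubgroup A} [GradedRing 𝒜]

/-- The power `g ^ k` of a homogeneous element, as a homogeneous element of degree `k * d`. -/
def hpow {d : ℤ} (g : 𝒜 d) (k : ℕ) : 𝒜 (k * d) :=
  ⟨(g : A) ^ k, by simpa using SetLike.pow_mem_graded k g.2⟩

@[simp] lemma coe_hpow {d : ℤ} (g : 𝒜 d) (k : ℕ) : (hpow g k : A) = (g : A) ^ k := rfl

/-- The transition maps `g ^ (k - j) : M_{w + j d} → M_{w + k d}`. -/
def locStep {d : ℤ} (g : 𝒜 d) (M : GrMod 𝒜) (w : ℤ) (j k : ℕ) (h : j ≤ k) :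
    M.X (w + j * d) →+ M.X (w + k * d) :=
  M.act (by push_cast [Nat.cast_sub h]; ring) (hpow g (k - j))

instance {d : ℤ} (g : 𝒜 d) (M : GrMod 𝒜) (w : ℤ) :
    DirectedSystem (fun k : ℕ => M.X (w + k * d)) (fun j k h => locStep g M w j k h) where
  map_self j x := M.act_one _ _ (by simp) x
  map_map i j k hij hjk x :=
    M.act_act _ _ _ _ _ _ (by simp only [coe_hpow]; rw [← pow_add]; congr 1; omega) x

lemma locStep_act {d : ℤ} (g : 𝒜 d) (M : GrMod 𝒜) {i w w' : ℤ} (h : i + w = w') (a : 𝒜 i)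
    (k m : ℕ) (hkm : k ≤ m) :
    (M.act (show i + (w + m * d) = w' + m * d by omega) a).comp (locStep g M w k m hkm) =
      (locStep g M w' k m hkm).comp (M.act (show i + (w + k * d) = w' + k * d by omega) a) := by
  ext x
  exact (M.act_act _ _ (by push_cast [Nat.cast_sub hkm]; linarith) _ _
      ⟨(a : A) * hpow g (m - k), SetLike.GradedMul.mul_mem a.2 (hpow g (m - k)).2⟩ rfl x).trans
    (M.act_act _ _ _ _ _ _ (mul_comm _ _) x).symm

/-- The localization `M_g` of a graded module at a homogeneous element `g` of degree `d`: its
component of weight `w` is the colimit of `M_w → M_{w + d} → M_{w + 2 d} → ⋯`, whose transition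
maps are multiplication by `g`; the class of `x ∈ M_{w + k d}` stands for `x / g ^ k`. -/
def locObj {d : ℤ} (g : 𝒜 d) (M : GrMod 𝒜) : GrMod 𝒜 where
  X w := AddCommGroup.DirectLimit (fun k : ℕ => M.X (w + k * d)) (locStep g M w)
  act {i j l} h a := AddCommGroup.DirectLimit.map
    (fun k => M.act (show i + (j + k * d) = l + k * d by omega) a) (locStep_act g M h a)
  add_act h a b x := by
    induction x using AddCommGroup.DirectLimit.induction_on with
    | ih k x => simp [add_act]
  one_act x := by
    induction x using AddCommGroup.DirectLimit.induction_on with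
    | ih k x => simp [act_one]
  mul_act {i j l m n o} h₁ h₂ h₃ h₄ a b x := by
    induction x using AddCommGroup.DirectLimit.induction_on with
    | ih k x =>
      simp only [AddCommGroup.DirectLimit.map_apply_of]
      rw [M.mul_act h₁ (by omega) (n := o + k * d) (by omega) (by omega)]

/-- The fraction `x / g ^ k`. -/
def frac {d : ℤ} (g : 𝒜 d) (M : GrMod 𝒜) (w : ℤ) (k : ℕ) :
    M.X (w + k * d) →+ (locObj g M).X w :=
  AddCommGroup.DirectLimit.of (fun k : ℕ => M.X (w + k * d)) (locStep g M w) k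

lemma exists_frac {d : ℤ} (g : 𝒜 d) (M : GrMod 𝒜) (w : ℤ) (x : (locObj g M).X w) :
    ∃ k y, x = frac g M w k y := by
  revert x
  intro (x : AddCommGroup.DirectLimit (fun k : ℕ => M.X (w + k * d)) (locStep g M w))
  induction x using AddCommGroup.DirectLimit.induction_on with
  | ih k x => exact ⟨k, x, rfl⟩

lemma frac_step {d : ℤ} (g : 𝒜 d) (M : GrMod 𝒜) (w : ℤ) {j k : ℕ} (h : j ≤ k)
    (x : M.X (w + j * d)) : frac g M w k (locStep g M w j k h x) = frac g M w j x :=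
  AddCommGroup.DirectLimit.of_f (f := locStep g M w) h x

lemma frac_eq_zero {d : ℤ} (g : 𝒜 d) (M : GrMod 𝒜) (w : ℤ) (k : ℕ) (x : M.X (w + k * d))
    (hx : frac g M w k x = 0) : ∃ j, ∃ h : k ≤ j, locStep g M w k j h x = 0 :=
  AddCommGroup.DirectLimit.of.zero_exact (f := locStep g M w) k x hx

lemma frac_act {d : ℤ} (g : 𝒜 d) (M : GrMod 𝒜) {i w w' : ℤ} (h : i + w = w') (a : 𝒜 i) (k : ℕ)
    (x : M.X (w + k * d)) :
    (locObj g M).act h a (frac g M w k x) =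
      frac g M w' k (M.act (show i + (w + k * d) = w' + k * d by omega) a x) :=
  AddCommGroup.DirectLimit.map_apply_of (f := locStep g M w) (f' := locStep g M w')
    (fun k => M.act (show i + (w + k * d) = w' + k * d by omega) a) (locStep_act g M h a) x

/-- A morphism out of `M_g`, given by compatible maps on numerators. -/
def locDesc {d : ℤ} (g : 𝒜 d) (M N : GrMod 𝒜) (φ : ∀ (w : ℤ) (k : ℕ), M.X (w + k * d) →+ N.X w)
    (hφ : ∀ w j k h x, φ w k (locStep g M w j k h x) = φ w j x)
    (hφ' : ∀ {i w w' : ℤ} (h : i + w = w') (a : 𝒜 i) (k : ℕ) (x : M.X (w + k * d)),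
      φ w' k (M.act (show i + (w + k * d) = w' + k * d by omega) a x) = N.act h a (φ w k x)) :
    locObj g M ⟶ N :=
  mkHom (M := locObj g M) (N := N)
    (fun w => AddCommGroup.DirectLimit.lift (fun k : ℕ => M.X (w + k * d)) (locStep g M w) _
      (φ w) (hφ w))
    (fun h a x => by
      obtain ⟨k, x, rfl⟩ := exists_frac g M _ x
      rw [frac_act]
      erw [AddCommGroup.DirectLimit.lift_of, AddCommGroup.DirectLimit.lift_of]
      exact hφ' h a k x)

@[simp] lemma ev_locDesc {d : ℤ} (g : 𝒜 d) (M N : GrMod 𝒜) (φ) (hφ) (hφ') (w : ℤ) (k : ℕ)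
    (x : M.X (w + k * d)) :
    ev (locDesc g M N φ hφ hφ') w (frac g M w k x) = φ w k x :=
  AddCommGroup.DirectLimit.lift_of (G := fun k : ℕ => M.X (w + k * d)) (f := locStep g M w)
    _ (φ w) (hφ w) k x

lemma loc_hom_ext {d : ℤ} {g : 𝒜 d} {M N : GrMod 𝒜} {a b : locObj g M ⟶ N}
    (h : ∀ w k x, ev a w (frac g M w k x) = ev b w (frac g M w k x)) : a = b := by
  ext w x
  obtain ⟨k, x, rfl⟩ := exists_frac g M w x
  exact h w k x

/-- The localization functor `M ↦ M_g`. -/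
abbrev loc {d : ℤ} (g : 𝒜 d) : GrMod 𝒜 ⥤ GrMod 𝒜 where
  obj M := locObj g M
  map {M N} φ := locDesc g M (locObj g N) (fun w k => (frac g N w k).comp (ev φ (w + k * d)))
    (fun w j k h x => by
      have : ev φ _ (locStep g M w j k h x) = locStep g N w j k h (ev φ _ x) := ev_act φ _ _ x
      simp [this, frac_step])
    (fun h a k x => by simp [ev_act, frac_act])
  map_id M := loc_hom_ext (fun w k x => by simp)
  map_comp φ ψ := loc_hom_ext (fun w k x => by simp)

@[simp] lemma ev_loc_map {d : ℤ} (g : 𝒜 d) {M N : GrMod 𝒜} (φ : M ⟶ N) (w : ℤ) (k : ℕ)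
    (x : M.X (w + k * d)) :
    ev ((loc g).map φ) w (frac g M w k x) = frac g N w k (ev φ _ x) :=
  by simp only [ev_locDesc]; rfl

instance {d : ℤ} (g : 𝒜 d) : (loc g).Additive where
  map_add {M N φ ψ} := loc_hom_ext (fun w k x => by simp)

/-- The canonical map `M_g → M_{h g}`, `x / g ^ k ↦ (h ^ k x) / (h g) ^ k`. -/
def locTransApp {d d' e : ℤ} (g : 𝒜 d) (g' : 𝒜 d') (h : 𝒜 e) (hd : e + d = d')
    (hg : (g' : A) = h * g) (M : GrMod 𝒜) : locObj g M ⟶ locObj g' M :=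
  locDesc g M (locObj g' M)
    (fun w k => (frac g' M w k).comp (M.act (by rw [← hd]; ring) (hpow h k)))
    (fun w j k hjk x => by
      change frac g' M w k _ = frac g' M w j _
      rw [← frac_step g' M w hjk]
      congr 1
      have h2 := SetLike.GradedMul.mul_mem (hpow h k).2 (hpow g (k - j)).2
      refine (M.act_act _ _ (by push_cast [Nat.cast_sub hjk]; rw [← hd]; ring) _ _ ⟨_, h2⟩ rfl
        x).trans (M.act_act _ _ _ _ _ _ ?_ x).symm
      simp only [coe_hpow, hg]
      obtain ⟨l, rfl⟩ := Nat.exists_eq_add_of_le hjk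
      simp only [Nat.add_sub_cancel_left]
      ring)
    (fun {i w w'} hw a k x => by
      change frac g' M w' k _ = (locObj g' M).act hw a (frac g' M w k _)
      rw [frac_act]
      congr 1
      exact (M.act_act _ _ (by rw [← hd, ← hw]; ring) _ _
        ⟨_, SetLike.GradedMul.mul_mem (hpow h k).2 a.2⟩ rfl x).trans
        (M.act_act _ _ _ _ _ _ (mul_comm _ _) x).symm)

lemma ev_locTransApp {d d' e : ℤ} (g : 𝒜 d) (g' : 𝒜 d') (h : 𝒜 e) (hd : e + d = d')
    (hg : (g' : A) = h * g) (M : GrMod 𝒜) (w : ℤ) (k : ℕ) (x : M.X (w + k * d)) :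
    ev (locTransApp g g' h hd hg M) w (frac g M w k x) =
      frac g' M w k (M.act (by rw [← hd]; ring) (hpow h k) x) := by
  simp only [locTransApp, ev_locDesc]; rfl

/-- The canonical map `M_g → M_{h g}`, as a natural transformation. -/
def locTrans {d d' e : ℤ} (g : 𝒜 d) (g' : 𝒜 d') (h : 𝒜 e) (hd : e + d = d')
    (hg : (g' : A) = h * g) : loc g ⟶ loc g' where
  app M := locTransApp g g' h hd hg M
  naturality M N φ := loc_hom_ext (fun w k x => by
    simp only [ev_comp, ev_locDesc, ev_locTransApp, AddMonoidHom.comp_apply]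
    rw [ev_act])

lemma ev_locTrans {d d' e : ℤ} (g : 𝒜 d) (g' : 𝒜 d') (h : 𝒜 e) (hd : e + d = d')
    (hg : (g' : A) = h * g) (M : GrMod 𝒜) (w : ℤ) (k : ℕ) (x : M.X (w + k * d)) :
    ev ((locTrans g g' h hd hg).app M) w (frac g M w k x) =
      frac g' M w k (M.act (by rw [← hd]; ring) (hpow h k) x) :=
  ev_locTransApp g g' h hd hg M w k x

lemma locTrans_id {d e : ℤ} (g : 𝒜 d) (h : 𝒜 e) (hd : e + d = d) (hh : (h : A) = 1) :
    locTrans g g h hd (by rw [hh, one_mul]) = 𝟙 (loc g) := by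
  ext M : 2
  refine loc_hom_ext (fun w k x => ?_)
  rw [ev_locTrans, M.act_one _ _ (by simp [hh])]
  rfl

lemma locTrans_comp {d d' d'' e e' e'' : ℤ} (g : 𝒜 d) (g' : 𝒜 d') (g'' : 𝒜 d'')
    (h : 𝒜 e) (h' : 𝒜 e') (h'' : 𝒜 e'') (hd : e + d = d') (hg : (g' : A) = h * g)
    (hd' : e' + d' = d'') (hg' : (g'' : A) = h' * g') (hd'' : e'' + d = d'')
    (hh : (h'' : A) = h' * h) :
    locTrans g g' h hd hg ≫ locTrans g' g'' h' hd' hg' =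
      locTrans g g'' h'' hd'' (by rw [hg', hg, hh]; ring) := by
  ext M : 2
  refine loc_hom_ext (fun w k x => ?_)
  rw [NatTrans.comp_app, ev_comp, ev_locTrans, ev_locTrans, ev_locTrans]
  rw [M.act_act _ _ (by rw [← hd'']; ring) _ _ (hpow h'' k) (by simp [hh, mul_pow]) x]

/-- The canonical map `M → M_g`, `x ↦ x / 1`. -/
def toLoc {d : ℤ} (g : 𝒜 d) : 𝟭 (GrMod 𝒜) ⟶ loc g where
  app M := mkHom (M := M) (N := locObj g M)
    (fun w => (frac g M w 0).comp (M.act (by simp) ⟨1, SetLike.GradedOne.one_mem⟩))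
    (fun {i w w'} hw a x => by
      change frac g M w' 0 _ = (locObj g M).act hw a (frac g M w 0 _)
      rw [frac_act]
      congr 1
      exact (M.act_act _ _ (by simpa using hw) ⟨1, SetLike.GradedOne.one_mem⟩ _ a
        (one_mul _).symm x).trans (M.act_act _ _ _ a ⟨1, SetLike.GradedOne.one_mem⟩ a (mul_one _).symm x).symm)
  naturality M N φ := by
    ext w x
    change frac g N w 0 (N.act _ _ (ev φ w x)) = ev ((loc g).map φ) w (frac g M w 0 (M.act _ _ x))
    rw [ev_loc_map, ev_act]

lemma ev_toLoc {d : ℤ} (g : 𝒜 d) (M : GrMod 𝒜) (w : ℤ) (x : M.X w) :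
    ev ((toLoc g).app M) w x =
      frac g M w 0 (M.act (by simp) ⟨1, SetLike.GradedOne.one_mem⟩ x) := rfl

lemma toLoc_comp {d d' e : ℤ} (g : 𝒜 d) (g' : 𝒜 d') (h : 𝒜 e) (hd : e + d = d')
    (hg : (g' : A) = h * g) : toLoc g ≫ locTrans g g' h hd hg = toLoc g' := by
  ext M w x
  rw [NatTrans.comp_app, ev_comp, ev_toLoc, ev_locTrans, ev_toLoc]
  rw [M.act_act _ _ (by simp) _ _ ⟨1, SetLike.GradedOne.one_mem⟩ (by simp) x]

/-- The graded module `∏_{k ≥ 0} M(-k d)`. -/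
def towObj (d : ℤ) (M : GrMod 𝒜) : GrMod 𝒜 where
  X w := ∀ k : ℕ, M.X (w - k * d)
  act {i j l} h a :=
    { toFun := fun x k => M.act (show i + (j - k * d) = l - k * d by omega) a (x k)
      map_zero' := by ext; simp
      map_add' := fun x y => by ext; simp }
  add_act h a b x := by ext; simp [add_act]
  one_act x := by ext; simp [act_one]
  mul_act {i j l m n o} h₁ h₂ h₃ h₄ a b x := funext fun k =>
    M.mul_act h₁ (show l + (m - k * d) = n - k * d by omega)
      (show j + (m - k * d) = o - k * d by omega) (by omega) a b (x k)

/-- The functor `M ↦ ∏_{k ≥ 0} M(-k d)`. -/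
abbrev tow (d : ℤ) : GrMod 𝒜 ⥤ GrMod 𝒜 where
  obj M := towObj d M
  map {M N} φ := mkHom (M := towObj d M) (N := towObj d N)
    (fun w => AddMonoidHom.mk' (fun x k => ev φ (w - k * d) (x k)) (fun x y => by
      funext k; exact map_add _ _ _))
    (fun h a x => by funext k; exact ev_act φ _ a (x k))

lemma ev_tow_map (d : ℤ) {M N : GrMod 𝒜} (φ : M ⟶ N) (w : ℤ) (x : (towObj d M).X w) :
    ev ((tow d).map φ) w x = fun k : ℕ => ev φ (w - k * d) (x k) := rfl

instance (d : ℤ) : (tow (𝒜 := 𝒜) d).Additive where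

/-- The difference map `(x_k) ↦ (x_k - g x_{k+1})` of the tower
`M ← M(-d) ← M(-2d) ← ⋯`, whose transition maps are multiplication by `g`. -/
def towDiff {d : ℤ} (g : 𝒜 d) : tow (𝒜 := 𝒜) d ⟶ tow d where
  app M := mkHom (M := towObj d M) (N := towObj d M)
    (fun w => AddMonoidHom.mk'
      (fun x k => x k - M.act (show d + (w - (k + 1 : ℕ) * d) = w - k * d by push_cast; ring) g
        (x (k + 1)))
      (fun x y => by
        funext k
        change (x k + y k) - M.act _ g (x (k + 1) + y (k + 1)) = (x k - _) + (y k - _)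
        rw [map_add]; abel))
    (fun {i w w'} hw a x => by
      funext k
      change M.act _ a _ - M.act _ g (M.act _ a _) = M.act _ a (_ - M.act _ g _)
      rw [map_sub]
      congr 1
      exact (M.act_act _ _ (by rw [← hw]; push_cast; ring) _ _
        ⟨_, SetLike.GradedMul.mul_mem g.2 a.2⟩ rfl _).trans
        (M.act_act _ _ _ _ _ _ (mul_comm _ _) _).symm)
  naturality M N φ := by
    ext w x
    funext k
    change ev φ _ _ - N.act _ g (ev φ _ _) = ev φ _ (_ - M.act _ g _)
    rw [map_sub, ev_act]

/-- The map of towers given in stage `k` by `h ^ k : M(-k (e + d)) → M(-k d)`. -/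
def towTrans {d d' e : ℤ} (h : 𝒜 e) (hd : e + d = d') : tow (𝒜 := 𝒜) d' ⟶ tow d where
  app M := mkHom (M := towObj d' M) (N := towObj d M)
    (fun w => AddMonoidHom.mk'
      (fun x k => M.act (show _ + (w - k * d') = w - k * d by rw [← hd]; ring) (hpow h k) (x k))
      (fun x y => by funext k; exact map_add _ _ _))
    (fun {i w w'} hw a x => by
      funext k
      change M.act _ _ (M.act _ a _) = M.act _ a (M.act _ _ _)
      exact (M.act_act _ _ (by rw [← hw, ← hd]; ring) _ _
        ⟨_, SetLike.GradedMul.mul_mem (hpow h k).2 a.2⟩ rfl _).trans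
        (M.act_act _ _ _ _ _ _ (mul_comm _ _) _).symm)
  naturality M N φ := by
    ext w x
    funext k
    exact (ev_act φ _ _ _).symm

lemma towTrans_diff {d d' e : ℤ} (g : 𝒜 d) (g' : 𝒜 d') (h : 𝒜 e) (hd : e + d = d')
    (hg : (g' : A) = h * g) :
    towDiff g' ≫ towTrans h hd = towTrans h hd ≫ towDiff g := by
  ext M w x
  funext k
  change M.act _ _ (_ - M.act _ g' _) = M.act _ _ _ - M.act _ g (M.act _ _ _)
  rw [map_sub]
  congr 1
  exact (M.act_act _ _ (by rw [← hd]; push_cast; ring) _ _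
    ⟨_, SetLike.GradedMul.mul_mem (hpow h k).2 g'.2⟩ rfl _).trans
    (M.act_act _ _ _ _ _ _ (by simp [hg]; ring) _).symm

lemma towTrans_id {d e : ℤ} (h : 𝒜 e) (hd : e + d = d) (hh : (h : A) = 1) :
    towTrans h hd = 𝟙 (tow (𝒜 := 𝒜) d) := by
  ext M w x
  funext k
  exact M.act_one _ _ (by simp [hh]) _

lemma towTrans_comp {d d' d'' e e' e'' : ℤ}
    (h : 𝒜 e) (h' : 𝒜 e') (h'' : 𝒜 e'') (hd : e + d = d')
    (hd' : e' + d' = d'') (hd'' : e'' + d = d'') (hh : (h'' : A) = h * h') :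
    towTrans h' hd' ≫ towTrans h hd = towTrans (𝒜 := 𝒜) h'' hd'' := by
  ext M w x
  funext k
  exact M.act_act _ _ _ _ _ _ (by simp [hh, mul_pow]) _

/-- The projection `∏_{k ≥ 0} M(-k d) → M` to the factor `k = 0`. -/
def towZero (d : ℤ) : tow (𝒜 := 𝒜) d ⟶ 𝟭 _ where
  app M := mkHom (M := towObj d M) (N := M)
    (fun w => (M.act (show 0 + (w - (0 : ℕ) * d) = w by simp)
      ⟨1, SetLike.GradedOne.one_mem⟩).comp (Pi.evalAddMonoidHom (fun k : ℕ => M.X (w - k * d)) 0))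
    (fun {i w w'} hw a x => by
      exact (M.act_act _ _ (by simpa using hw) _ _ a (by simp) _).trans
        (M.act_act _ _ _ _ _ _ (by simp) _).symm)
  naturality M N φ := by
    ext w x
    exact (ev_act φ _ _ _).symm

lemma towTrans_zero {d d' e : ℤ} (h : 𝒜 e) (hd : e + d = d') :
    towTrans h hd ≫ towZero d = towZero (𝒜 := 𝒜) d' := by
  ext M w x
  exact M.act_act _ _ _ _ _ _ (by simp) _

end
end GrMod
end

noncomputable section
namespace GrMod
section
variable {C : Type u} [Category.{v} C] [Preadditive C] [HasBinaryBiproducts C]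
open CochainComplex CochainComplex.HomComplex

/-- The mapping cone of a natural transformation between functors on cochain complexes. -/
def coneFunctor {F G : CochainComplex C ℤ ⥤ CochainComplex C ℤ} (α : F ⟶ G) :
    CochainComplex C ℤ ⥤ CochainComplex C ℤ where
  obj K := mappingCone (α.app K)
  map φ := mappingCone.map _ _ (F.map φ) (G.map φ) (α.naturality φ).symm
  map_id K := by
    rw [← mappingCone.map_id]; congr 1 <;> simp
  map_comp φ ψ := by
    rw [← mappingCone.map_comp]; congr 1 <;> simp

/-- The inclusion of the target into the mapping cone. -/
def coneInr {F G : CochainComplex C ℤ ⥤ CochainComplex C ℤ} (α : F ⟶ G) :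
    G ⟶ coneFunctor α where
  app K := mappingCone.inr (α.app K)
  naturality K L φ := by simp [coneFunctor, mappingCone.map]

/-- The map of mapping cocones (mapping cones shifted by `-1`) induced by a commutative square. -/
def cocMap {K₁ L₁ K₂ L₂ : CochainComplex C ℤ} (φ₁ : K₁ ⟶ L₁) (φ₂ : K₂ ⟶ L₂)
    (a : K₁ ⟶ K₂) (b : L₁ ⟶ L₂) (comm : φ₁ ≫ b = a ≫ φ₂) :
    mappingCocone φ₁ ⟶ mappingCocone φ₂ :=
  (CategoryTheory.shiftFunctor (CochainComplex C ℤ) (-1 : ℤ)).map (mappingCone.map φ₁ φ₂ a b comm)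

lemma cocMap_id {K L : CochainComplex C ℤ} (φ : K ⟶ L) :
    cocMap φ φ (𝟙 K) (𝟙 L) (by simp) = 𝟙 _ :=
  (congrArg _ (mappingCone.map_id φ)).trans (CategoryTheory.Functor.map_id _ _)

lemma cocMap_comp {K₁ L₁ K₂ L₂ K₃ L₃ : CochainComplex C ℤ} (φ₁ : K₁ ⟶ L₁) (φ₂ : K₂ ⟶ L₂)
    (φ₃ : K₃ ⟶ L₃) (a : K₁ ⟶ K₂) (b : L₁ ⟶ L₂) (comm : φ₁ ≫ b = a ≫ φ₂)
    (a' : K₂ ⟶ K₃) (b' : L₂ ⟶ L₃) (comm' : φ₂ ≫ b' = a' ≫ φ₃) :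
    cocMap φ₁ φ₂ a b comm ≫ cocMap φ₂ φ₃ a' b' comm' =
      cocMap φ₁ φ₃ (a ≫ a') (b ≫ b') (by rw [reassoc_of% comm, comm', Category.assoc]) :=
  (CategoryTheory.Functor.map_comp _ _ _).symm.trans
    (congrArg _ (mappingCone.map_comp φ₁ φ₂ φ₃ a b comm a' b' comm').symm)

lemma cocone_fst_f {K L : CochainComplex C ℤ} (φ : K ⟶ L) (p : ℤ) :
    (mappingCocone.fst φ).f p = (mappingCone.fst φ).1.v (p + -1) p (by omega) := by
  simp only [mappingCocone.fst, HomologicalComplex.neg_f_apply, Cocycle.homOf_f,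
    Cocycle.leftShift_coe,
    Cochain.leftShift_v (n := 1) _ (-1) 0 (add_neg_cancel 1) p p _ (p + -1) (by omega)]
  simp
  exact (neg_neg (𝟙 _ ≫ (mappingCone.fst φ).1.v (p + -1) p (by omega))).trans
    (Category.id_comp _)

lemma cocMap_fst {K₁ L₁ K₂ L₂ : CochainComplex C ℤ} (φ₁ : K₁ ⟶ L₁) (φ₂ : K₂ ⟶ L₂)
    (a : K₁ ⟶ K₂) (b : L₁ ⟶ L₂) (comm : φ₁ ≫ b = a ≫ φ₂) :
    cocMap φ₁ φ₂ a b comm ≫ mappingCocone.fst φ₂ = mappingCocone.fst φ₁ ≫ a := by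
  ext p
  have h : (mappingCone.map φ₁ φ₂ a b comm).f (p + -1) ≫
      (mappingCone.fst φ₂).1.v (p + -1) p (by omega) =
        (mappingCone.fst φ₁).1.v (p + -1) p (by omega) ≫ a.f p := by
    simp [mappingCone.ext_from_iff _ p (p + -1) (by omega), mappingCone.map]
  rw [HomologicalComplex.comp_f, HomologicalComplex.comp_f, cocone_fst_f, cocone_fst_f]
  exact h

/-- The mapping cocone (mapping cone shifted by `-1`) of a natural transformation between
functors on cochain complexes. -/
def coconeFunctor {F G : CochainComplex C ℤ ⥤ CochainComplex C ℤ} (α : F ⟶ G) :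
    CochainComplex C ℤ ⥤ CochainComplex C ℤ where
  obj K := mappingCocone (α.app K)
  map φ := cocMap _ _ (F.map φ) (G.map φ) (α.naturality φ).symm
  map_id K := by
    rw [← cocMap_id]; congr 1 <;> simp
  map_comp φ ψ := by
    rw [cocMap_comp]; congr 1 <;> simp

/-- The projection of the mapping cocone to the source. -/
def coconeFst {F G : CochainComplex C ℤ ⥤ CochainComplex C ℤ} (α : F ⟶ G) :
    coconeFunctor α ⟶ F where
  app K := mappingCocone.fst (α.app K)
  naturality _ _ φ := cocMap_fst _ _ (F.map φ) (G.map φ) (α.naturality φ).symm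

/-- The map of mapping cocones induced by a commutative square of natural transformations. -/
def coconeMap {F G F' G' : CochainComplex C ℤ ⥤ CochainComplex C ℤ} (α : F ⟶ G) (α' : F' ⟶ G')
    (a : F ⟶ F') (b : G ⟶ G') (h : ∀ K, α.app K ≫ b.app K = a.app K ≫ α'.app K) :
    coconeFunctor α ⟶ coconeFunctor α' where
  app K := cocMap _ _ (a.app K) (b.app K) (h K)
  naturality K L φ := by
    dsimp only [coconeFunctor]
    rw [cocMap_comp, cocMap_comp]
    congr 1 <;> simp

lemma coconeMap_id {F G : CochainComplex C ℤ ⥤ CochainComplex C ℤ} (α : F ⟶ G) :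
    coconeMap α α (𝟙 F) (𝟙 G) (by simp) = 𝟙 _ := by
  ext K : 2
  exact cocMap_id _

lemma coconeMap_comp {F G F' G' F'' G'' : CochainComplex C ℤ ⥤ CochainComplex C ℤ} (α : F ⟶ G)
    (α' : F' ⟶ G') (α'' : F'' ⟶ G'') (a : F ⟶ F') (b : G ⟶ G')
    (h : ∀ K, α.app K ≫ b.app K = a.app K ≫ α'.app K)
    (a' : F' ⟶ F'') (b' : G' ⟶ G'')
    (h' : ∀ K, α'.app K ≫ b'.app K = a'.app K ≫ α''.app K) :
    coconeMap α α' a b h ≫ coconeMap α' α'' a' b' h' =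
      coconeMap α α'' (a ≫ a') (b ≫ b') (fun K => by
        simp only [NatTrans.comp_app]
        rw [reassoc_of% (h K), h', Category.assoc]) := by
  ext K : 2
  exact cocMap_comp _ _ _ _ _ (h K) _ _ (h' K)

lemma coconeMap_fst {F G F' G' : CochainComplex C ℤ ⥤ CochainComplex C ℤ} (α : F ⟶ G)
    (α' : F' ⟶ G') (a : F ⟶ F') (b : G ⟶ G')
    (h : ∀ K, α.app K ≫ b.app K = a.app K ≫ α'.app K) :
    coconeMap α α' a b h ≫ coconeFst α' = coconeFst α ≫ a := by
  ext K : 2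
  exact cocMap_fst _ _ _ _ (h K)

end

section
variable {C : Type u} [Category.{v} C] [Abelian C]
open CochainComplex

/-- A functor on cochain complexes that preserves quasi-isomorphisms. -/
def PreservesQuasiIso (F : CochainComplex C ℤ ⥤ CochainComplex C ℤ) : Prop :=
  ∀ {K L : CochainComplex C ℤ} (φ : K ⟶ L), QuasiIso φ → QuasiIso (F.map φ)

lemma quasiIso_mappingCone_map {K₁ L₁ K₂ L₂ : CochainComplex C ℤ} (φ₁ : K₁ ⟶ L₁) (φ₂ : K₂ ⟶ L₂)
    (a : K₁ ⟶ K₂) (b : L₁ ⟶ L₂) (comm : φ₁ ≫ b = a ≫ φ₂) (ha : QuasiIso a) (hb : QuasiIso b) :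
    QuasiIso (mappingCone.map φ₁ φ₂ a b comm) := by
  let _ := HasDerivedCategory.standard C
  rw [← DerivedCategory.isIso_Q_map_iff_quasiIso] at ha hb ⊢
  exact Pretriangulated.isIso₃_of_isIso₁₂
    (DerivedCategory.Q.mapTriangle.map (mappingCone.triangleMap φ₁ φ₂ a b comm))
    (DerivedCategory.mappingCone_triangle_distinguished _)
    (DerivedCategory.mappingCone_triangle_distinguished _) ha hb

lemma PreservesQuasiIso.cone {F G : CochainComplex C ℤ ⥤ CochainComplex C ℤ} (α : F ⟶ G)
    (hF : PreservesQuasiIso F) (hG : PreservesQuasiIso G) : PreservesQuasiIso (coneFunctor α) :=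
  fun φ h => quasiIso_mappingCone_map _ _ _ _ (α.naturality φ).symm (hF φ h) (hG φ h)

lemma PreservesQuasiIso.cocone {F G : CochainComplex C ℤ ⥤ CochainComplex C ℤ} (α : F ⟶ G)
    (hF : PreservesQuasiIso F) (hG : PreservesQuasiIso G) :
    PreservesQuasiIso (coconeFunctor α) := by
  intro K L φ h
  have h' := PreservesQuasiIso.cone α hF hG φ h
  let _ := HasDerivedCategory.standard C
  rw [← DerivedCategory.isIso_Q_map_iff_quasiIso] at h' ⊢
  have h'' : IsIso ((DerivedCategory.Q ⋙ CategoryTheory.shiftFunctor (DerivedCategory C)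
      (-1 : ℤ)).map ((coneFunctor α).map φ)) :=
    inferInstanceAs (IsIso ((CategoryTheory.shiftFunctor (DerivedCategory C) (-1 : ℤ)).map
      (DerivedCategory.Q.map ((coneFunctor α).map φ))))
  exact (NatIso.isIso_map_iff (DerivedCategory.Q.commShiftIso (-1 : ℤ)) _).2 h''

end
end GrMod
end

noncomputable section
namespace GrMod

/-- The nonempty subsets of `{1, …, r}`, ordered by inclusion. -/
abbrev NSub (r : ℕ) := {S : Finset (Fin r) // S.Nonempty}

/-- The sign `(-1) ^ j` attached to the `j`-th element `i` of `S` (counting from `0`). -/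
def sgn {r : ℕ} (i : Fin r) (S : Finset (Fin r)) : ℤ := (-1) ^ (S.filter (· < i)).card

lemma sgn_insert {r : ℕ} (i : Fin r) (S : Finset (Fin r)) : sgn i (insert i S) = sgn i S := by
  unfold sgn
  rw [Finset.filter_insert, if_neg (lt_irrefl i)]

lemma sgn_erase {r : ℕ} {i j : Fin r} {S : Finset (Fin r)} (hi : i ∈ S) (hj : j ∈ S)
    (hij : i ≠ j) : sgn i S * sgn j (S.erase i) = -(sgn j S * sgn i (S.erase j)) := by
  wlog h : i < j generalizing i j
  · rw [this hj hi hij.symm (lt_of_le_of_ne (not_lt.1 h) hij.symm), neg_neg]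
  unfold sgn
  have h1 : ((S.erase j).filter (· < i)) = S.filter (· < i) := by
    rw [Finset.filter_erase, Finset.erase_eq_of_notMem]
    simp [h.le]
  have h2 : (S.filter (· < j)).card = ((S.erase i).filter (· < j)).card + 1 := by
    rw [Finset.filter_erase, Finset.card_erase_add_one]
    simp [hi, h]
  rw [h1, h2, pow_succ]
  ring

lemma sum_antisymm {r : ℕ} {G : Type*} [AddCommGroup G] (F : Fin r → Fin r → G)
    (h0 : ∀ i, F i i = 0) (h : ∀ i j, i ≠ j → F i j = -F j i) : ∑ i, ∑ j, F i j = 0 := by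
  rw [← Finset.sum_product']
  refine Finset.sum_involution (fun a _ => (a.2, a.1)) ?_ ?_ ?_ ?_
  · rintro ⟨i, j⟩ -
    by_cases hij : i = j
    · subst hij; simp [h0]
    · simp [h i j hij]
  · rintro ⟨i, j⟩ - hne heq
    simp only [Prod.mk.injEq] at heq
    exact hne (by simpa [heq.1] using h0 i)
  · simp
  · simp

section
variable {A : Type u} [CommRing A] {𝒜 : ℤ → AddSubgroup A} [GradedRing 𝒜]

/-- The projection of a product to a factor. -/
def piProj {J : Type} (F : J → GrMod 𝒜) (j : J) : piObj F ⟶ F j :=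
  mkHom (M := piObj F) (fun i => Pi.evalAddMonoidHom (fun j => (F j).X i) j) (fun _ _ _ => rfl)

/-- The morphism to a product with given components. -/
def piLift {J : Type} {F : J → GrMod 𝒜} {M : GrMod 𝒜} (φ : ∀ j, M ⟶ F j) : M ⟶ piObj F :=
  mkHom (M := M) (N := piObj F) (fun i => AddMonoidHom.pi (f := fun j => (F j).X i) fun j => ev (φ j) i)
    (fun h a x => by funext j; exact ev_act (φ j) h a x)

@[simp]
lemma piLift_proj {J : Type} {F : J → GrMod 𝒜} {M : GrMod 𝒜} (φ : ∀ j, M ⟶ F j) (j : J) :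
    piLift φ ≫ piProj F j = φ j := rfl

lemma piExt {J : Type} {F : J → GrMod 𝒜} {M : GrMod 𝒜} {φ ψ : M ⟶ piObj F}
    (h : ∀ j, φ ≫ piProj F j = ψ ≫ piProj F j) : φ = ψ := by
  ext i x
  funext j
  exact congrArg (fun q => ev q i x) (h j)

variable {r : ℕ}

/-- The pairs `(S, q)` such that `X_S ^ q` sits in degree `n` of the total complex, where the
column of `S` is placed in degree `|S| - 1`. -/
abbrev TotIdx (r : ℕ) (n : ℤ) := {p : NSub r × ℤ // p.2 + p.1.1.card = n + 1}

variable (X : NSub r ⥤ CochainComplex (GrMod 𝒜) ℤ)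

/-- The degree `n` part `⨁_{p + q = n} ∏_{|S| = p + 1} X_S ^ q` of the total complex. -/
def totX (n : ℤ) : GrMod 𝒜 :=
  piObj fun p : TotIdx r n => (X.obj p.1.1).X p.1.2

/-- The projection of the total complex to `X_S ^ q`. -/
def totProj (n : ℤ) (S : Finset (Fin r)) (hS : S.Nonempty) (q : ℤ) (hq : q + S.card = n + 1) :
    totX X n ⟶ (X.obj ⟨S, hS⟩).X q :=
  piProj (fun p : TotIdx r n => (X.obj p.1.1).X p.1.2) ⟨(⟨S, hS⟩, q), hq⟩

variable {X} in
/-- The morphism to the total complex with given components. -/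
def totLift {M : GrMod 𝒜} {n : ℤ} (φ : ∀ (S : Finset (Fin r)) (hS : S.Nonempty) (q : ℤ)
    (_ : q + S.card = n + 1), M ⟶ (X.obj ⟨S, hS⟩).X q) : M ⟶ totX X n :=
  piLift fun p => φ p.1.1.1 p.1.1.2 p.1.2 p.2

variable {X} in
lemma totLift_proj {M : GrMod 𝒜} {n : ℤ} (φ : ∀ (S : Finset (Fin r)) (hS : S.Nonempty) (q : ℤ)
    (_ : q + S.card = n + 1), M ⟶ (X.obj ⟨S, hS⟩).X q) (S : Finset (Fin r)) (hS : S.Nonempty)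
    (q : ℤ) (hq : q + S.card = n + 1) : totLift φ ≫ totProj X n S hS q hq = φ S hS q hq := rfl

variable {X} in
lemma totExt {M : GrMod 𝒜} {n : ℤ} {φ ψ : M ⟶ totX X n} (h : ∀ (S : Finset (Fin r))
    (hS : S.Nonempty) (q : ℤ) (hq : q + S.card = n + 1),
    φ ≫ totProj X n S hS q hq = ψ ≫ totProj X n S hS q hq) : φ = ψ :=
  piExt fun p => h p.1.1.1 p.1.1.2 p.1.2 p.2

/-- The component `X_T ^ q → X_S ^ q` (for `T ⊆ S`) on the total complex. -/
def totEnt (n : ℤ) (T S : Finset (Fin r)) (hT : T.Nonempty) (h : T ⊆ S) (q : ℤ)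
    (hq : q + T.card = n + 1) : totX X n ⟶ (X.obj ⟨S, hT.mono h⟩).X q :=
  totProj X n T hT (q) hq ≫
    (X.map (homOfLE (show (⟨T, hT⟩ : NSub r) ≤ ⟨S, hT.mono h⟩ from h))).f q

lemma totEnt_congr (n : ℤ) (T T' S : Finset (Fin r)) (hT : T.Nonempty) (h : T ⊆ S) (q : ℤ)
    (hq : q + T.card = n + 1) (hTT' : T = T') : totEnt X n T S hT h q hq =
      totEnt X n T' S (hTT' ▸ hT) (hTT' ▸ h) q (hTT' ▸ hq) := by
  subst hTT'
  rfl

/-- The differential of the total complex: the component in `X_S ^ q` is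
`∑_j (-1) ^ j (X_{S \ {i_j}} ^ q → X_S ^ q) + (-1) ^ (|S| - 1) d`, where `S = {i_0 < i_1 < ⋯}`. -/
def totD (n m : ℤ) (hnm : n + 1 = m) : totX X n ⟶ totX X m :=
  totLift fun S hS q hq =>
    (∑ i : Fin r, if h : i ∈ S ∧ (S.erase i).Nonempty then
      sgn i S • totEnt X n (S.erase i) S h.2 (Finset.erase_subset _ _) q (by
        have := Finset.card_erase_add_one h.1
        omega) else 0) +
    (-1 : ℤ) ^ (S.card + 1) •
      (totProj X n S hS (q - 1) (by omega) ≫ (X.obj ⟨S, hS⟩).d (q - 1) q)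

lemma totD_proj (n m : ℤ) (hnm : n + 1 = m) (S : Finset (Fin r)) (hS : S.Nonempty) (q q' : ℤ)
    (hq' : q' + 1 = q) (hq : q + S.card = m + 1) :
    totD X n m hnm ≫ totProj X m S hS (q) hq =
    (∑ i : Fin r, if h : i ∈ S ∧ (S.erase i).Nonempty then
      sgn i S • totEnt X n (S.erase i) S h.2 (Finset.erase_subset _ _) q (by
        have := Finset.card_erase_add_one h.1
        omega) else 0) +
    (-1 : ℤ) ^ (S.card + 1) •
      (totProj X n S hS q' (by omega) ≫ (X.obj ⟨S, hS⟩).d q' q) := by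
  obtain rfl : q' = q - 1 := by omega
  rfl

lemma totD_ent (n m : ℤ) (hnm : n + 1 = m) (T S : Finset (Fin r)) (hT : T.Nonempty) (h : T ⊆ S)
    (q q' : ℤ) (hq' : q' + 1 = q) (hq : q + T.card = m + 1) :
    totD X n m hnm ≫ totEnt X m T S hT h q hq =
    (∑ i : Fin r, if h' : i ∈ T ∧ (T.erase i).Nonempty then
      sgn i T • totEnt X n (T.erase i) S h'.2 ((Finset.erase_subset _ _).trans h) q (by
        have := Finset.card_erase_add_one h'.1
        omega) else 0) +
    (-1 : ℤ) ^ (T.card + 1) •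
      (totEnt X n T S hT h q' (by omega) ≫ (X.obj ⟨S, hT.mono h⟩).d q' q) := by
  unfold totEnt
  rw [← Category.assoc, totD_proj X n m hnm T hT q q' hq' hq, Preadditive.add_comp,
    Preadditive.sum_comp, Preadditive.zsmul_comp]
  congr 1
  · refine Finset.sum_congr rfl (fun i _ => ?_)
    split_ifs with h'
    · rw [Preadditive.zsmul_comp]
      congr 1
      unfold totEnt
      rw [Category.assoc, ← HomologicalComplex.comp_f, ← X.map_comp]
      rfl
    · rw [zero_comp]
  · congr 1
    rw [Category.assoc, Category.assoc, HomologicalComplex.Hom.comm]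

lemma totD_comp (n m l : ℤ) (hnm : n + 1 = m) (hml : m + 1 = l) :
    totD X n m hnm ≫ totD X m l hml = 0 := by
  refine totExt fun S hS q hq => ?_
  have hq0 : q + (S.card : ℤ) = l + 1 := hq
  rw [Category.assoc, totD_proj X m l hml S hS q (q - 1) (by omega) hq, zero_comp,
    Preadditive.comp_add, Preadditive.comp_sum, Preadditive.comp_zsmul, ← Category.assoc,
    totD_proj X n m hnm S hS (q - 1) (q - 1 - 1) (by omega) (by omega)]
  have h1 : ∀ i : Fin r, totD X n m hnm ≫ (if h : i ∈ S ∧ (S.erase i).Nonempty then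
      sgn i S • totEnt X m (S.erase i) S h.2 (Finset.erase_subset _ _) q (by
        have := Finset.card_erase_add_one h.1
        omega) else 0) =
      (∑ j : Fin r, if h : i ∈ S ∧ j ∈ S.erase i ∧ ((S.erase i).erase j).Nonempty then
        (sgn i S * sgn j (S.erase i)) • totEnt X n ((S.erase i).erase j) S h.2.2
          ((Finset.erase_subset _ _).trans (Finset.erase_subset _ _)) q (by
            have := Finset.card_erase_add_one h.1
            have := Finset.card_erase_add_one h.2.1
            omega) else 0) +
      (if h : i ∈ S ∧ (S.erase i).Nonempty then
        ((-1 : ℤ) ^ S.card * sgn i S) • (totEnt X n (S.erase i) S h.2 (Finset.erase_subset _ _)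
          (q - 1) (by
            have := Finset.card_erase_add_one h.1
            omega) ≫ (X.obj ⟨S, hS⟩).d (q - 1) q) else 0) := by
    intro i
    by_cases h : i ∈ S ∧ (S.erase i).Nonempty
    · rw [dif_pos h, dif_pos h, Preadditive.comp_zsmul,
        totD_ent X n m hnm _ S h.2 _ q (q - 1) (by omega), smul_add, Finset.smul_sum]
      congr 1
      · refine Finset.sum_congr rfl (fun j _ => ?_)
        by_cases h' : j ∈ S.erase i ∧ ((S.erase i).erase j).Nonempty
        · rw [dif_pos h', dif_pos ⟨h.1, h'⟩, smul_smul]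
        · rw [dif_neg h', dif_neg (fun hh => h' hh.2), smul_zero]
      · have e : sgn i S * (-1 : ℤ) ^ ((S.erase i).card + 1) = (-1) ^ S.card * sgn i S := by
          rw [Finset.card_erase_add_one h.1, mul_comm]
        rw [smul_smul, e]
    · rw [dif_neg h, dif_neg h, comp_zero, add_zero]
      symm
      refine Finset.sum_eq_zero (fun j _ => dif_neg (fun hh => h ⟨hh.1, ⟨j, hh.2.1⟩⟩))
  simp only [h1, Finset.sum_add_distrib]
  rw [sum_antisymm, zero_add, Preadditive.add_comp, smul_add, Preadditive.sum_comp,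
    Finset.smul_sum, Preadditive.zsmul_comp, Category.assoc, HomologicalComplex.d_comp_d,
    comp_zero, smul_zero, smul_zero, add_zero, ← Finset.sum_add_distrib]
  · refine Finset.sum_eq_zero (fun i _ => ?_)
    by_cases h : i ∈ S ∧ (S.erase i).Nonempty
    · rw [dif_pos h, dif_pos h, Preadditive.zsmul_comp, smul_smul, ← add_smul]
      rw [pow_succ]
      ring_nf
      simp
    · rw [dif_neg h, dif_neg h, zero_comp, smul_zero, add_zero]
  · intro i
    exact dif_neg (fun h => Finset.notMem_erase i S h.2.1)
  · intro i j hij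
    by_cases h : i ∈ S ∧ j ∈ S.erase i ∧ ((S.erase i).erase j).Nonempty
    · have h' : j ∈ S ∧ i ∈ S.erase j ∧ ((S.erase j).erase i).Nonempty :=
        ⟨Finset.mem_of_mem_erase h.2.1, Finset.mem_erase.2 ⟨hij, h.1⟩, by
          rw [Finset.erase_right_comm]; exact h.2.2⟩
      rw [dif_pos h, dif_pos h', sgn_erase h.1 h'.1 hij, neg_smul]
      rw [totEnt_congr X n _ _ S _ _ q _ (Finset.erase_right_comm (a := i) (b := j))]
    · have h' : ¬ (j ∈ S ∧ i ∈ S.erase j ∧ ((S.erase j).erase i).Nonempty) := by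
        intro h'
        exact h ⟨Finset.mem_of_mem_erase h'.2.1, Finset.mem_erase.2 ⟨hij.symm, h'.1⟩, by
          rw [Finset.erase_right_comm]; exact h'.2.2⟩
      rw [dif_neg h, dif_neg h', neg_zero]

/-- The total complex of the double complex
`∏_{|S| = 1} X_S → ∏_{|S| = 2} X_S → ⋯ → X_{{1, …, r}}` attached to a covariant diagram `X` of
complexes indexed by the nonempty subsets of `{1, …, r}`. -/
def tot : CochainComplex (GrMod 𝒜) ℤ where
  X := totX X
  d n m := if h : n + 1 = m then totD X n m h else 0
  shape n m h := dif_neg h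
  d_comp_d' n m l (hnm : n + 1 = m) (hml : m + 1 = l) := by
    rw [dif_pos hnm, dif_pos hml, totD_comp]

lemma tot_d (n m : ℤ) (h : n + 1 = m) : (tot X).d n m = totD X n m h := dif_pos h

variable {X} {Y Z : NSub r ⥤ CochainComplex (GrMod 𝒜) ℤ}

/-- The map in degree `n` on total complexes. -/
def totMapF (α : X ⟶ Y) (n : ℤ) : totX X n ⟶ totX Y n :=
  totLift fun S hS q hq => totProj X n S hS q hq ≫ (α.app ⟨S, hS⟩).f q

lemma totMapF_proj (α : X ⟶ Y) (n : ℤ) (S : Finset (Fin r)) (hS : S.Nonempty) (q : ℤ)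
    (hq : q + S.card = n + 1) : totMapF α n ≫ totProj Y n S hS q hq =
      totProj X n S hS q hq ≫ (α.app ⟨S, hS⟩).f q := rfl

lemma totMapF_proj_assoc (α : X ⟶ Y) (n : ℤ) (S : Finset (Fin r)) (hS : S.Nonempty) (q : ℤ)
    (hq : q + S.card = n + 1) {M : GrMod 𝒜} (g : (Y.obj ⟨S, hS⟩).X q ⟶ M) :
    totMapF α n ≫ totProj Y n S hS q hq ≫ g =
      totProj X n S hS q hq ≫ (α.app ⟨S, hS⟩).f q ≫ g := rfl

lemma totMapF_ent (α : X ⟶ Y) (n : ℤ) (T S : Finset (Fin r)) (hT : T.Nonempty) (h : T ⊆ S)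
    (q : ℤ) (hq : q + T.card = n + 1) :
    totMapF α n ≫ totEnt Y n T S hT h q hq =
      totEnt X n T S hT h q hq ≫ (α.app ⟨S, hT.mono h⟩).f q := by
  unfold totEnt
  rw [totMapF_proj_assoc, Category.assoc, ← HomologicalComplex.comp_f, ← α.naturality]
  rfl

lemma totMapF_comm (α : X ⟶ Y) (n m : ℤ) (hnm : n + 1 = m) :
    totMapF α n ≫ totD Y n m hnm = totD X n m hnm ≫ totMapF α m := by
  refine totExt fun S hS q hq => ?_
  rw [Category.assoc, Category.assoc, totD_proj Y n m hnm S hS q (q - 1) (by omega) hq,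
    totMapF_proj, ← Category.assoc, totD_proj X n m hnm S hS q (q - 1) (by omega) hq,
    Preadditive.comp_add, Preadditive.add_comp, Preadditive.comp_sum, Preadditive.sum_comp,
    Preadditive.comp_zsmul, Preadditive.zsmul_comp]
  congr 1
  · refine Finset.sum_congr rfl (fun i _ => ?_)
    split_ifs with h
    · rw [Preadditive.comp_zsmul, Preadditive.zsmul_comp, totMapF_ent]
    · rw [zero_comp, comp_zero]
  · rw [totMapF_proj_assoc, Category.assoc, HomologicalComplex.Hom.comm]

/-- Functoriality of the total complex. -/
def totFunctor (𝒜 : ℤ → AddSubgroup A) [GradedRing 𝒜] (r : ℕ) :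
    (NSub r ⥤ CochainComplex (GrMod 𝒜) ℤ) ⥤ CochainComplex (GrMod 𝒜) ℤ where
  obj X := tot X
  map α :=
    { f := totMapF α
      comm' := fun n m (h : n + 1 = m) => by
        rw [tot_d _ _ _ h, tot_d _ _ _ h]
        exact totMapF_comm α n m h }
  map_id X := by ext n : 1; rfl
  map_comp α β := by ext n : 1; rfl

/-- The pairs `(S, q)` such that `X_S ^ q` sits in degree `n` of the total complex, where the
column of `S` is placed in degree `1 - |S|`. -/
abbrev CotIdx (r : ℕ) (n : ℤ) := {p : NSub r × ℤ // p.2 + 1 = n + p.1.1.card}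

variable (X' Y' : (NSub r)ᵒᵖ ⥤ CochainComplex (GrMod 𝒜) ℤ)

/-- The degree `n` part `⨁_{q - p = n} ∏_{|S| = p + 1} X_S ^ q` of the total complex. -/
def cotX (n : ℤ) : GrMod 𝒜 :=
  piObj fun p : CotIdx r n => (X'.obj (Opposite.op p.1.1)).X p.1.2

/-- The projection of the total complex to `X_S ^ q`. -/
def cotProj (n : ℤ) (S : Finset (Fin r)) (hS : S.Nonempty) (q : ℤ) (hq : q + 1 = n + S.card) :
    cotX X' n ⟶ (X'.obj (Opposite.op ⟨S, hS⟩)).X q :=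
  piProj (fun p : CotIdx r n => (X'.obj (Opposite.op p.1.1)).X p.1.2) ⟨(⟨S, hS⟩, q), hq⟩

variable {X'} in
/-- The morphism to the total complex with given components. -/
def cotLift {M : GrMod 𝒜} {n : ℤ} (φ : ∀ (S : Finset (Fin r)) (hS : S.Nonempty) (q : ℤ)
    (_ : q + 1 = n + S.card), M ⟶ (X'.obj (Opposite.op ⟨S, hS⟩)).X q) : M ⟶ cotX X' n :=
  piLift fun p => φ p.1.1.1 p.1.1.2 p.1.2 p.2

variable {X'} in
lemma cotLift_proj {M : GrMod 𝒜} {n : ℤ} (φ : ∀ (S : Finset (Fin r)) (hS : S.Nonempty) (q : ℤ)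
    (_ : q + 1 = n + S.card), M ⟶ (X'.obj (Opposite.op ⟨S, hS⟩)).X q) (S : Finset (Fin r))
    (hS : S.Nonempty) (q : ℤ) (hq : q + 1 = n + S.card) :
    cotLift φ ≫ cotProj X' n S hS q hq = φ S hS q hq := rfl

variable {X'} in
lemma cotExt {M : GrMod 𝒜} {n : ℤ} {φ ψ : M ⟶ cotX X' n} (h : ∀ (S : Finset (Fin r))
    (hS : S.Nonempty) (q : ℤ) (hq : q + 1 = n + S.card),
    φ ≫ cotProj X' n S hS q hq = ψ ≫ cotProj X' n S hS q hq) : φ = ψ :=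
  piExt fun p => h p.1.1.1 p.1.1.2 p.1.2 p.2

/-- The component `X_T ^ q → X_S ^ q` (for `S ⊆ T`) on the total complex. -/
def cotEnt (n : ℤ) (T S : Finset (Fin r)) (hS : S.Nonempty) (h : S ⊆ T) (q : ℤ)
    (hq : q + 1 = n + T.card) : cotX X' n ⟶ (X'.obj (Opposite.op ⟨S, hS⟩)).X q :=
  cotProj X' n T (hS.mono h) (q) hq ≫
    (X'.map (homOfLE (show (⟨S, hS⟩ : NSub r) ≤ ⟨T, hS.mono h⟩ from h)).op).f q

lemma cotEnt_congr (n : ℤ) (T T' S : Finset (Fin r)) (hS : S.Nonempty) (h : S ⊆ T) (q : ℤ)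
    (hq : q + 1 = n + T.card) (hTT' : T = T') : cotEnt X' n T S hS h q hq =
      cotEnt X' n T' S hS (hTT' ▸ h) q (hTT' ▸ hq) := by
  subst hTT'
  rfl

/-- The differential of the total complex: the component in `X_S ^ q` is
`∑_{i ∉ S} (-1) ^ j (X_{S ∪ {i}} ^ q → X_S ^ q) + (-1) ^ (|S| - 1) d`, where `j` is the position
of `i` in `S ∪ {i}`, counting from `0`. -/
def cotD (n m : ℤ) (hnm : n + 1 = m) : cotX X' n ⟶ cotX X' m :=
  cotLift fun S hS q hq =>
    (∑ i : Fin r, if h : i ∉ S then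
      sgn i (insert i S) • cotEnt X' n (insert i S) S hS (Finset.subset_insert _ _) q (by
        have := Finset.card_insert_of_notMem h
        omega) else 0) +
    (-1 : ℤ) ^ (S.card + 1) •
      (cotProj X' n S hS (q - 1) (by omega) ≫ (X'.obj (Opposite.op ⟨S, hS⟩)).d (q - 1) q)

lemma cotD_proj (n m : ℤ) (hnm : n + 1 = m) (S : Finset (Fin r)) (hS : S.Nonempty) (q q' : ℤ)
    (hq' : q' + 1 = q) (hq : q + 1 = m + S.card) :
    cotD X' n m hnm ≫
      cotProj X' m S (hS) (q) hq =
    (∑ i : Fin r, if h : i ∉ S then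
      sgn i (insert i S) • cotEnt X' n (insert i S) S hS (Finset.subset_insert _ _) q (by
        have := Finset.card_insert_of_notMem h
        omega) else 0) +
    (-1 : ℤ) ^ (S.card + 1) •
      (cotProj X' n S hS q' (by omega) ≫ (X'.obj (Opposite.op ⟨S, hS⟩)).d q' q) := by
  obtain rfl : q' = q - 1 := by omega
  rfl

lemma cotD_ent (n m : ℤ) (hnm : n + 1 = m) (T S : Finset (Fin r)) (hS : S.Nonempty) (h : S ⊆ T)
    (q q' : ℤ) (hq' : q' + 1 = q) (hq : q + 1 = m + T.card) :
    cotD X' n m hnm ≫ cotEnt X' m T S hS h q hq =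
    (∑ i : Fin r, if h' : i ∉ T then
      sgn i (insert i T) • cotEnt X' n (insert i T) S hS (h.trans (Finset.subset_insert _ _)) q (by
        have := Finset.card_insert_of_notMem h'
        omega) else 0) +
    (-1 : ℤ) ^ (T.card + 1) •
      (cotEnt X' n T S hS h q' (by omega) ≫ (X'.obj (Opposite.op ⟨S, hS⟩)).d q' q) := by
  unfold cotEnt
  rw [← Category.assoc, cotD_proj X' n m hnm T (hS.mono h) q q' hq' hq, Preadditive.add_comp,
    Preadditive.sum_comp, Preadditive.zsmul_comp]
  congr 1
  · refine Finset.sum_congr rfl (fun i _ => ?_)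
    by_cases h' : i ∉ T
    · rw [dif_pos h', dif_pos h', Preadditive.zsmul_comp]
      congr 1
      unfold cotEnt
      rw [Category.assoc, ← HomologicalComplex.comp_f, ← X'.map_comp]
      rfl
    · rw [dif_neg h', dif_neg h', zero_comp]
  · congr 1
    rw [Category.assoc, Category.assoc, HomologicalComplex.Hom.comm]

lemma cotD_comp (n m l : ℤ) (hnm : n + 1 = m) (hml : m + 1 = l) :
    cotD X' n m hnm ≫ cotD X' m l hml = 0 := by
  refine cotExt fun S hS q hq => ?_
  have hq0 : q + 1 = l + (S.card : ℤ) := hq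
  rw [Category.assoc, cotD_proj X' m l hml S hS q (q - 1) (by omega) hq, zero_comp,
    Preadditive.comp_add, Preadditive.comp_sum, Preadditive.comp_zsmul, ← Category.assoc,
    cotD_proj X' n m hnm S hS (q - 1) (q - 1 - 1) (by omega) (by omega)]
  have h1 : ∀ i : Fin r, cotD X' n m hnm ≫ (if h : i ∉ S then
      sgn i (insert i S) • cotEnt X' m (insert i S) S hS (Finset.subset_insert _ _) q (by
        have := Finset.card_insert_of_notMem h
        omega) else 0) =
      (∑ j : Fin r, if h : i ∉ S ∧ j ∉ insert i S then
        (sgn i (insert i S) * sgn j (insert j (insert i S))) •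
          cotEnt X' n (insert j (insert i S)) S hS
          ((Finset.subset_insert _ _).trans (Finset.subset_insert _ _)) q (by
            have := Finset.card_insert_of_notMem h.1
            have := Finset.card_insert_of_notMem h.2
            omega) else 0) +
      (if h : i ∉ S then
        ((-1 : ℤ) ^ S.card * sgn i (insert i S)) • (cotEnt X' n (insert i S) S hS
          (Finset.subset_insert _ _) (q - 1) (by
            have := Finset.card_insert_of_notMem h
            omega) ≫ (X'.obj (Opposite.op ⟨S, hS⟩)).d (q - 1) q) else 0) := by
    intro i
    by_cases h : i ∉ S
    · rw [dif_pos h, dif_pos h, Preadditive.comp_zsmul,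
        cotD_ent X' n m hnm _ S hS _ q (q - 1) (by omega), smul_add, Finset.smul_sum]
      congr 1
      · refine Finset.sum_congr rfl (fun j _ => ?_)
        by_cases h' : j ∉ insert i S
        · rw [dif_pos h', dif_pos ⟨h, h'⟩, smul_smul]
        · rw [dif_neg h', dif_neg (fun hh => h' hh.2), smul_zero]
      · have e : sgn i (insert i S) * (-1 : ℤ) ^ ((insert i S).card + 1) =
            (-1) ^ S.card * sgn i (insert i S) := by
          rw [Finset.card_insert_of_notMem h, mul_comm, pow_succ, pow_succ]
          simp
        rw [smul_smul, e]
    · rw [dif_neg h, dif_neg h, comp_zero, add_zero]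
      symm
      refine Finset.sum_eq_zero (fun j _ => dif_neg (fun hh => h hh.1))
  simp only [h1, Finset.sum_add_distrib]
  rw [sum_antisymm, zero_add, Preadditive.add_comp, smul_add, Preadditive.sum_comp,
    Finset.smul_sum, Preadditive.zsmul_comp, Category.assoc, HomologicalComplex.d_comp_d,
    comp_zero, smul_zero, smul_zero, add_zero, ← Finset.sum_add_distrib]
  · refine Finset.sum_eq_zero (fun i _ => ?_)
    by_cases h : i ∉ S
    · rw [dif_pos h, dif_pos h, Preadditive.zsmul_comp, smul_smul, ← add_smul]
      rw [pow_succ]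
      ring_nf
      simp
    · rw [dif_neg h, dif_neg h, zero_comp, smul_zero, add_zero]
  · intro i
    exact dif_neg (fun h => h.2 (Finset.mem_insert_self i S))
  · intro i j hij
    by_cases h : i ∉ S ∧ j ∉ insert i S
    · have hj : j ∉ S := fun hh => h.2 (Finset.mem_insert_of_mem hh)
      have h' : j ∉ S ∧ i ∉ insert j S := ⟨hj, fun hh => (Finset.mem_insert.1 hh).elim hij h.1⟩
      have hs : sgn i (insert i S) * sgn j (insert j (insert i S)) =
          -(sgn j (insert j S) * sgn i (insert i (insert j S))) := by
        have e := sgn_erase (S := insert j (insert i S)) (i := i) (j := j) (by simp) (by simp) hij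
        have e1 : (insert j (insert i S)).erase i = insert j S := by
          rw [Finset.insert_comm, Finset.erase_insert h'.2]
        rw [Finset.erase_insert h.2, e1] at e
        rw [Finset.insert_comm i j S, mul_comm, mul_comm (sgn j (insert j S)), e, neg_neg]
      rw [dif_pos h, dif_pos h', hs, neg_smul]
      rw [cotEnt_congr X' n _ _ S _ _ q _ (Finset.insert_comm j i S)]
    · have h' : ¬ (j ∉ S ∧ i ∉ insert j S) := by
        intro h'
        exact h ⟨fun hh => h'.2 (Finset.mem_insert_of_mem hh),
          fun hh => (Finset.mem_insert.1 hh).elim (fun e => hij e.symm) h'.1⟩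
      rw [dif_neg h, dif_neg h', neg_zero]

/-- The total complex of the double complex
`∏_{|S| = 1} X_S ← ∏_{|S| = 2} X_S ← ⋯ ← X_{{1, …, r}}` attached to a contravariant diagram `X` of
complexes indexed by the nonempty subsets of `{1, …, r}`. -/
def cot : CochainComplex (GrMod 𝒜) ℤ where
  X := cotX X'
  d n m := if h : n + 1 = m then cotD X' n m h else 0
  shape n m h := dif_neg h
  d_comp_d' n m l (hnm : n + 1 = m) (hml : m + 1 = l) := by
    rw [dif_pos hnm, dif_pos hml, cotD_comp]

lemma cot_d (n m : ℤ) (h : n + 1 = m) : (cot X').d n m = cotD X' n m h := dif_pos h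

variable {X' Y'}

/-- The map in degree `n` on total complexes. -/
def cotMapF (α : X' ⟶ Y') (n : ℤ) : cotX X' n ⟶ cotX Y' n :=
  cotLift fun S hS q hq => cotProj X' n S hS q hq ≫ (α.app (Opposite.op ⟨S, hS⟩)).f q

lemma cotMapF_proj (α : X' ⟶ Y') (n : ℤ) (S : Finset (Fin r)) (hS : S.Nonempty) (q : ℤ)
    (hq : q + 1 = n + S.card) : cotMapF α n ≫ cotProj Y' n S hS q hq =
      cotProj X' n S hS q hq ≫ (α.app (Opposite.op ⟨S, hS⟩)).f q := rfl

lemma cotMapF_proj_assoc (α : X' ⟶ Y') (n : ℤ) (S : Finset (Fin r)) (hS : S.Nonempty) (q : ℤ)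
    (hq : q + 1 = n + S.card) {M : GrMod 𝒜} (g : (Y'.obj (Opposite.op ⟨S, hS⟩)).X q ⟶ M) :
    cotMapF α n ≫ cotProj Y' n S hS q hq ≫ g =
      cotProj X' n S hS q hq ≫ (α.app (Opposite.op ⟨S, hS⟩)).f q ≫ g := rfl

lemma cotMapF_ent (α : X' ⟶ Y') (n : ℤ) (T S : Finset (Fin r)) (hS : S.Nonempty) (h : S ⊆ T)
    (q : ℤ) (hq : q + 1 = n + T.card) :
    cotMapF α n ≫ cotEnt Y' n T S hS h q hq =
      cotEnt X' n T S hS h q hq ≫ (α.app (Opposite.op ⟨S, hS⟩)).f q := by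
  unfold cotEnt
  rw [cotMapF_proj_assoc, Category.assoc, ← HomologicalComplex.comp_f, ← α.naturality]
  rfl

lemma cotMapF_comm (α : X' ⟶ Y') (n m : ℤ) (hnm : n + 1 = m) :
    cotMapF α n ≫ cotD Y' n m hnm = cotD X' n m hnm ≫ cotMapF α m := by
  refine cotExt fun S hS q hq => ?_
  rw [Category.assoc, Category.assoc, cotD_proj Y' n m hnm S hS q (q - 1) (by omega) hq,
    cotMapF_proj, ← Category.assoc, cotD_proj X' n m hnm S hS q (q - 1) (by omega) hq,
    Preadditive.comp_add, Preadditive.add_comp, Preadditive.comp_sum, Preadditive.sum_comp,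
    Preadditive.comp_zsmul, Preadditive.zsmul_comp]
  congr 1
  · refine Finset.sum_congr rfl (fun i _ => ?_)
    by_cases h : i ∉ S
    · rw [dif_pos h, dif_pos h, Preadditive.comp_zsmul, Preadditive.zsmul_comp, cotMapF_ent]
    · rw [dif_neg h, dif_neg h, zero_comp, comp_zero]
  · rw [cotMapF_proj_assoc, Category.assoc, HomologicalComplex.Hom.comm]

/-- Functoriality of the total complex. -/
def cotFunctor (𝒜 : ℤ → AddSubgroup A) [GradedRing 𝒜] (r : ℕ) :
    ((NSub r)ᵒᵖ ⥤ CochainComplex (GrMod 𝒜) ℤ) ⥤ CochainComplex (GrMod 𝒜) ℤ where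
  obj X := cot X
  map α :=
    { f := cotMapF α
      comm' := fun n m (h : n + 1 = m) => by
        rw [cot_d _ _ _ h, cot_d _ _ _ h]
        exact cotMapF_comm α n m h }
  map_id X := by ext n : 1; rfl
  map_comp α β := by ext n : 1; rfl

end
end GrMod
end

noncomputable section
namespace GrMod
section
variable {A : Type u} [CommRing A] {𝒜 : ℤ → AddSubgroup A} [GradedRing 𝒜]

/-- Evaluation of morphisms as a homomorphism. -/
def evHom (M N : GrMod 𝒜) (i : ℤ) (x : M.X i) : (M ⟶ N) →+ N.X i :=
  AddMonoidHom.mk' (fun φ => ev φ i x) (fun _ _ => rfl)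

lemma ev_sum {M N : GrMod 𝒜} {J : Type*} (s : Finset J) (φ : J → (M ⟶ N)) (i : ℤ) (x : M.X i) :
    ev (∑ j ∈ s, φ j) i x = ∑ j ∈ s, ev (φ j) i x := map_sum (evHom M N i x) φ s

lemma ev_zsmul {M N : GrMod 𝒜} (k : ℤ) (φ : M ⟶ N) (i : ℤ) (x : M.X i) :
    ev (k • φ) i x = k • ev φ i x := map_zsmul (evHom M N i x) k φ

lemma ev_d_d (K : CochainComplex (GrMod 𝒜) ℤ) (p q r i : ℤ) (x : (K.X p).X i) :
    ev (K.d q r) i (ev (K.d p q) i x) = 0 := by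
  rw [← ev_comp, K.d_comp_d, ev_zero]

lemma ev_comm {K L : CochainComplex (GrMod 𝒜) ℤ} (φ : K ⟶ L) (p q i : ℤ) (x : (K.X p).X i) :
    ev (φ.f q) i (ev (K.d p q) i x) = ev (L.d p q) i (ev (φ.f p) i x) := by
  rw [← ev_comp, ← ev_comp, φ.comm]

/-- A morphism is a quasi-isomorphism if cocycles of the mapping cone can be moved up an
exhaustive and finite filtration. -/
lemma quasiIso_of_filtration {K L : CochainComplex (GrMod 𝒜) ℤ} (φ : K ⟶ L)
    (F : ℕ → ∀ r i, (K.X r).X i → Prop) (G : ℕ → ∀ q i, (L.X q).X i → Prop)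
    (F0 : ∀ r i x, F 0 r i x) (G0 : ∀ q i y, G 0 q i y) (N : ℕ)
    (FN : ∀ r i x, F N r i x → x = 0) (GN : ∀ q i y, G N q i y → y = 0)
    (step : ∀ (k : ℕ) (p q r : ℤ) (_ : p + 1 = q) (_ : q + 1 = r) (i : ℤ)
      (x : (K.X r).X i) (y : (L.X q).X i), ev (K.d r (r + 1)) i x = 0 →
      ev (φ.f r) i x = ev (L.d q r) i y → F k r i x → G k q i y →
      ∃ (x' : (K.X q).X i) (y' : (L.X p).X i), F (k + 1) r i (x - ev (K.d q r) i x') ∧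
        G (k + 1) q i (y - ev (φ.f q) i x' - ev (L.d p q) i y')) : QuasiIso φ := by
  rw [quasiIso_iff]
  intro p q r hp hr i x y hx hxy
  have main : ∀ k : ℕ, ∃ (x' : (K.X q).X i) (y' : (L.X p).X i),
      F k r i (x - ev (K.d q r) i x') ∧
        G k q i (y - ev (φ.f q) i x' - ev (L.d p q) i y') := by
    intro k
    induction k with
    | zero => exact ⟨0, 0, F0 _ _ _, G0 _ _ _⟩
    | succ k ih =>
      obtain ⟨x', y', h1, h2⟩ := ih
      obtain ⟨x'', y'', h3, h4⟩ := step k p q r hp hr i _ _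
        (by rw [map_sub, hx, ev_d_d, sub_zero])
        (by rw [map_sub, map_sub, map_sub, hxy, ev_comm, ev_d_d, sub_zero]) h1 h2
      refine ⟨x' + x'', y' + y'', ?_, ?_⟩
      · rwa [map_add, ← sub_sub]
      · rw [map_add, map_add]
        convert h4 using 1
        abel
  obtain ⟨x', y', h1, h2⟩ := main N
  refine ⟨x', y', (sub_eq_zero.1 (FN _ _ _ h1)).symm, ?_⟩
  have := GN _ _ _ h2
  rw [sub_sub, sub_eq_zero] at this
  exact this.symm

variable {r : ℕ}

section
variable {X Y : NSub r ⥤ CochainComplex (GrMod 𝒜) ℤ}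

lemma ev_totD (n m : ℤ) (hnm : n + 1 = m) (S : Finset (Fin r)) (hS : S.Nonempty) (q q' : ℤ)
    (hq' : q' + 1 = q) (hq : q + S.card = m + 1) (i : ℤ) (x : (totX X n).X i)
    (hx : ∀ (T : Finset (Fin r)) (hT : T.Nonempty) (q) (hq), T.card < S.card →
      ev (totProj X n T hT q hq) i x = 0) :
    ev (totProj X m S hS q hq) i (ev (totD X n m hnm) i x) =
      (-1 : ℤ) ^ (S.card + 1) • ev ((X.obj ⟨S, hS⟩).d q' q) i
        (ev (totProj X n S hS q' (by omega)) i x) := by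
  have h := congrArg (fun φ => ev φ i x) (totD_proj X n m hnm S hS q q' hq' hq)
  refine h.trans ?_
  simp only [ev_add, ev_sum, ev_zsmul, ev_comp]
  rw [Finset.sum_eq_zero, zero_add]
  intro j _
  split_ifs with hj
  · rw [ev_zsmul, totEnt, ev_comp, hx _ _ _ _ (Finset.card_erase_lt_of_mem hj.1), map_zero,
      smul_zero]
  · rfl

/-- The total complex preserves columnwise quasi-isomorphisms. -/
lemma quasiIso_tot (α : X ⟶ Y) (h : ∀ S, QuasiIso (α.app S)) :
    QuasiIso ((totFunctor 𝒜 r).map α) := by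
  have sq : ∀ k : ℕ, ((-1 : ℤ) ^ k) * (-1) ^ k = 1 := fun k => by rw [← mul_pow]; simp
  refine quasiIso_of_filtration _
    (fun k n i x => ∀ (T : Finset (Fin r)) (hT : T.Nonempty) (q) (hq), T.card < k →
      ev (totProj X n T hT q hq) i x = 0)
    (fun k n i x => ∀ (T : Finset (Fin r)) (hT : T.Nonempty) (q) (hq), T.card < k →
      ev (totProj Y n T hT q hq) i x = 0)
    (fun _ _ _ _ _ _ _ h => absurd h (Nat.not_lt_zero _))
    (fun _ _ _ _ _ _ _ h => absurd h (Nat.not_lt_zero _)) (r + 1) ?_ ?_ ?_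
  · intro n i x hx
    funext p
    exact hx p.1.1.1 p.1.1.2 p.1.2 p.2 (Nat.lt_succ_of_le (card_finset_fin_le _))
  · intro n i x hx
    funext p
    exact hx p.1.1.1 p.1.1.2 p.1.2 p.2 (Nat.lt_succ_of_le (card_finset_fin_le _))
  · intro k p q n hp hn i (x : (totX X n).X i) (y : (totX Y q).X i) hx hxy hxk hyk
    replace hx : ev (totD X n (n + 1) rfl) i x = 0 := by rw [← tot_d]; exact hx
    replace hxy : ev (totMapF α n) i x = ev (totD Y q n hn) i y := by rw [← tot_d]; exact hxy
    have key : ∀ (S : Finset (Fin r)) (hS : S.Nonempty), S.card = k →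
        ∃ (fx : ∀ c : ℤ, c + S.card = q + 1 → ((X.obj ⟨S, hS⟩).X c).X i)
          (fy : ∀ c : ℤ, c + S.card = p + 1 → ((Y.obj ⟨S, hS⟩).X c).X i),
          ∀ (c₀ : ℤ) (h₀ : c₀ + S.card = p + 1) (c₁ : ℤ) (h₁ : c₁ + S.card = q + 1)
            (c₂ : ℤ) (h₂ : c₂ + S.card = n + 1),
          ev ((X.obj ⟨S, hS⟩).d c₁ c₂) i (fx c₁ h₁) = ev (totProj X n S hS c₂ h₂) i x ∧
          ev ((α.app ⟨S, hS⟩).f c₁) i (fx c₁ h₁) + ev ((Y.obj ⟨S, hS⟩).d c₀ c₁) i (fy c₀ h₀) =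
            (-1 : ℤ) ^ (S.card + 1) • ev (totProj Y q S hS c₁ h₁) i y := by
      intro S hS hSk
      obtain ⟨a, b, hab⟩ := (quasiIso_iff (α.app ⟨S, hS⟩)).1 (h ⟨S, hS⟩) (p + 1 - S.card)
        (q + 1 - S.card) (n + 1 - S.card) (by omega) (by omega) i
        (ev (totProj X n S hS (n + 1 - S.card) (by omega)) i x)
        ((-1 : ℤ) ^ (S.card + 1) • ev (totProj Y q S hS (q + 1 - S.card) (by omega)) i y) (by
          have e := ev_totD n (n + 1) rfl S hS (n + 1 - S.card + 1) (n + 1 - S.card) rfl (by omega)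
            i x (fun T hT q hq hlt => hxk T hT q hq (by omega))
          rw [hx, map_zero] at e
          have e' := congrArg (fun z => (-1 : ℤ) ^ (S.card + 1) • z) e.symm
          simpa only [smul_smul, sq, one_smul, smul_zero] using e') (by
          have e := ev_totD q n hn S hS (n + 1 - S.card) (q + 1 - S.card) (by omega) (by omega)
            i y (fun T hT q hq hlt => hyk T hT q hq (by omega))
          rw [← hxy] at e
          rw [map_zsmul, ← e]
          rfl)
      refine ⟨fun c hc => (show q + 1 - S.card = c by omega) ▸ a,
        fun c hc => (show p + 1 - S.card = c by omega) ▸ b, ?_⟩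
      intro c₀ h₀ c₁ h₁ c₂ h₂
      obtain rfl : c₀ = p + 1 - S.card := by omega
      obtain rfl : c₁ = q + 1 - S.card := by omega
      obtain rfl : c₂ = n + 1 - S.card := by omega
      exact hab
    choose fx fy hf using key
    let x' : (totX X q).X i := fun c => if hc : c.1.1.1.card = k then
      (-1 : ℤ) ^ (c.1.1.1.card + 1) • fx c.1.1.1 c.1.1.2 hc c.1.2 c.2 else 0
    let y' : (totX Y p).X i := fun c => if hc : c.1.1.1.card = k then
      fy c.1.1.1 c.1.1.2 hc c.1.2 c.2 else 0
    have hx' : ∀ (S : Finset (Fin r)) (hS : S.Nonempty) (c : ℤ) (hc) (h : S.card = k),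
        ev (totProj X q S hS c hc) i x' = (-1 : ℤ) ^ (S.card + 1) • fx S hS h c hc :=
      fun S hS c hc h => dif_pos h
    have hy' : ∀ (S : Finset (Fin r)) (hS : S.Nonempty) (c : ℤ) (hc) (h : S.card = k),
        ev (totProj Y p S hS c hc) i y' = fy S hS h c hc :=
      fun S hS c hc h => dif_pos h
    have hx'' : ∀ (S : Finset (Fin r)) (hS : S.Nonempty) (c : ℤ) (hc) (_ : S.card < k),
        ev (totProj X q S hS c hc) i x' = 0 :=
      fun S hS c hc h => dif_neg h.ne
    have hy'' : ∀ (S : Finset (Fin r)) (hS : S.Nonempty) (c : ℤ) (hc) (_ : S.card < k),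
        ev (totProj Y p S hS c hc) i y' = 0 :=
      fun S hS c hc h => dif_neg h.ne
    refine ⟨x', y', fun S hS c hc hlt => ?_, fun S hS c hc hlt => ?_⟩
    · suffices e : ev (totProj X n S hS c hc) i (x - ev (totD X q n hn) i x') = 0 by
        rw [← tot_d X q n hn] at e
        exact e
      rw [map_sub, ev_totD q n hn S hS c (c - 1) (by omega) hc i x'
        (fun T hT q hq hlt' => hx'' T hT q hq (by omega))]
      rcases Nat.lt_succ_iff_lt_or_eq.1 hlt with hlt | heq
      · rw [hxk S hS c hc hlt, hx'' S hS _ _ hlt, map_zero, smul_zero, sub_zero]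
      · rw [hx' S hS _ _ heq, map_zsmul, smul_smul, sq, one_smul,
          (hf S hS heq (c - 2) (by omega) (c - 1) (by omega) c hc).1, sub_self]
    · suffices e : ev (totProj Y q S hS c hc) i
          (y - ev (totMapF α q) i x' - ev (totD Y p q hp) i y') = 0 by
        rw [← tot_d Y p q hp] at e
        exact e
      rw [map_sub, map_sub, ev_totD p q hp S hS c (c - 1) (by omega) hc i y'
        (fun T hT q hq hlt' => hy'' T hT q hq (by omega))]
      have e : ev (totProj Y q S hS c hc) i (ev (totMapF α q) i x') =
        ev ((α.app ⟨S, hS⟩).f c) i (ev (totProj X q S hS c hc) i x') := rfl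
      rw [e]
      rcases Nat.lt_succ_iff_lt_or_eq.1 hlt with hlt | heq
      · rw [hyk S hS c hc hlt, hx'' S hS _ _ hlt, hy'' S hS _ _ hlt, map_zero, map_zero,
          smul_zero, sub_zero, sub_zero]
      · have e' := (hf S hS heq (c - 1) (by omega) c hc (c + 1) (by omega)).2
        rw [hx' S hS _ _ heq, hy' S hS _ _ heq, map_zsmul, sub_sub, ← smul_add, e',
          smul_smul, sq, one_smul, sub_self]
end

section
variable {X Y : (NSub r)ᵒᵖ ⥤ CochainComplex (GrMod 𝒜) ℤ}

lemma ev_cotD (n m : ℤ) (hnm : n + 1 = m) (S : Finset (Fin r)) (hS : S.Nonempty) (q q' : ℤ)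
    (hq' : q' + 1 = q) (hq : q + 1 = m + S.card) (i : ℤ) (x : (cotX X n).X i)
    (hx : ∀ (T : Finset (Fin r)) (hT : T.Nonempty) (q) (hq), S.card < T.card →
      ev (cotProj X n T hT q hq) i x = 0) :
    ev (cotProj X m S hS q hq) i (ev (cotD X n m hnm) i x) =
      (-1 : ℤ) ^ (S.card + 1) • ev ((X.obj (Opposite.op ⟨S, hS⟩)).d q' q) i
        (ev (cotProj X n S hS q' (by omega)) i x) := by
  have h := congrArg (fun φ => ev φ i x) (cotD_proj X n m hnm S hS q q' hq' hq)
  refine h.trans ?_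
  simp only [ev_add, ev_sum, ev_zsmul, ev_comp]
  rw [Finset.sum_eq_zero, zero_add]
  intro j _
  by_cases hj : j ∉ S
  · rw [dif_pos hj, ev_zsmul, cotEnt, ev_comp, hx _ _ _ _ (by rw [Finset.card_insert_of_notMem hj]; omega), map_zero,
      smul_zero]
  · rw [dif_neg hj, ev_zero]

/-- The total complex preserves columnwise quasi-isomorphisms. -/
lemma quasiIso_cot (α : X ⟶ Y) (h : ∀ S, QuasiIso (α.app S)) :
    QuasiIso ((cotFunctor 𝒜 r).map α) := by
  have sq : ∀ k : ℕ, ((-1 : ℤ) ^ k) * (-1) ^ k = 1 := fun k => by rw [← mul_pow]; simp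
  refine quasiIso_of_filtration _
    (fun k n i x => ∀ (T : Finset (Fin r)) (hT : T.Nonempty) (q) (hq), r < T.card + k →
      ev (cotProj X n T hT q hq) i x = 0)
    (fun k n i x => ∀ (T : Finset (Fin r)) (hT : T.Nonempty) (q) (hq), r < T.card + k →
      ev (cotProj Y n T hT q hq) i x = 0)
    (fun _ _ _ T _ _ _ h => absurd h (card_finset_fin_le T).not_gt)
    (fun _ _ _ T _ _ _ h => absurd h (card_finset_fin_le T).not_gt) (r + 1) ?_ ?_ ?_
  · intro n i x hx
    funext p
    exact hx p.1.1.1 p.1.1.2 p.1.2 p.2 (by omega)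
  · intro n i x hx
    funext p
    exact hx p.1.1.1 p.1.1.2 p.1.2 p.2 (by omega)
  · intro k p q n hp hn i (x : (cotX X n).X i) (y : (cotX Y q).X i) hx hxy hxk hyk
    replace hx : ev (cotD X n (n + 1) rfl) i x = 0 := by rw [← cot_d]; exact hx
    replace hxy : ev (cotMapF α n) i x = ev (cotD Y q n hn) i y := by rw [← cot_d]; exact hxy
    have key : ∀ (S : Finset (Fin r)) (hS : S.Nonempty), S.card + k = r →
        ∃ (fx : ∀ c : ℤ, c + 1 = q + S.card → ((X.obj (Opposite.op ⟨S, hS⟩)).X c).X i)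
          (fy : ∀ c : ℤ, c + 1 = p + S.card → ((Y.obj (Opposite.op ⟨S, hS⟩)).X c).X i),
          ∀ (c₀ : ℤ) (h₀ : c₀ + 1 = p + S.card) (c₁ : ℤ) (h₁ : c₁ + 1 = q + S.card)
            (c₂ : ℤ) (h₂ : c₂ + 1 = n + S.card),
          ev ((X.obj (Opposite.op ⟨S, hS⟩)).d c₁ c₂) i (fx c₁ h₁) = ev (cotProj X n S hS c₂ h₂) i x ∧
          ev ((α.app (Opposite.op ⟨S, hS⟩)).f c₁) i (fx c₁ h₁) + ev ((Y.obj (Opposite.op ⟨S, hS⟩)).d c₀ c₁) i (fy c₀ h₀) =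
            (-1 : ℤ) ^ (S.card + 1) • ev (cotProj Y q S hS c₁ h₁) i y := by
      intro S hS hSk
      obtain ⟨a, b, hab⟩ := (quasiIso_iff (α.app (Opposite.op ⟨S, hS⟩))).1 (h (Opposite.op ⟨S, hS⟩)) (p - 1 + S.card)
        (q - 1 + S.card) (n - 1 + S.card) (by omega) (by omega) i
        (ev (cotProj X n S hS (n - 1 + S.card) (by omega)) i x)
        ((-1 : ℤ) ^ (S.card + 1) • ev (cotProj Y q S hS (q - 1 + S.card) (by omega)) i y) (by
          have e := ev_cotD n (n + 1) rfl S hS (n - 1 + S.card + 1) (n - 1 + S.card) rfl (by omega)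
            i x (fun T hT q hq hlt => hxk T hT q hq (by omega))
          rw [hx, map_zero] at e
          have e' := congrArg (fun z => (-1 : ℤ) ^ (S.card + 1) • z) e.symm
          simpa only [smul_smul, sq, one_smul, smul_zero] using e') (by
          have e := ev_cotD q n hn S hS (n - 1 + S.card) (q - 1 + S.card) (by omega) (by omega)
            i y (fun T hT q hq hlt => hyk T hT q hq (by omega))
          rw [← hxy] at e
          rw [map_zsmul, ← e]
          rfl)
      refine ⟨fun c hc => (show q - 1 + S.card = c by omega) ▸ a,
        fun c hc => (show p - 1 + S.card = c by omega) ▸ b, ?_⟩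
      intro c₀ h₀ c₁ h₁ c₂ h₂
      obtain rfl : c₀ = p - 1 + S.card := by omega
      obtain rfl : c₁ = q - 1 + S.card := by omega
      obtain rfl : c₂ = n - 1 + S.card := by omega
      exact hab
    choose fx fy hf using key
    let x' : (cotX X q).X i := fun c => if hc : c.1.1.1.card + k = r then
      (-1 : ℤ) ^ (c.1.1.1.card + 1) • fx c.1.1.1 c.1.1.2 hc c.1.2 c.2 else 0
    let y' : (cotX Y p).X i := fun c => if hc : c.1.1.1.card + k = r then
      fy c.1.1.1 c.1.1.2 hc c.1.2 c.2 else 0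
    have hx' : ∀ (S : Finset (Fin r)) (hS : S.Nonempty) (c : ℤ) (hc) (h : S.card + k = r),
        ev (cotProj X q S hS c hc) i x' = (-1 : ℤ) ^ (S.card + 1) • fx S hS h c hc :=
      fun S hS c hc h => dif_pos h
    have hy' : ∀ (S : Finset (Fin r)) (hS : S.Nonempty) (c : ℤ) (hc) (h : S.card + k = r),
        ev (cotProj Y p S hS c hc) i y' = fy S hS h c hc :=
      fun S hS c hc h => dif_pos h
    have hx'' : ∀ (S : Finset (Fin r)) (hS : S.Nonempty) (c : ℤ) (hc) (_ : r < S.card + k),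
        ev (cotProj X q S hS c hc) i x' = 0 :=
      fun S hS c hc h => dif_neg h.ne'
    have hy'' : ∀ (S : Finset (Fin r)) (hS : S.Nonempty) (c : ℤ) (hc) (_ : r < S.card + k),
        ev (cotProj Y p S hS c hc) i y' = 0 :=
      fun S hS c hc h => dif_neg h.ne'
    refine ⟨x', y', fun S hS c hc hlt => ?_, fun S hS c hc hlt => ?_⟩
    · suffices e : ev (cotProj X n S hS c hc) i (x - ev (cotD X q n hn) i x') = 0 by
        rw [← cot_d X q n hn] at e
        exact e
      rw [map_sub, ev_cotD q n hn S hS c (c - 1) (by omega) hc i x'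
        (fun T hT q hq hlt' => hx'' T hT q hq (by omega))]
      rcases (show r < S.card + k ∨ S.card + k = r by omega) with hlt | heq
      · rw [hxk S hS c hc hlt, hx'' S hS _ _ hlt, map_zero, smul_zero, sub_zero]
      · rw [hx' S hS _ _ heq, map_zsmul, smul_smul, sq, one_smul,
          (hf S hS heq (c - 2) (by omega) (c - 1) (by omega) c hc).1, sub_self]
    · suffices e : ev (cotProj Y q S hS c hc) i
          (y - ev (cotMapF α q) i x' - ev (cotD Y p q hp) i y') = 0 by
        rw [← cot_d Y p q hp] at e
        exact e
      rw [map_sub, map_sub, ev_cotD p q hp S hS c (c - 1) (by omega) hc i y'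
        (fun T hT q hq hlt' => hy'' T hT q hq (by omega))]
      have e : ev (cotProj Y q S hS c hc) i (ev (cotMapF α q) i x') =
        ev ((α.app (Opposite.op ⟨S, hS⟩)).f c) i (ev (cotProj X q S hS c hc) i x') := rfl
      rw [e]
      rcases (show r < S.card + k ∨ S.card + k = r by omega) with hlt | heq
      · rw [hyk S hS c hc hlt, hx'' S hS _ _ hlt, hy'' S hS _ _ hlt, map_zero, map_zero,
          smul_zero, sub_zero, sub_zero]
      · have e' := (hf S hS heq (c - 1) (by omega) c hc (c + 1) (by omega)).2
        rw [hx' S hS _ _ heq, hy' S hS _ _ heq, map_zsmul, sub_sub, ← smul_add, e',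
          smul_smul, sq, one_smul, sub_self]
end
end
end GrMod
end

noncomputable section
namespace GrMod
section
variable {A : Type u} [CommRing A] {𝒜 : ℤ → AddSubgroup A} [GradedRing 𝒜]

lemma loc_exact {d : ℤ} (g : 𝒜 d) (S : ShortComplex (GrMod 𝒜)) (hS : S.Exact) :
    (S.map (loc g)).Exact := by
  rw [exact_iff] at hS ⊢
  intro w x hx
  obtain ⟨k, x, rfl⟩ := exists_frac g S.X₂ w x
  change ev ((loc g).map S.g) w (frac g S.X₂ w k x) = 0 at hx
  rw [ev_loc_map] at hx
  obtain ⟨j, hj, h⟩ := frac_eq_zero _ _ _ _ _ hx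
  obtain ⟨y, hy⟩ := hS _ (locStep g S.X₂ w k j hj x) ((ev_act S.g _ _ x).trans h)
  refine ⟨frac g S.X₁ w j y, ?_⟩
  change ev ((loc g).map S.f) w (frac g S.X₁ w j y) = frac g S.X₂ w k x
  rw [ev_loc_map, hy, frac_step]

lemma tow_exact (d : ℤ) (S : ShortComplex (GrMod 𝒜)) (hS : S.Exact) :
    (S.map (tow d)).Exact := by
  rw [exact_iff] at hS ⊢
  intro w x hx
  choose y hy using fun k : ℕ => hS _ (x k) (congrFun hx k)
  exact ⟨y, funext hy⟩

lemma preservesQuasiIso_of_exact (F : GrMod 𝒜 ⥤ GrMod 𝒜) [F.Additive]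
    (hF : ∀ S : ShortComplex (GrMod 𝒜), S.Exact → (S.map F).Exact) :
    PreservesQuasiIso (F.mapHomologicalComplex (ComplexShape.up ℤ)) := by
  have := F.preservesHomology_of_map_exact hF
  intro K L φ hφ
  infer_instance

end
end GrMod
end

noncomputable section
namespace GrMod
section
variable {A : Type u} [CommRing A] {𝒜 : ℤ → AddSubgroup A} [GradedRing 𝒜] {r : ℕ}

lemma sgn_singleton (i : Fin r) : sgn i {i} = 1 := by
  simp [sgn, Finset.filter_singleton]

lemma sgn_pair {i j : Fin r} (hij : i ≠ j) : sgn i {i, j} = -sgn j {i, j} := by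
  have h := sgn_erase (S := {i, j}) (i := i) (j := j) (by simp) (by simp) hij
  have h1 : ({i, j} : Finset (Fin r)).erase i = {j} := Finset.erase_insert (by simpa using hij)
  have h2 : ({i, j} : Finset (Fin r)).erase j = {i} := by
    rw [Finset.pair_comm]; exact Finset.erase_insert (by simpa using hij.symm)
  rwa [h1, h2, sgn_singleton, sgn_singleton, mul_one, mul_one] at h

section
variable {X : NSub r ⥤ CochainComplex (GrMod 𝒜) ℤ} {K : CochainComplex (GrMod 𝒜) ℤ}

/-- The component in degree `n` of the augmentation `K → tot X`. -/
def totAugF (κ : ∀ S, K ⟶ X.obj S) (n : ℤ) : K.X n ⟶ totX X n :=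
  totLift fun S hS q hq => if h : S.card = 1 then
    (K.XIsoOfEq (show n = q by rw [h] at hq; push_cast at hq; omega)).hom ≫ (κ ⟨S, hS⟩).f q else 0

lemma totAugF_proj (κ : ∀ S, K ⟶ X.obj S) (n : ℤ) (S : Finset (Fin r)) (hS : S.Nonempty)
    (hS' : S.card = 1) (hq : n + S.card = n + 1) :
    totAugF κ n ≫ totProj X n S hS n hq = (κ ⟨S, hS⟩).f n := by
  rw [totAugF, totLift_proj, dif_pos hS', HomologicalComplex.XIsoOfEq_rfl, Iso.refl_hom,
    Category.id_comp]

lemma totAugF_proj_zero (κ : ∀ S, K ⟶ X.obj S) (n : ℤ) (S : Finset (Fin r)) (hS : S.Nonempty)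
    (hS' : S.card ≠ 1) (q : ℤ) (hq : q + S.card = n + 1) :
    totAugF κ n ≫ totProj X n S hS q hq = 0 := by
  rw [totAugF, totLift_proj, dif_neg hS']

lemma totAugF_ent (κ : ∀ S, K ⟶ X.obj S)
    (hκ : ∀ {S T : NSub r} (h : S ⟶ T), κ S ≫ X.map h = κ T) (n : ℤ) (T S : Finset (Fin r))
    (hT : T.Nonempty) (hTS : T ⊆ S) (hT' : T.card = 1) (hq : n + T.card = n + 1) :
    totAugF κ n ≫ totEnt X n T S hT hTS n hq = (κ ⟨S, hT.mono hTS⟩).f n := by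
  rw [totEnt, ← Category.assoc, totAugF_proj κ n T hT hT', ← HomologicalComplex.comp_f, hκ]

lemma totAugF_comm (κ : ∀ S, K ⟶ X.obj S)
    (hκ : ∀ {S T : NSub r} (h : S ⟶ T), κ S ≫ X.map h = κ T) (n m : ℤ) (hnm : n + 1 = m) :
    totAugF κ n ≫ totD X n m hnm = K.d n m ≫ totAugF κ m := by
  refine totExt fun S hS q hq => ?_
  rw [Category.assoc, Category.assoc, totD_proj X n m hnm S hS q (q - 1) (by omega) hq,
    Preadditive.comp_add, Preadditive.comp_sum, Preadditive.comp_zsmul]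
  have hpos := hS.card_pos
  by_cases h1 : S.card = 1
  · obtain rfl : q = m := by rw [h1] at hq; push_cast at hq; omega
    obtain rfl : n = q - 1 := by omega
    rw [totAugF_proj κ q S hS h1, ← Category.assoc, totAugF_proj κ (q - 1) S hS h1,
      show (-1 : ℤ) ^ (S.card + 1) = 1 by rw [h1]; rfl, Finset.sum_eq_zero, (κ ⟨S, hS⟩).comm]
    · simp
    · intro i _
      rw [dif_neg, comp_zero]
      rintro ⟨hi, hne⟩
      have := Finset.card_erase_add_one hi
      have := hne.card_pos
      omega
  · rw [totAugF_proj_zero κ m S hS h1 q hq, comp_zero, ← Category.assoc,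
      totAugF_proj_zero κ n S hS h1, zero_comp, smul_zero, add_zero]
    by_cases h2 : S.card = 2
    · obtain rfl : q = n := by rw [h2] at hq; push_cast at hq; omega
      obtain ⟨a, b, hab, rfl⟩ := Finset.card_eq_two.1 h2
      have key : ∀ i : Fin r, (totAugF κ q ≫ if h : i ∈ ({a, b} : Finset (Fin r)) ∧
          (({a, b} : Finset (Fin r)).erase i).Nonempty then
          sgn i {a, b} • totEnt X q (({a, b} : Finset (Fin r)).erase i) {a, b} h.2
            (Finset.erase_subset _ _) q (by
              have := Finset.card_erase_add_one h.1
              omega) else 0) =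
          if i ∈ ({a, b} : Finset (Fin r)) then
            sgn i {a, b} • (κ ⟨{a, b}, hS⟩).f q else 0 := by
        intro i
        by_cases hi : i ∈ ({a, b} : Finset (Fin r))
        · have hc := Finset.card_erase_add_one hi
          rw [dif_pos ⟨hi, Finset.card_pos.1 (by omega)⟩, if_pos hi, Preadditive.comp_zsmul,
            totAugF_ent κ hκ q _ _ _ _ (by omega)]
        · rw [dif_neg (fun h => hi h.1), if_neg hi, comp_zero]
      simp only [key]
      rw [Finset.sum_ite_mem, Finset.univ_inter, Finset.sum_pair hab, sgn_pair hab, neg_smul,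
        neg_add_cancel]
    · refine Finset.sum_eq_zero fun i _ => ?_
      by_cases h : i ∈ S ∧ (S.erase i).Nonempty
      · have := Finset.card_erase_add_one h.1
        rw [dif_pos h, Preadditive.comp_zsmul, totEnt, ← Category.assoc,
          totAugF_proj_zero κ n _ _ (by omega), zero_comp, smul_zero]
      · rw [dif_neg h, comp_zero]

/-- The augmentation `K → tot X` given by a compatible family of maps `K → X_S`: it is the map
`K → ∏_{|S| = 1} X_S`. -/
def totAug (κ : ∀ S, K ⟶ X.obj S)
    (hκ : ∀ {S T : NSub r} (h : S ⟶ T), κ S ≫ X.map h = κ T) : K ⟶ tot X where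
  f := totAugF κ
  comm' n m (h : n + 1 = m) := by
    rw [tot_d X n m h]
    exact totAugF_comm κ hκ n m h

lemma totAug_naturality {L : CochainComplex (GrMod 𝒜) ℤ} {Y : NSub r ⥤ CochainComplex (GrMod 𝒜) ℤ}
    (κ : ∀ S, K ⟶ X.obj S) (hκ : ∀ {S T : NSub r} (h : S ⟶ T), κ S ≫ X.map h = κ T)
    (κ' : ∀ S, L ⟶ Y.obj S) (hκ' : ∀ {S T : NSub r} (h : S ⟶ T), κ' S ≫ Y.map h = κ' T)
    (φ : K ⟶ L) (α : X ⟶ Y) (h : ∀ S, φ ≫ κ' S = κ S ≫ α.app S) :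
    φ ≫ totAug κ' hκ' = totAug κ hκ ≫ (totFunctor 𝒜 r).map α := by
  ext n : 1
  refine totExt fun S hS q hq => ?_
  change φ.f n ≫ totAugF κ' n ≫ totProj Y n S hS q hq =
    (totAugF κ n ≫ totProj X n S hS q hq) ≫ (α.app ⟨S, hS⟩).f q
  by_cases h1 : S.card = 1
  · obtain rfl : q = n := by rw [h1] at hq; push_cast at hq; omega
    rw [totAugF_proj κ q S hS h1, totAugF_proj κ' q S hS h1, ← HomologicalComplex.comp_f,
      ← HomologicalComplex.comp_f, h]
  · rw [totAugF_proj_zero κ n S hS h1, totAugF_proj_zero κ' n S hS h1, comp_zero, zero_comp]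

end

section
variable {X : (NSub r)ᵒᵖ ⥤ CochainComplex (GrMod 𝒜) ℤ} {K : CochainComplex (GrMod 𝒜) ℤ}

/-- The component in degree `n` of the augmentation `cot X → K`. -/
def cotAugF (κ : ∀ S, X.obj S ⟶ K) (n : ℤ) : cotX X n ⟶ K.X n :=
  ∑ i : Fin r, cotProj X n {i} (Finset.singleton_nonempty i) n (by simp) ≫
    (κ (Opposite.op ⟨{i}, Finset.singleton_nonempty i⟩)).f n

lemma cotAugF_comm (κ : ∀ S, X.obj S ⟶ K)
    (hκ : ∀ {S T : (NSub r)ᵒᵖ} (h : S ⟶ T), X.map h ≫ κ T = κ S) (n m : ℤ) (hnm : n + 1 = m) :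
    cotAugF κ n ≫ K.d n m = cotD X n m hnm ≫ cotAugF κ m := by
  unfold cotAugF
  rw [Preadditive.sum_comp, Preadditive.comp_sum]
  have key : ∀ i : Fin r, cotD X n m hnm ≫
      (cotProj X m {i} (Finset.singleton_nonempty i) m (by simp) ≫
        (κ (Opposite.op ⟨{i}, Finset.singleton_nonempty i⟩)).f m) =
      (∑ j : Fin r, if h : j ∉ ({i} : Finset (Fin r)) then
        sgn j (insert j {i}) • (cotProj X n (insert j {i}) (Finset.insert_nonempty _ _) m (by
          rw [Finset.card_insert_of_notMem h]; simp; omega) ≫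
            (κ (Opposite.op ⟨insert j {i}, Finset.insert_nonempty _ _⟩)).f m) else 0) +
      (cotProj X n {i} (Finset.singleton_nonempty i) n (by simp) ≫
        (κ (Opposite.op ⟨{i}, Finset.singleton_nonempty i⟩)).f n) ≫ K.d n m := by
    intro i
    rw [← Category.assoc, cotD_proj X n m hnm {i} _ m n hnm, Preadditive.add_comp,
      Preadditive.sum_comp]
    congr 1
    · refine Finset.sum_congr rfl fun j _ => ?_
      by_cases h : j ∉ ({i} : Finset (Fin r))
      · rw [dif_pos h, dif_pos h, Preadditive.zsmul_comp, cotEnt, Category.assoc,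
          ← HomologicalComplex.comp_f, hκ]
      · rw [dif_neg h, dif_neg h, zero_comp]
    · rw [Preadditive.zsmul_comp, Category.assoc, Category.assoc, ← HomologicalComplex.Hom.comm]
      simp
  simp only [key]
  rw [Finset.sum_add_distrib, sum_antisymm, zero_add]
  · intro i
    exact dif_neg (by simp)
  · intro i j hij
    have h1 : j ∉ ({i} : Finset (Fin r)) := by simpa using hij.symm
    have h2 : i ∉ ({j} : Finset (Fin r)) := by simpa using hij
    have gen : ∀ (U V : Finset (Fin r)) (hU : U.Nonempty) (hV : V.Nonempty)
        (hU' : m + 1 = n + U.card) (hV' : m + 1 = n + V.card), U = V →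
        cotProj X n U hU m hU' ≫ (κ (Opposite.op ⟨U, hU⟩)).f m =
          cotProj X n V hV m hV' ≫ (κ (Opposite.op ⟨V, hV⟩)).f m := by
      rintro U V _ _ _ _ rfl
      rfl
    have e : sgn j (insert j {i}) = -sgn i (insert i {j}) := by
      rw [Finset.pair_comm, sgn_pair hij, neg_neg]
    rw [dif_pos h1, dif_pos h2, ← neg_smul, e, gen _ _ _ _ _ _ (Finset.pair_comm j i)]

/-- The augmentation `cot X → K` given by a compatible family of maps `X_S → K`: it is the sum of
the maps `X_S → K` for `|S| = 1`. -/
def cotAug (κ : ∀ S, X.obj S ⟶ K)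
    (hκ : ∀ {S T : (NSub r)ᵒᵖ} (h : S ⟶ T), X.map h ≫ κ T = κ S) : cot X ⟶ K where
  f := cotAugF κ
  comm' n m (h : n + 1 = m) := by
    rw [cot_d X n m h]
    exact cotAugF_comm κ hκ n m h

lemma cotAug_naturality {L : CochainComplex (GrMod 𝒜) ℤ}
    {Y : (NSub r)ᵒᵖ ⥤ CochainComplex (GrMod 𝒜) ℤ}
    (κ : ∀ S, X.obj S ⟶ K) (hκ : ∀ {S T : (NSub r)ᵒᵖ} (h : S ⟶ T), X.map h ≫ κ T = κ S)
    (κ' : ∀ S, Y.obj S ⟶ L) (hκ' : ∀ {S T : (NSub r)ᵒᵖ} (h : S ⟶ T), Y.map h ≫ κ' T = κ' S)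
    (φ : K ⟶ L) (α : X ⟶ Y) (h : ∀ S, κ S ≫ φ = α.app S ≫ κ' S) :
    (cotFunctor 𝒜 r).map α ≫ cotAug κ' hκ' = cotAug κ hκ ≫ φ := by
  ext n : 1
  change cotMapF α n ≫ cotAugF κ' n = cotAugF κ n ≫ φ.f n
  unfold cotAugF
  rw [Preadditive.comp_sum, Preadditive.sum_comp]
  refine Finset.sum_congr rfl fun i _ => ?_
  rw [cotMapF_proj_assoc, Category.assoc, ← HomologicalComplex.comp_f,
    ← HomologicalComplex.comp_f, h]

end

end
end GrMod
end

noncomputable section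
namespace GrMod
section
variable {A : Type u} [CommRing A] {𝒜 : ℤ → AddSubgroup A} [GradedRing 𝒜]

/-- Localization `K ↦ K_g` of complexes of graded modules. -/
abbrev locC {d : ℤ} (g : 𝒜 d) : CochainComplex (GrMod 𝒜) ℤ ⥤ CochainComplex (GrMod 𝒜) ℤ :=
  (loc g).mapHomologicalComplex (ComplexShape.up ℤ)

/-- The difference map `∏_k K(-k d) → ∏_k K(-k d)` of the tower `K ← K(-d) ← K(-2d) ← ⋯`. -/
abbrev towDiffC {d : ℤ} (g : 𝒜 d) :
    (tow (𝒜 := 𝒜) d).mapHomologicalComplex (ComplexShape.up ℤ) ⟶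
      (tow d).mapHomologicalComplex (ComplexShape.up ℤ) :=
  NatTrans.mapHomologicalComplex (towDiff g) (ComplexShape.up ℤ)

/-- The complex `T(K, g) = holim (K ← K(-d) ← K(-2d) ← ⋯)`, where the transition maps are
multiplication by `g`, for `g` homogeneous of degree `d`: it is the mapping cocone of the
difference map on `∏_k K(-k d)`. -/
abbrev telC {d : ℤ} (g : 𝒜 d) : CochainComplex (GrMod 𝒜) ℤ ⥤ CochainComplex (GrMod 𝒜) ℤ :=
  coconeFunctor (towDiffC g)

/-- The map `T(K, h g) → T(K, g)` induced by `h ^ k : K(-k d') → K(-k d)`. -/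
def telTrans {d d' e : ℤ} (g : 𝒜 d) (g' : 𝒜 d') (h : 𝒜 e) (hd : e + d = d')
    (hg : (g' : A) = h * g) : telC g' ⟶ telC g :=
  coconeMap (towDiffC g') (towDiffC g)
    (NatTrans.mapHomologicalComplex (towTrans h hd) (ComplexShape.up ℤ))
    (NatTrans.mapHomologicalComplex (towTrans h hd) (ComplexShape.up ℤ)) (fun K => by
      rw [← NatTrans.comp_app, ← NatTrans.comp_app, ← NatTrans.mapHomologicalComplex_comp,
        ← NatTrans.mapHomologicalComplex_comp, towTrans_diff g g' h hd hg])

/-- The canonical map `T(K, g) → K`, induced by the projection to the stage `k = 0`. -/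
def telZero {d : ℤ} (g : 𝒜 d) : telC g ⟶ 𝟭 _ :=
  coconeFst (towDiffC g) ≫ NatTrans.mapHomologicalComplex (towZero d) (ComplexShape.up ℤ) ≫
    (Functor.mapHomologicalComplexIdIso (GrMod 𝒜) (ComplexShape.up ℤ)).hom

/-- The canonical map `K → K_g`. -/
def toLocC {d : ℤ} (g : 𝒜 d) : 𝟭 _ ⟶ locC g :=
  (Functor.mapHomologicalComplexIdIso (GrMod 𝒜) (ComplexShape.up ℤ)).inv ≫
    NatTrans.mapHomologicalComplex (toLoc g) (ComplexShape.up ℤ)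

lemma telTrans_zero {d d' e : ℤ} (g : 𝒜 d) (g' : 𝒜 d') (h : 𝒜 e) (hd : e + d = d')
    (hg : (g' : A) = h * g) : telTrans g g' h hd hg ≫ telZero g = telZero g' := by
  unfold telTrans telZero
  rw [← towTrans_zero h hd, NatTrans.mapHomologicalComplex_comp, Category.assoc]
  exact (Category.assoc _ _ _).symm.trans
    ((congrArg (· ≫ _) (coconeMap_fst _ _ _ _ _)).trans (Category.assoc _ _ _))

variable {r : ℕ} {d : Fin r → ℤ} (f : ∀ i, 𝒜 (d i))

/-- The product `f_S = ∏_{i ∈ S} f_i`, homogeneous of degree `∑_{i ∈ S} d_i`. -/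
def fprod (S : Finset (Fin r)) : 𝒜 (∑ i ∈ S, d i) :=
  ⟨∏ i ∈ S, (f i : A), SetLike.prod_mem_graded 𝒜 d (fun i => (f i : A)) (fun i _ => (f i).2)⟩

@[simp]
lemma coe_fprod (S : Finset (Fin r)) : (fprod f S : A) = ∏ i ∈ S, (f i : A) := rfl

lemma fprod_sdiff {S T : Finset (Fin r)} (h : S ⊆ T) :
    (fprod f T : A) = fprod f (T \ S) * fprod f S := (Finset.prod_sdiff h).symm

lemma fprod_sdiff_sdiff {S T U : Finset (Fin r)} (h : S ⊆ T) (h' : T ⊆ U) :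
    (fprod f (U \ S) : A) = fprod f (U \ T) * fprod f (T \ S) := by
  have e : (U \ S) \ (T \ S) = U \ T := by
    ext i
    have := @h i
    simp only [Finset.mem_sdiff]
    tauto
  simp only [coe_fprod]
  rw [← Finset.prod_sdiff (Finset.sdiff_subset_sdiff h' (le_refl S)), e]

/-- The diagram `S ↦ K_{f_S}` indexed by the nonempty subsets of `{1, …, r}`. -/
def locSys : NSub r ⥤ (CochainComplex (GrMod 𝒜) ℤ ⥤ CochainComplex (GrMod 𝒜) ℤ) where
  obj S := locC (fprod f S.1)
  map {S T} h := NatTrans.mapHomologicalComplex (locTrans (fprod f S.1) (fprod f T.1)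
    (fprod f (T.1 \ S.1)) (Finset.sum_sdiff (leOfHom h)) (fprod_sdiff f (leOfHom h)))
      (ComplexShape.up ℤ)
  map_id S := by
    rw [locTrans_id _ _ _ (by simp), NatTrans.mapHomologicalComplex_id]
  map_comp {S T U} h h' := by
    rw [← NatTrans.mapHomologicalComplex_comp, locTrans_comp _ _ _ _ _ (fprod f (U.1 \ S.1)) _ _ _ _
      (Finset.sum_sdiff ((leOfHom h).trans (leOfHom h')))
      (fprod_sdiff_sdiff f (leOfHom h) (leOfHom h'))]

/-- The diagram `S ↦ T(K, f_S)` indexed by the nonempty subsets of `{1, …, r}`. -/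
def telSys : (NSub r)ᵒᵖ ⥤ (CochainComplex (GrMod 𝒜) ℤ ⥤ CochainComplex (GrMod 𝒜) ℤ) where
  obj S := telC (fprod f S.unop.1)
  map {T S} h := telTrans (fprod f S.unop.1) (fprod f T.unop.1)
    (fprod f (T.unop.1 \ S.unop.1)) (Finset.sum_sdiff (leOfHom h.unop))
      (fprod_sdiff f (leOfHom h.unop))
  map_id S := by
    unfold telTrans
    rw [← coconeMap_id]
    congr 1 <;>
      rw [towTrans_id _ _ (by simp), NatTrans.mapHomologicalComplex_id]
  map_comp {U T S} h h' := by
    unfold telTrans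
    rw [coconeMap_comp]
    congr 1 <;>
    · rw [← NatTrans.mapHomologicalComplex_comp, towTrans_comp _ _ (fprod f (U.unop.1 \ S.unop.1))
        _ _ (Finset.sum_sdiff ((leOfHom h'.unop).trans (leOfHom h.unop)))
        ((fprod_sdiff_sdiff f (leOfHom h'.unop) (leOfHom h.unop)).trans (mul_comm _ _))]

/-- The Čech complex `Č_I(K)`: the total complex of
`∏_i K_{f_i} → ∏_{i < j} K_{f_i f_j} → ⋯ → K_{f_1 ⋯ f_r}`, starting in degree `0`. -/
def cechC : CochainComplex (GrMod 𝒜) ℤ ⥤ CochainComplex (GrMod 𝒜) ℤ :=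
  (locSys f).flip ⋙ totFunctor 𝒜 r

/-- The functor `E_I(K)`: the total complex of
`∏_i T(K, f_i) ← ∏_{i < j} T(K, f_i f_j) ← ⋯ ← T(K, f_1 ⋯ f_r)`, ending in degree `0`. -/
def dualC : CochainComplex (GrMod 𝒜) ℤ ⥤ CochainComplex (GrMod 𝒜) ℤ :=
  (telSys f).flip ⋙ cotFunctor 𝒜 r

lemma toLocC_map {S T : NSub r} (h : S ⟶ T) (K : CochainComplex (GrMod 𝒜) ℤ) :
    (toLocC (fprod f S.1)).app K ≫ ((locSys f).flip.obj K).map h =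
      (toLocC (fprod f T.1)).app K := by
  have := toLoc_comp (fprod f S.1) (fprod f T.1) (fprod f (T.1 \ S.1))
    (Finset.sum_sdiff (leOfHom h)) (fprod_sdiff f (leOfHom h))
  unfold toLocC
  rw [← this, NatTrans.mapHomologicalComplex_comp]
  rfl

/-- The augmentation `K → Č_I(K)`, given by `K → ∏_i K_{f_i}`. -/
def cechAug : 𝟭 _ ⟶ cechC f where
  app K := totAug (X := (locSys f).flip.obj K) (fun S => (toLocC (fprod f S.1)).app K)
    (fun h => toLocC_map f h K)
  naturality K L φ := by
    exact totAug_naturality _ _ _ _ φ ((locSys f).flip.map φ)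
      (fun S => (toLocC (fprod f S.1)).naturality φ)

/-- The augmentation `E_I(K) → K`, given by `∏_i T(K, f_i) → K`. -/
def dualAug : dualC f ⟶ 𝟭 _ where
  app K := cotAug (X := (telSys f).flip.obj K) (fun S => (telZero (fprod f S.unop.1)).app K)
    (fun {S T} h => congrArg (fun q => q.app K) (telTrans_zero (fprod f T.unop.1) (fprod f S.unop.1)
      (fprod f (S.unop.1 \ T.unop.1)) (Finset.sum_sdiff (leOfHom h.unop))
      (fprod_sdiff f (leOfHom h.unop))))
  naturality K L φ := by
    exact cotAug_naturality _ _ _ _ φ ((telSys f).flip.map φ)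
      (fun S => ((telZero (fprod f S.unop.1)).naturality φ).symm)

/-- The extended Čech complex `RΓ_I(K)`: the total complex of
`K → ∏_i K_{f_i} → ∏_{i < j} K_{f_i f_j} → ⋯ → K_{f_1 ⋯ f_r}`, with `K` in degree `0`. -/
def gammaC : CochainComplex (GrMod 𝒜) ℤ ⥤ CochainComplex (GrMod 𝒜) ℤ := coconeFunctor (cechAug f)

/-- The canonical map `RΓ_I(K) → K`. -/
def gammaCounitC : gammaC f ⟶ 𝟭 _ := coconeFst (cechAug f)

/-- The complex `LΛ_I(K)`: the total complex of
`K ← ∏_i T(K, f_i) ← ∏_{i < j} T(K, f_i f_j) ← ⋯ ← T(K, f_1 ⋯ f_r)`, with `K` in degree `0`. -/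
def lambdaC : CochainComplex (GrMod 𝒜) ℤ ⥤ CochainComplex (GrMod 𝒜) ℤ := coneFunctor (dualAug f)

/-- The canonical map `K → LΛ_I(K)`. -/
def lambdaUnitC : 𝟭 _ ⟶ lambdaC f := coneInr (dualAug f)

lemma locC_preserves {d : ℤ} (g : 𝒜 d) : PreservesQuasiIso (locC g) :=
  preservesQuasiIso_of_exact _ (loc_exact g)

lemma telC_preserves {d : ℤ} (g : 𝒜 d) : PreservesQuasiIso (telC g) :=
  PreservesQuasiIso.cocone _ (preservesQuasiIso_of_exact _ (tow_exact d))
    (preservesQuasiIso_of_exact _ (tow_exact d))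

lemma id_preserves : PreservesQuasiIso (𝟭 (CochainComplex (GrMod 𝒜) ℤ)) := fun _ h => h

lemma cechC_preserves : PreservesQuasiIso (cechC f) := fun _ h =>
  quasiIso_tot _ (fun S => locC_preserves (fprod f S.1) _ h)

lemma dualC_preserves : PreservesQuasiIso (dualC f) := fun _ h =>
  quasiIso_cot _ (fun S => telC_preserves (fprod f S.unop.1) _ h)

lemma gammaC_preserves : PreservesQuasiIso (gammaC f) :=
  PreservesQuasiIso.cocone _ id_preserves (cechC_preserves f)

lemma lambdaC_preserves : PreservesQuasiIso (lambdaC f) :=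
  PreservesQuasiIso.cone _ (dualC_preserves f) id_preserves

end
end GrMod
end

noncomputable section
namespace GrMod
section
variable {A : Type u} [CommRing A] {𝒜 : ℤ → AddSubgroup A} [GradedRing 𝒜]
variable [HasDerivedCategory.{w} (GrMod 𝒜)]

/-- A functor on complexes that preserves quasi-isomorphisms descends to the derived category. -/
def descend (F : CochainComplex (GrMod 𝒜) ℤ ⥤ CochainComplex (GrMod 𝒜) ℤ)
    (hF : PreservesQuasiIso F) : DerivedCategory (GrMod 𝒜) ⥤ DerivedCategory (GrMod 𝒜) :=
  Localization.lift (W := HomologicalComplex.quasiIso (GrMod 𝒜) (ComplexShape.up ℤ))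
    (F ⋙ DerivedCategory.Q)
    (fun _ _ φ hφ => (DerivedCategory.isIso_Q_map_iff_quasiIso _ (F.map φ)).2 (hF φ hφ))
    DerivedCategory.Q

instance (F : CochainComplex (GrMod 𝒜) ℤ ⥤ CochainComplex (GrMod 𝒜) ℤ)
    (hF : PreservesQuasiIso F) : Localization.Lifting DerivedCategory.Q
      (HomologicalComplex.quasiIso (GrMod 𝒜) (ComplexShape.up ℤ)) (F ⋙ DerivedCategory.Q)
      (descend F hF) :=
  Localization.liftingLift _ _ _

/-- A natural transformation from the identity descends to the derived category. -/
def descendUnit {F : CochainComplex (GrMod 𝒜) ℤ ⥤ CochainComplex (GrMod 𝒜) ℤ}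
    (hF : PreservesQuasiIso F) (α : 𝟭 _ ⟶ F) : 𝟭 (DerivedCategory (GrMod 𝒜)) ⟶ descend F hF :=
  Localization.liftNatTrans DerivedCategory.Q
    (HomologicalComplex.quasiIso (GrMod 𝒜) (ComplexShape.up ℤ)) DerivedCategory.Q
    (F ⋙ DerivedCategory.Q) _ _
    ((Functor.leftUnitor _).inv ≫ Functor.whiskerRight α DerivedCategory.Q)

/-- A natural transformation to the identity descends to the derived category. -/
def descendCounit {F : CochainComplex (GrMod 𝒜) ℤ ⥤ CochainComplex (GrMod 𝒜) ℤ}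
    (hF : PreservesQuasiIso F) (α : F ⟶ 𝟭 _) : descend F hF ⟶ 𝟭 (DerivedCategory (GrMod 𝒜)) :=
  Localization.liftNatTrans DerivedCategory.Q
    (HomologicalComplex.quasiIso (GrMod 𝒜) (ComplexShape.up ℤ)) (F ⋙ DerivedCategory.Q)
    DerivedCategory.Q _ _
    (Functor.whiskerRight α DerivedCategory.Q ≫ (Functor.leftUnitor _).hom)

/-- The functor `T(-, g)` on the derived category. -/
def tel {d : ℤ} (g : 𝒜 d) : DerivedCategory (GrMod 𝒜) ⥤ DerivedCategory (GrMod 𝒜) :=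
  descend (telC g) (telC_preserves g)

variable {r : ℕ} {d : Fin r → ℤ} (f : ∀ i, 𝒜 (d i))

/-- The functor `RΓ_I` on the derived category, for `I = (f_1, …, f_r)`. -/
def RGamma : DerivedCategory (GrMod 𝒜) ⥤ DerivedCategory (GrMod 𝒜) :=
  descend (gammaC f) (gammaC_preserves f)

/-- The functor `LΛ_I` on the derived category, for `I = (f_1, …, f_r)`. -/
def LLambda : DerivedCategory (GrMod 𝒜) ⥤ DerivedCategory (GrMod 𝒜) :=
  descend (lambdaC f) (lambdaC_preserves f)

/-- The functor `Č_I` on the derived category, for `I = (f_1, …, f_r)`. -/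
def cech : DerivedCategory (GrMod 𝒜) ⥤ DerivedCategory (GrMod 𝒜) :=
  descend (cechC f) (cechC_preserves f)

/-- The functor `E_I` on the derived category, for `I = (f_1, …, f_r)`. -/
def dualCech : DerivedCategory (GrMod 𝒜) ⥤ DerivedCategory (GrMod 𝒜) :=
  descend (dualC f) (dualC_preserves f)

/-- The natural transformation `ε : RΓ_I → id`. -/
def RGammaε : RGamma f ⟶ 𝟭 (DerivedCategory (GrMod 𝒜)) :=
  descendCounit (gammaC_preserves f) (gammaCounitC f)

/-- The natural transformation `η : id → Č_I`. -/
def cechη : 𝟭 (DerivedCategory (GrMod 𝒜)) ⟶ cech f :=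
  descendUnit (cechC_preserves f) (cechAug f)

/-- The natural transformation `ε^∨ : id → LΛ_I`. -/
def LLambdaε : 𝟭 (DerivedCategory (GrMod 𝒜)) ⟶ LLambda f :=
  descendUnit (lambdaC_preserves f) (lambdaUnitC f)

/-- The natural transformation `η^∨ : E_I → id`. -/
def dualCechη : dualCech f ⟶ 𝟭 (DerivedCategory (GrMod 𝒜)) :=
  descendCounit (dualC_preserves f) (dualAug f)

/-- A graded module is `I^∞`-torsion if for every `x` and every `a ∈ I` there is some `n > 0` with
`a ^ n x = 0`. It is enough to ask this for homogeneous `x`, and then `a ^ n x = 0` means that all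
homogeneous components of `a ^ n` kill `x`. -/
def IsTorsion (I : Ideal A) (M : GrMod 𝒜) : Prop :=
  ∀ (w : ℤ) (x : M.X w) (a : A), a ∈ I → ∃ n : ℕ, 0 < n ∧
    ∀ i : ℤ, M.act (rfl : i + w = i + w) (DirectSum.decompose 𝒜 (a ^ n) i) x = 0

variable (𝒜)

/-- The full subcategory of complexes with `I^∞`-torsion cohomology. -/
def DTor (I : Ideal A) : ObjectProperty (DerivedCategory (GrMod 𝒜)) :=
  fun M => ∀ n : ℤ, IsTorsion I ((DerivedCategory.homologyFunctor (GrMod 𝒜) n).obj M)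

/-- The full subcategory of complexes that are derived complete with respect to `I`: the complex
`T(M, g)` is acyclic for every homogeneous `g ∈ I`. -/
def DComp (I : Ideal A) : ObjectProperty (DerivedCategory (GrMod 𝒜)) :=
  fun M => ∀ (m : ℤ) (g : 𝒜 m), (g : A) ∈ I → IsZero ((tel g).obj M)

variable {𝒜}

/-- The full subcategory of `I`-trivial complexes, `I = (f_1, …, f_r)`. -/
def DTriv : ObjectProperty (DerivedCategory (GrMod 𝒜)) :=
  fun M => IsZero ((RGamma f).obj M)

end
end GrMod
end

open CategoryTheory.Pretriangulated GrMod

/-! Let P be the subcategory of complexes with I^∞-torsion cohomology, and write P^⊥ for its right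
orthogonal. The theorem is a formal consequence of two semi-orthogonal decompositions: one of P with
parts RΓ_I and Č_I (`isDecomposition_cech`), and one of P^⊥ with parts E_I and LΛ_I
(`isDecomposition_dualCech`), together with the identifications of the I-trivial complexes with P^⊥
(`dTriv_eq`) and of the complete ones with P^⊥⊥ (`dComp_eq`). The triangles and orthogonality in an
`IsDecomposition` give the adjunctions, exactness, triangulatedness of the parts and naturality of
the triangles. Two decompositions that share P^⊥ give the equivalence of P with P^⊥⊥ and the
remaining adjunctions.

For a single homogeneous g, let P_g be the complexes with g-power torsion cohomology. Localization
is exact, M_g = 0 if and only if M is g-power torsion, and M = M_g if and only if g acts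
bijectively. The fibre of M → M_g therefore gives a decomposition of P_g (`isDecomposition_loc`),
and P_g^⊥ consists of the complexes on whose cohomology g is bijective (`inv_iff`). The telescope
T(-, g) is the colocalization onto P_g^⊥ (`isDecomposition_tel`). The Milnor sequence
(`exists_tel_homology`) shows that g is bijective on the cohomology of T(M, g) (`mulBij_tel`) and
that T(M, g) → M is an isomorphism if g is already bijective on that of M (`isIso_Q_map_telZero`).
Finally, T(-, g) inverts its own counit, since the two natural maps T(T(M, g), g) → T(M, g) have a
common section `telSplit`, induced by the diagonal (x_k) ↦ (x_{j+k}) of towers.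

For several generators, the key point is that localization at f_i inverts M → Č_I(M)
(`isIso_locD_map_cechη`) and T(-, f_i) inverts E_I(M) → M (`isIso_tel_map_dualCechη`). After either
functor the columns of S and S ∪ {i} agree, and a total complex whose columns depend only on S ∪ {i}
contracts onto the column of {i} by an explicit homotopy (`quasiIso_insAug`, `quasiIso_delAug`).
Passing from columns to total complexes is an induction over truncations of the diagram
(`mem_of_columns`). Hence RΓ_I(M) is torsion for every f_i, so for I, while Č_I(M) and E_I(M) are
built from objects on which some f_S is invertible and so lie in P^⊥.

It remains to see that LΛ_I(M) lies in P^⊥⊥ (`eq_zero_of_forall_fprod`): an object N of P^⊥ is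
isomorphic to Č_I(N), hence is built from the localizations of N at the f_S, and LΛ_I(M) receives no
nonzero maps from objects on which some f_S is invertible, because T(LΛ_I(M), f_i) = 0 for all i. -/

noncomputable section
namespace CategoryTheory.ObjectProperty
open Pretriangulated

/-! ### Adjunctions from universal units and counits -/

section Adjoint
variable {C : Type u} [Category.{v} C] (P : ObjectProperty C)

/-- A full subcategory is coreflective as soon as morphisms from its objects factor uniquely
through a natural transformation with values in it. -/
lemma exists_adjunction_of_counit (F : C ⥤ C) (hF : ∀ M, P (F.obj M)) (ε : F ⟶ 𝟭 C)
    (h : ∀ (N M : C), P N → Function.Bijective (fun φ : N ⟶ F.obj M => φ ≫ ε.app M)) :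
    ∃ adj : P.ι ⊣ P.lift F hF, ∀ M, adj.counit.app M = ε.app M := by
  have h' : ∀ (N : P.FullSubcategory) (M : C), Function.Bijective
      (fun φ : N ⟶ (P.lift F hF).obj M => φ.hom ≫ ε.app M) := fun N M =>
    (h N.1 M N.2).comp P.fullyFaithfulι.homEquiv.bijective
  let adj : P.ι ⊣ P.lift F hF := Adjunction.mkOfHomEquiv
    { homEquiv := fun N M => (Equiv.ofBijective _ (h' N M)).symm
      homEquiv_naturality_left_symm := fun f g => Category.assoc _ _ _
      homEquiv_naturality_right := fun {N M M'} f g => by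
        apply (h' N M').1
        have e := Equiv.ofBijective_apply_symm_apply _ (h' N M) f
        have e' := Equiv.ofBijective_apply_symm_apply _ (h' N M') (f ≫ g)
        refine e'.trans ?_
        conv_lhs => rw [← e]
        simp }
  exact ⟨adj, fun M => Category.id_comp _⟩

/-- A full subcategory is reflective as soon as morphisms to its objects factor uniquely
through a natural transformation with values in it. -/
lemma exists_adjunction_of_unit (F : C ⥤ C) (hF : ∀ M, P (F.obj M)) (η : 𝟭 C ⟶ F)
    (h : ∀ (N M : C), P N → Function.Bijective (fun φ : F.obj M ⟶ N => η.app M ≫ φ)) :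
    ∃ adj : P.lift F hF ⊣ P.ι, ∀ M, adj.unit.app M = η.app M := by
  have h' : ∀ (M : C) (N : P.FullSubcategory), Function.Bijective
      (fun φ : (P.lift F hF).obj M ⟶ N => η.app M ≫ φ.hom) := fun M N =>
    (h N.1 M N.2).comp P.fullyFaithfulι.homEquiv.bijective
  let adj : P.lift F hF ⊣ P.ι := Adjunction.mkOfHomEquiv
    { homEquiv := fun M N => Equiv.ofBijective _ (h' M N)
      homEquiv_naturality_left_symm := fun {M' M N} f g => by
        apply (h' M' N).1
        have e := Equiv.ofBijective_apply_symm_apply _ (h' M N) g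
        have e' := Equiv.ofBijective_apply_symm_apply _ (h' M' N) (f ≫ g)
        refine e'.trans ?_
        conv_lhs => rw [← e]
        exact (Category.assoc _ _ _).symm.trans ((congrArg (· ≫ _) (η.naturality f)).trans
          (Category.assoc _ _ _))
      homEquiv_naturality_right := fun f g => (Category.assoc _ _ _).symm }
  exact ⟨adj, fun M => Category.comp_id _⟩

end Adjoint

/-! ### Semi-orthogonal decompositions in a triangulated category -/

section Triangulated
variable {C : Type u} [Category.{v} C] [HasZeroObject C] [HasShift C ℤ] [Preadditive C]
  [∀ n : ℤ, (shiftFunctor C n).Additive] [Pretriangulated C] (P : ObjectProperty C)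

/-- The right adjoint of a triangulated functor is triangulated, and `F` is that adjoint followed by
the inclusion. No shift structure on `F` is given beforehand; it is transported through the
adjunction, which is why it appears existentially. -/
lemma exists_isTriangulated_of_counit [P.IsTriangulated] (F : C ⥤ C) (hF : ∀ M, P (F.obj M))
    (adj : P.ι ⊣ P.lift F hF) : ∃ _ : F.CommShift ℤ, F.IsTriangulated := by
  let _ : (P.lift F hF).CommShift ℤ := adj.rightAdjointCommShift ℤ
  have := adj.commShift_of_leftAdjoint ℤ
  have := adj.isTriangulated_rightAdjoint
  exact ⟨inferInstanceAs ((P.lift F hF ⋙ P.ι).CommShift ℤ),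
    inferInstanceAs ((P.lift F hF ⋙ P.ι).IsTriangulated)⟩

lemma exists_isTriangulated_of_unit [P.IsTriangulated] (F : C ⥤ C) (hF : ∀ M, P (F.obj M))
    (adj : P.lift F hF ⊣ P.ι) : ∃ _ : F.CommShift ℤ, F.IsTriangulated := by
  let _ : (P.lift F hF).CommShift ℤ := adj.leftAdjointCommShift ℤ
  have := adj.commShift_of_rightAdjoint ℤ
  have := adj.isTriangulated_leftAdjoint
  exact ⟨inferInstanceAs ((P.lift F hF ⋙ P.ι).CommShift ℤ),
    inferInstanceAs ((P.lift F hF ⋙ P.ι).IsTriangulated)⟩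

/-- A semi-orthogonal decomposition: functorial triangles `Γ M ⟶ M ⟶ L M ⟶ (Γ M)⟦1⟧` with
`Γ M` in `P` and `L M` in the right orthogonal of `P`. -/
structure IsDecomposition (Γ L : C ⥤ C) (ε : Γ ⟶ 𝟭 C) (η : 𝟭 C ⟶ L) : Prop where
  left : ∀ M, P (Γ.obj M)
  right : ∀ M, P.rightOrthogonal (L.obj M)
  triangle : ∀ M, ∃ δ : L.obj M ⟶ (Γ.obj M)⟦(1 : ℤ)⟧,
    Triangle.mk (ε.app M) (η.app M) δ ∈ distTriang C

namespace IsDecomposition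
variable {P} [P.IsStableUnderShift ℤ] {Γ L : C ⥤ C} {ε : Γ ⟶ 𝟭 C} {η : 𝟭 C ⟶ L}
  (h : P.IsDecomposition Γ L ε η)
include h

/-- Apply Hom(N, -) to the triangle of M. Surjectivity needs Hom(N, L M) = 0, injectivity needs
Hom(N, (L M)[-1]) = 0, and the right orthogonal is stable under shifts because `P` is. -/
lemma bijective_counit {N : C} (hN : P N) (M : C) :
    Function.Bijective (fun φ : N ⟶ Γ.obj M => φ ≫ ε.app M) := by
  obtain ⟨δ, hδ⟩ := h.triangle M
  constructor
  · suffices ∀ φ : N ⟶ Γ.obj M, φ ≫ ε.app M = 0 → φ = 0 from fun φ ψ e =>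
      sub_eq_zero.1 (this _ (by simpa [Preadditive.sub_comp, sub_eq_zero] using e))
    intro φ hφ
    obtain ⟨ψ, rfl⟩ := Triangle.coyoneda_exact₂ _ (inv_rot_of_distTriang _ hδ) φ hφ
    have : ψ = 0 := P.rightOrthogonal.le_shift (-1 : ℤ) _ (h.right M) ψ hN
    rw [this]
    exact zero_comp
  · intro φ
    obtain ⟨ψ, hψ⟩ := Triangle.coyoneda_exact₂ _ hδ φ (h.right M _ hN)
    exact ⟨ψ, hψ.symm⟩

/-- Apply Hom(-, N) to the triangle of M; injectivity uses that (Γ M)[1] still lies in `P`. -/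
lemma bijective_unit {N : C} (hN : P.rightOrthogonal N) (M : C) :
    Function.Bijective (fun φ : L.obj M ⟶ N => η.app M ≫ φ) := by
  obtain ⟨δ, hδ⟩ := h.triangle M
  constructor
  · suffices ∀ φ : L.obj M ⟶ N, η.app M ≫ φ = 0 → φ = 0 from fun φ ψ e =>
      sub_eq_zero.1 (this _ (by simpa [Preadditive.comp_sub, sub_eq_zero] using e))
    intro φ hφ
    obtain ⟨ψ, rfl⟩ := Triangle.yoneda_exact₃ _ hδ φ hφ
    have : ψ = 0 := hN ψ (P.le_shift (1 : ℤ) _ (h.left M))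
    rw [this]
    exact comp_zero
  · intro φ
    obtain ⟨ψ, hψ⟩ := Triangle.yoneda_exact₂ _ hδ φ (hN _ (h.left M))
    exact ⟨ψ, hψ.symm⟩

omit [P.IsStableUnderShift ℤ] in
lemma isIso_counit_iff (M : C) : IsIso (ε.app M) ↔ IsZero (L.obj M) := by
  obtain ⟨δ, hδ⟩ := h.triangle M
  exact (Triangle.isZero₃_iff_isIso₁ _ hδ).symm

omit [P.IsStableUnderShift ℤ] in
lemma isIso_unit_iff (M : C) : IsIso (η.app M) ↔ IsZero (Γ.obj M) := by
  obtain ⟨δ, hδ⟩ := h.triangle M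
  exact (Triangle.isZero₁_iff_isIso₂ _ hδ).symm

/-- If the unit vanishes at M, then the identity and the zero map of L M agree after precomposition
with it, so they are equal by the uniqueness in `bijective_unit`. -/
lemma isZero_right_iff_unit (M : C) : IsZero (L.obj M) ↔ η.app M = 0 := by
  refine ⟨fun hz => hz.eq_of_tgt _ _, fun h0 => ?_⟩
  rw [IsZero.iff_id_eq_zero]
  exact (h.bijective_unit (h.right M) M).1 (by simp [h0])

lemma isZero_left_iff_counit (M : C) : IsZero (Γ.obj M) ↔ ε.app M = 0 := by
  refine ⟨fun hz => hz.eq_of_src _ _, fun h0 => ?_⟩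
  rw [IsZero.iff_id_eq_zero]
  exact (h.bijective_counit (h.left M) M).1 (by simp [h0])

/-- The source of the counit lies in `P`, so the counit vanishes at objects orthogonal to `P`;
conversely Γ M = 0 forces M ≅ L M. -/
lemma mem_right_iff (M : C) : P.rightOrthogonal M ↔ IsZero (Γ.obj M) := by
  refine ⟨fun hM => (h.isZero_left_iff_counit M).2 (hM _ (h.left M)), fun hz => ?_⟩
  have := (h.isIso_unit_iff M).2 hz
  exact P.rightOrthogonal.prop_of_iso (asIso (η.app M)).symm (h.right M)

variable [P.IsClosedUnderIsomorphisms]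

lemma mem_left_iff (M : C) : P M ↔ IsZero (L.obj M) := by
  refine ⟨fun hM => (h.isZero_right_iff_unit M).2 (h.right M _ hM), fun hz => ?_⟩
  have := (h.isIso_counit_iff M).2 hz
  exact P.prop_of_iso (asIso (ε.app M)) (h.left M)

/-- Since `P` is detected by the vanishing of L, it equals the left orthogonal of its right
orthogonal, and orthogonals of shift-stable properties are triangulated. Closure of `P` under cones
therefore never has to be checked directly. -/
lemma isTriangulated : P.IsTriangulated := by
  have e : P = P.rightOrthogonal.leftOrthogonal := by
    ext M
    refine ⟨fun hM N φ hN => hN φ hM, fun hM => ?_⟩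
    exact (h.mem_left_iff M).2 ((h.isZero_right_iff_unit M).2 (hM _ (h.right M)))
  rw [e]
  infer_instance

omit [P.IsClosedUnderIsomorphisms] in
lemma exists_adjunction_counit :
    ∃ adj : P.ι ⊣ P.lift Γ h.left, ∀ M, adj.counit.app M = ε.app M :=
  P.exists_adjunction_of_counit Γ h.left ε fun _ M hN => h.bijective_counit hN M

omit [P.IsClosedUnderIsomorphisms] in
lemma exists_adjunction_unit :
    ∃ adj : P.rightOrthogonal.lift L h.right ⊣ P.rightOrthogonal.ι,
      ∀ M, adj.unit.app M = η.app M :=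
  P.rightOrthogonal.exists_adjunction_of_unit L h.right η fun _ M hN => h.bijective_unit hN M

lemma exists_isTriangulated_left : ∃ _ : Γ.CommShift ℤ, Γ.IsTriangulated := by
  have := h.isTriangulated
  obtain ⟨adj, -⟩ := h.exists_adjunction_counit
  exact P.exists_isTriangulated_of_counit Γ h.left adj

omit [P.IsClosedUnderIsomorphisms] in
lemma exists_isTriangulated_right : ∃ _ : L.CommShift ℤ, L.IsTriangulated := by
  obtain ⟨adj, -⟩ := h.exists_adjunction_unit
  exact P.rightOrthogonal.exists_isTriangulated_of_unit L h.right adj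

omit [P.IsClosedUnderIsomorphisms] in
/-- The triangles of a semi-orthogonal decomposition are natural. -/
lemma exists_natTrans : ∃ δ : L ⟶ Γ ⋙ shiftFunctor C (1 : ℤ),
    ∀ M, Triangle.mk (ε.app M) (η.app M) (δ.app M) ∈ distTriang C := by
  choose δ hδ using h.triangle
  refine ⟨{ app := δ, naturality := fun M N φ => ?_ }, hδ⟩
  obtain ⟨ψ, h1, h2⟩ := complete_distinguished_triangle_morphism _ _ (hδ M) (hδ N) (Γ.map φ) φ
    (ε.naturality φ).symm
  -- The third component of a morphism of triangles is not unique in general; here it is forced,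
  -- because maps from L M into the right orthogonal are determined by their composite with the
  -- unit.
  have : ψ = L.map φ := (h.bijective_unit (h.right N) M).1 (h1.trans (η.naturality φ))
  subst this
  exact h2.symm

/-- L annihilates Γ M, so it turns the triangle of M into an isomorphism L M ≅ L (L M). -/
lemma isIso_map_unit (M : C) : IsIso (L.map (η.app M)) := by
  obtain ⟨_, _⟩ := h.exists_isTriangulated_right
  obtain ⟨δ, hδ⟩ := h.triangle M
  exact (Triangle.isZero₁_iff_isIso₂ _ (L.map_distinguished _ hδ)).1
    ((h.mem_left_iff _).1 (h.left M))

lemma isIso_map_counit (M : C) : IsIso (Γ.map (ε.app M)) := by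
  obtain ⟨_, _⟩ := h.exists_isTriangulated_left
  obtain ⟨δ, hδ⟩ := h.triangle M
  exact (Triangle.isZero₃_iff_isIso₁ _ (Γ.map_distinguished _ hδ)).1
    ((h.mem_right_iff _).1 (h.right M))

end IsDecomposition

/-! ### Two decompositions sharing a common part -/

section Recollement
variable {P} [P.IsStableUnderShift ℤ] [P.IsClosedUnderIsomorphisms] {Γ L E Λ : C ⥤ C}
  {ε : Γ ⟶ 𝟭 C} {η : 𝟭 C ⟶ L} {η' : E ⟶ 𝟭 C} {ε' : 𝟭 C ⟶ Λ}
  (h : P.IsDecomposition Γ L ε η) (h' : P.rightOrthogonal.IsDecomposition E Λ η' ε')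
include h h'

/-- The fibre E M of the unit M → Λ M lies in the right orthogonal of `P`, which is where Γ
vanishes. -/
lemma IsDecomposition.isIso_left_map_unit (M : C) : IsIso (Γ.map (ε'.app M)) := by
  obtain ⟨_, _⟩ := h.exists_isTriangulated_left
  obtain ⟨δ, hδ⟩ := h'.triangle M
  exact (Triangle.isZero₁_iff_isIso₂ _ (Γ.map_distinguished _ hδ)).1
    ((h.mem_right_iff _).1 (h'.left M))

omit [P.IsClosedUnderIsomorphisms] in
-- The cone L M of the counit Γ M → M lies in the right orthogonal of `P`, the left part of the
-- second decomposition, and Λ vanishes there.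
lemma IsDecomposition.isIso_right_map_counit (M : C) : IsIso (Λ.map (ε.app M)) := by
  obtain ⟨_, _⟩ := h'.exists_isTriangulated_right
  obtain ⟨δ, hδ⟩ := h.triangle M
  exact (Triangle.isZero₃_iff_isIso₁ _ (Λ.map_distinguished _ hδ)).1
    ((h'.mem_left_iff _).1 (h.right M))

/-- In a recollement, the left part of the first decomposition is equivalent to the right part of
the second one. -/
lemma IsDecomposition.exists_equivalence :
    ∃ e : P.FullSubcategory ≌ P.rightOrthogonal.rightOrthogonal.FullSubcategory,
      e.functor = P.ι ⋙ P.rightOrthogonal.rightOrthogonal.lift Λ h'.right ∧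
      e.inverse = P.rightOrthogonal.rightOrthogonal.ι ⋙ P.lift Γ h.left := by
  have h1 := fun M => h.isIso_left_map_unit h' M
  have h2 := fun M => h.isIso_right_map_counit h' M
  have h3 : ∀ M : P.FullSubcategory, IsIso (ε.app M.1) := fun M =>
    (h.isIso_counit_iff _).2 ((h.mem_left_iff _).1 M.2)
  have h4 : ∀ M : P.rightOrthogonal.rightOrthogonal.FullSubcategory, IsIso (ε'.app M.1) :=
    fun M => (h'.isIso_unit_iff _).2 ((h'.mem_right_iff _).1 M.2)
  refine ⟨CategoryTheory.Equivalence.mk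
    (P.ι ⋙ P.rightOrthogonal.rightOrthogonal.lift Λ h'.right)
    (P.rightOrthogonal.rightOrthogonal.ι ⋙ P.lift Γ h.left)
    -- For M in `P` the comparison is M ≅ Γ M ≅ Γ (Λ M): the counit is invertible on `P`, and Γ
    -- inverts the unit of the second decomposition.
    (NatIso.ofComponents (fun M => P.isoMk
      ((asIso (ε.app M.1)).symm ≪≫ asIso (Γ.map (ε'.app M.1)))) ?_)
    -- For M in the double orthogonal the comparison is Λ (Γ M) ≅ Λ M ≅ M.
    (NatIso.ofComponents (fun M => P.rightOrthogonal.rightOrthogonal.isoMk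
      ((asIso (Λ.map (ε.app M.1))) ≪≫ (asIso (ε'.app M.1)).symm)) ?_), rfl, rfl⟩
  · intro M N φ
    ext
    simp only [Iso.trans_hom, Iso.symm_hom, asIso_inv, asIso_hom, isoMk_hom, Functor.id_map,
      Functor.comp_map, FullSubcategory.comp_hom, lift_map, ι_map, Category.assoc, homMk_hom]
    rw [← Functor.map_comp, ← ε'.naturality, IsIso.eq_inv_comp, Functor.map_comp]
    erw [← ε.naturality_assoc]
    simp
  · intro M N φ
    ext
    simp only [Iso.trans_hom, Iso.symm_hom, asIso_inv, asIso_hom, isoMk_hom, Functor.id_map,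
      Functor.comp_map, FullSubcategory.comp_hom, lift_map, ι_map, Category.assoc, homMk_hom]
    have e : Γ.map φ.hom ≫ ε.app N.1 = ε.app M.1 ≫ φ.hom := ε.naturality φ.hom
    rw [← Functor.map_comp_assoc, e, Functor.map_comp_assoc]
    congr 1
    rw [IsIso.eq_inv_comp, ← Category.assoc, IsIso.comp_inv_eq]
    exact (ε'.naturality φ.hom).symm

/-- Compose the adjunction of Λ with the inclusion of the double orthogonal and the adjunction of
the inverse equivalence with the equivalence. The left adjoint obtained is Γ ∘ Λ, which is Γ because
Γ inverts M → Λ M. -/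
lemma IsDecomposition.nonempty_adjunction_left :
    Nonempty (P.lift Γ h.left ⊣ (P.ι ⋙ P.rightOrthogonal.rightOrthogonal.lift Λ h'.right) ⋙
      P.rightOrthogonal.rightOrthogonal.ι) := by
  obtain ⟨e, he1, he2⟩ := h.exists_equivalence h'
  obtain ⟨adj, -⟩ := h'.exists_adjunction_unit
  have h1 := fun M => h.isIso_left_map_unit h' M
  rw [← he1]
  refine ⟨(adj.comp e.symm.toAdjunction).ofNatIsoLeft ?_⟩
  change P.rightOrthogonal.rightOrthogonal.lift Λ h'.right ⋙ e.inverse ≅ _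
  rw [he2]
  exact NatIso.ofComponents (fun M => P.isoMk (asIso (Γ.map (ε'.app M))).symm) (by
    intro M N φ
    ext
    simp only [Iso.symm_hom, asIso_inv, isoMk_hom,
      Functor.comp_map, FullSubcategory.comp_hom, lift_map, ι_map, homMk_hom]
    rw [IsIso.eq_inv_comp, ← Category.assoc, IsIso.comp_inv_eq, ← Functor.map_comp,
      ← Functor.map_comp]
    exact congrArg _ (ε'.naturality φ).symm)

/-- Here the composite right adjoint is Λ ∘ Γ, which is Λ because Λ inverts Γ M → M. -/
lemma IsDecomposition.nonempty_adjunction_right :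
    Nonempty ((P.rightOrthogonal.rightOrthogonal.ι ⋙ P.lift Γ h.left) ⋙ P.ι ⊣
      P.rightOrthogonal.rightOrthogonal.lift Λ h'.right) := by
  obtain ⟨e, he1, he2⟩ := h.exists_equivalence h'
  obtain ⟨adj, -⟩ := h.exists_adjunction_counit
  have h1 := fun M => h.isIso_right_map_counit h' M
  rw [← he2]
  refine ⟨(e.symm.toAdjunction.comp adj).ofNatIsoRight ?_⟩
  change P.lift Γ h.left ⋙ e.functor ≅ _
  rw [he1]
  exact NatIso.ofComponents (fun M => P.rightOrthogonal.rightOrthogonal.isoMk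
    (asIso (Λ.map (ε.app M)))) (by
    intro M N φ
    ext
    simp only [asIso_hom, isoMk_hom,
      Functor.comp_map, FullSubcategory.comp_hom, lift_map, ι_map, homMk_hom]
    rw [← Functor.map_comp, ← Functor.map_comp]
    exact congrArg _ (ε.naturality φ))

end Recollement

end Triangulated
end CategoryTheory.ObjectProperty
end

/-! ### Functors, transformations and triangles descended to the derived category -/

noncomputable section
namespace GrMod
open Pretriangulated DerivedCategory
variable {A : Type u} [CommRing A] {𝒜 : ℤ → AddSubgroup A} [GradedRing 𝒜]
variable [HasDerivedCategory.{w} (GrMod 𝒜)]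

section
variable {F : CochainComplex (GrMod 𝒜) ℤ ⥤ CochainComplex (GrMod 𝒜) ℤ} (hF : PreservesQuasiIso F)
  {G : CochainComplex (GrMod 𝒜) ℤ ⥤ CochainComplex (GrMod 𝒜) ℤ} (hG : PreservesQuasiIso G)

/-- The descended functor is computed by the functor on complexes. -/
def descendIso : Q ⋙ descend F hF ≅ F ⋙ Q :=
  Localization.Lifting.iso Q (HomologicalComplex.quasiIso (GrMod 𝒜) (ComplexShape.up ℤ)) _ _

lemma descendUnit_app (α : 𝟭 _ ⟶ F) (K : CochainComplex (GrMod 𝒜) ℤ) :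
    (descendUnit hF α).app (Q.obj K) = Q.map (α.app K) ≫ (descendIso hF).inv.app K := by
  refine (Localization.liftNatTrans_app _ _ _ _ _ _ _ _).trans ?_
  simp only [NatTrans.comp_app, Functor.leftUnitor_inv_app, Functor.whiskerRight_app,
    Category.id_comp]
  exact Category.id_comp _

lemma descendCounit_app (α : F ⟶ 𝟭 _) (K : CochainComplex (GrMod 𝒜) ℤ) :
    (descendCounit hF α).app (Q.obj K) = (descendIso hF).hom.app K ≫ Q.map (α.app K) := by
  refine (Localization.liftNatTrans_app _ _ _ _ _ _ _ _).trans ?_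
  simp only [NatTrans.comp_app, Functor.leftUnitor_hom_app, Functor.whiskerRight_app]
  exact congrArg _ ((Category.comp_id _).trans (Category.comp_id _))

lemma descendUnit_comp_hom (α : 𝟭 _ ⟶ F) (K : CochainComplex (GrMod 𝒜) ℤ) :
    (descendUnit hF α).app (Q.obj K) ≫ (descendIso hF).hom.app K = Q.map (α.app K) := by
  refine (congrArg (· ≫ _) (descendUnit_app hF α K)).trans ((Category.assoc _ _ _).trans ?_)
  exact (congrArg _ ((descendIso hF).inv_hom_id_app K)).trans (Category.comp_id _)

/-- A natural transformation of functors on complexes descends to the derived category. -/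
def descendMap (α : F ⟶ G) : descend F hF ⟶ descend G hG :=
  Localization.liftNatTrans Q (HomologicalComplex.quasiIso (GrMod 𝒜) (ComplexShape.up ℤ)) (F ⋙ Q)
    (G ⋙ Q) _ _ (Functor.whiskerRight α Q)

lemma descendMap_app (α : F ⟶ G) (K : CochainComplex (GrMod 𝒜) ℤ) :
    (descendMap hF hG α).app (Q.obj K) =
      (descendIso hF).hom.app K ≫ Q.map (α.app K) ≫ (descendIso hG).inv.app K := by
  exact Localization.liftNatTrans_app _ _ _ _ _ _ _ _

/-- Every object of the derived category is represented by a complex. -/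
lemma exists_Q_iso (M : DerivedCategory (GrMod 𝒜)) :
    ∃ K : CochainComplex (GrMod 𝒜) ℤ, Nonempty (Q.obj K ≅ M) :=
  ⟨_, ⟨Q.objObjPreimageIso M⟩⟩

/-- Reduces a statement about every object of the derived category to objects represented by
complexes. -/
lemma isIso_app_of_iso {C D : Type*} [Category* C] [Category* D] {F G : C ⥤ D} (α : F ⟶ G)
    {X Y : C} (e : X ≅ Y) [IsIso (α.app X)] : IsIso (α.app Y) := by
  have h : α.app Y = F.map e.inv ≫ α.app X ≫ G.map e.hom := by
    rw [← α.naturality, ← Category.assoc, ← F.map_comp, e.inv_hom_id, F.map_id, Category.id_comp]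
  rw [h]
  infer_instance

lemma exists_triangle_of_iso {C : Type*} [Category* C] [HasZeroObject C] [HasShift C ℤ]
    [Preadditive C] [∀ n : ℤ, (shiftFunctor C n).Additive] [Pretriangulated C]
    {F G H : C ⥤ C} (a : F ⟶ G) (b : G ⟶ H) {X Y : C} (e : X ≅ Y)
    (h : ∃ δ, Triangle.mk (a.app X) (b.app X) δ ∈ distTriang C) :
    ∃ δ, Triangle.mk (a.app Y) (b.app Y) δ ∈ distTriang C := by
  obtain ⟨δ, hδ⟩ := h
  refine ⟨H.map e.inv ≫ δ ≫ (shiftFunctor C (1 : ℤ)).map (F.map e.hom),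
    isomorphic_distinguished _ hδ _ (Triangle.isoMk _ _ (F.mapIso e.symm) (G.mapIso e.symm)
      (H.mapIso e.symm) (a.naturality _).symm (b.naturality _).symm ?_)⟩
  change (H.map e.inv ≫ δ ≫ (shiftFunctor C (1 : ℤ)).map (F.map e.hom)) ≫
    (shiftFunctor C (1 : ℤ)).map (F.map e.inv) = H.map e.inv ≫ δ
  rw [Category.assoc, Category.assoc, ← Functor.map_comp, ← F.map_comp, e.hom_inv_id, F.map_id,
    CategoryTheory.Functor.map_id, Category.comp_id]

lemma exists_triangle_of_isos {C : Type*} [Category* C] [HasZeroObject C] [HasShift C ℤ]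
    [Preadditive C] [∀ n : ℤ, (shiftFunctor C n).Additive] [Pretriangulated C]
    {X Y Z X' Y' Z' : C} {a : X ⟶ Y} {b : Y ⟶ Z} {δ : Z ⟶ X⟦(1 : ℤ)⟧}
    (h : Triangle.mk a b δ ∈ distTriang C) (a' : X' ⟶ Y') (b' : Y' ⟶ Z') (e₁ : X' ≅ X)
    (e₂ : Y' ≅ Y) (e₃ : Z' ≅ Z) (ha : a' ≫ e₂.hom = e₁.hom ≫ a)
    (hb : b' ≫ e₃.hom = e₂.hom ≫ b) :
    ∃ δ', Triangle.mk a' b' δ' ∈ distTriang C := by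
  refine ⟨e₃.hom ≫ δ ≫ (shiftFunctor C (1 : ℤ)).map e₁.inv, isomorphic_distinguished _ h _
    (Triangle.isoMk _ _ e₁ e₂ e₃ ha hb ?_)⟩
  change (e₃.hom ≫ δ ≫ (shiftFunctor C (1 : ℤ)).map e₁.inv) ≫
    (shiftFunctor C (1 : ℤ)).map e₁.hom = e₃.hom ≫ δ
  rw [Category.assoc, Category.assoc, ← Functor.map_comp, e₁.inv_hom_id, CategoryTheory.Functor.map_id,
    Category.comp_id]

/-- On a representing complex this is the standard triangle of a mapping cocone. Only the existence
of the third morphism is claimed: its naturality comes later, from orthogonality. -/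
lemma coconeFunctor_triangle {α : 𝟭 _ ⟶ F} (h : PreservesQuasiIso (coconeFunctor α))
    (M : DerivedCategory (GrMod 𝒜)) :
    ∃ δ, Triangle.mk ((descendCounit h (coconeFst α)).app M) ((descendUnit hF α).app M) δ ∈
      distTriang _ := by
  obtain ⟨K, ⟨e⟩⟩ := exists_Q_iso M
  refine exists_triangle_of_iso _ _ e ?_
  refine exists_triangle_of_isos (mappingCocone_triangle_distinguished (α.app K)) _ _
    ((descendIso h).app K) (Iso.refl _) ((descendIso hF).app K) ?_ ?_
  · exact (Category.comp_id _).trans (descendCounit_app h (coconeFst α) K)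
  · refine (congrArg (· ≫ _) (descendUnit_app hF α K)).trans ?_
    refine (Category.assoc _ _ _).trans ?_
    refine (congrArg _ ((descendIso hF).inv_hom_id_app K)).trans ?_
    exact (Category.comp_id _).trans (Category.id_comp _).symm

lemma coneFunctor_triangle {α : F ⟶ 𝟭 _} (h : PreservesQuasiIso (coneFunctor α))
    (M : DerivedCategory (GrMod 𝒜)) :
    ∃ δ, Triangle.mk ((descendCounit hF α).app M) ((descendUnit h (coneInr α)).app M) δ ∈
      distTriang _ := by
  obtain ⟨K, ⟨e⟩⟩ := exists_Q_iso M
  refine exists_triangle_of_iso _ _ e ?_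
  refine exists_triangle_of_isos (mappingCone_triangle_distinguished (α.app K)) _ _
    ((descendIso hF).app K) (Iso.refl _) ((descendIso h).app K) ?_ ?_
  · exact (Category.comp_id _).trans (descendCounit_app hF α K)
  · refine (congrArg (· ≫ _) (descendUnit_app h (coneInr α) K)).trans ?_
    refine (Category.assoc _ _ _).trans ?_
    refine (congrArg _ ((descendIso h).inv_hom_id_app K)).trans ?_
    exact (Category.comp_id _).trans (Category.id_comp _).symm

end
end GrMod
end

/-! ### Multiplication by a homogeneous element and localization of graded modules -/

noncomputable section
namespace GrMod
variable {A : Type u} [CommRing A] {𝒜 : ℤ → AddSubgroup A} [GradedRing 𝒜]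

section
variable {M N : GrMod 𝒜}

lemma isIso_of_bijective (φ : M ⟶ N) (h : ∀ w, Function.Bijective (ev φ w)) : IsIso φ := by
  have hr : ∀ w y, ev φ w ((AddEquiv.ofBijective (ev φ w) (h w)).symm y) = y := fun w y =>
    (AddEquiv.ofBijective (ev φ w) (h w)).apply_symm_apply y
  refine ⟨mkHom (M := N) (N := M)
    (fun w => (AddEquiv.ofBijective (ev φ w) (h w)).symm.toAddMonoidHom)
    (fun {i j k} hk a x => (h k).1 ?_), ?_, ?_⟩
  · change ev φ k ((AddEquiv.ofBijective (ev φ k) (h k)).symm _) =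
      ev φ k (M.act hk a ((AddEquiv.ofBijective (ev φ j) (h j)).symm x))
    rw [hr, ev_act, hr]
  · ext w x
    exact (AddEquiv.ofBijective (ev φ w) (h w)).symm_apply_apply x
  · ext w x
    exact hr w x

lemma ev_hom_inv (e : M ≅ N) (w : ℤ) (x : M.X w) : ev e.inv w (ev e.hom w x) = x := by
  rw [← ev_comp, e.hom_inv_id, ev_id]

lemma ev_inv_hom (e : M ≅ N) (w : ℤ) (x : N.X w) : ev e.hom w (ev e.inv w x) = x := by
  rw [← ev_comp, e.inv_hom_id, ev_id]

lemma bijective_of_isIso (φ : M ⟶ N) [IsIso φ] (w : ℤ) : Function.Bijective (ev φ w) :=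
  ⟨fun x y h => by rw [← ev_hom_inv (asIso φ) w x, ← ev_hom_inv (asIso φ) w y]; exact congrArg _ h,
    fun y => ⟨_, ev_inv_hom (asIso φ) w y⟩⟩

lemma isZero_iff : IsZero M ↔ ∀ w (x : M.X w), x = 0 := by
  rw [IsZero.iff_id_eq_zero]
  exact ⟨fun h w x => congrArg (fun q => ev q w x) h, fun h => hom_ext h⟩

/-- Multiplication by `g` is bijective. -/
def MulBij {d : ℤ} (g : 𝒜 d) (M : GrMod 𝒜) : Prop :=
  ∀ (i j : ℤ) (h : d + i = j), Function.Bijective (M.act h g)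

/-- Every element is killed by a power of `g`. -/
def PowTorsion {d : ℤ} (g : 𝒜 d) (M : GrMod 𝒜) : Prop :=
  ∀ (w : ℤ) (x : M.X w), ∃ k : ℕ, ∀ (j : ℤ) (h : k * d + w = j), M.act h (hpow g k) x = 0

variable {d : ℤ} (g : 𝒜 d)

lemma PowTorsion.of_iso {g : 𝒜 d} (h : PowTorsion g M) (e : M ≅ N) : PowTorsion g N := by
  intro w x
  obtain ⟨k, hk⟩ := h w (ev e.inv w x)
  refine ⟨k, fun j hj => ?_⟩
  rw [← ev_inv_hom e w x, ← ev_act, hk, map_zero]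

lemma MulBij.of_iso {g : 𝒜 d} (h : MulBij g M) (e : M ≅ N) : MulBij g N := by
  intro i j hj
  constructor
  · rw [injective_iff_map_eq_zero]
    intro x hx
    have := (injective_iff_map_eq_zero _).1 (h i j hj).1 (ev e.inv i x) (by
      rw [← ev_act, hx, map_zero])
    rw [← ev_inv_hom e i x, this, map_zero]
  · intro y
    obtain ⟨x, hx⟩ := (h i j hj).2 (ev e.inv j y)
    exact ⟨ev e.hom i x, by rw [← ev_act, hx, ev_inv_hom]⟩

lemma MulBij.hpow {g : 𝒜 d} (h : MulBij g M) (k : ℕ) : MulBij (hpow g k) M := by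
  induction k with
  | zero =>
    intro i j hj
    have hij : i = j := by simpa using hj
    subst hij
    have : ⇑(M.act hj (GrMod.hpow g 0)) = id := funext fun x => M.act_one _ _ (by simp) x
    rw [this]
    exact Function.bijective_id
  | succ k ih =>
    intro i j hj
    have : ⇑(M.act hj (GrMod.hpow g (k + 1))) =
        (M.act (show d + (k * d + i) = j by push_cast at hj; linarith) g) ∘
          (M.act rfl (GrMod.hpow g k)) := funext fun x =>
      (M.act_act _ _ _ _ _ _ (by simp [pow_succ']) x).symm
    rw [this]
    exact (h _ _ _).comp (ih _ _ _)

/-- Multiplication by `g ^ a` after multiplication by `g ^ b`. -/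
lemma hpow_act (M : GrMod 𝒜) (a b : ℕ) {i j l : ℤ} (hb : b * d + i = j) (ha : a * d + j = l)
    (x : M.X i) : M.act ha (hpow g a) (M.act hb (hpow g b) x) =
      M.act (show ((a + b : ℕ) : ℤ) * d + i = l by push_cast; linarith) (hpow g (a + b)) x :=
  M.act_act _ _ _ _ _ _ (by simp [pow_add]) x

lemma act_comm (M : GrMod 𝒜) {i j k l m n : ℤ} (a : 𝒜 i) (b : 𝒜 j) (h₁ : j + k = l)
    (h₂ : i + l = n) (h₃ : i + k = m) (h₄ : j + m = n) (x : M.X k) :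
    M.act h₂ a (M.act h₁ b x) = M.act h₄ b (M.act h₃ a x) :=
  (M.act_act _ _ (show i + j + k = n by omega) a b
    ⟨_, SetLike.GradedMul.mul_mem a.2 b.2⟩ rfl x).trans
    (M.act_act _ _ _ _ _ _ (mul_comm _ _) x).symm

/-- An element of a direct limit vanishes exactly when it does at some later stage. Here and below
the target weight `j` is a variable with an equation, so that no element has to be transported
between equal weights. -/
lemma frac_zero_iff (M : GrMod 𝒜) (w : ℤ) (k : ℕ) (x : M.X (w + k * d)) :
    frac g M w k x = 0 ↔ ∃ m : ℕ, ∀ (j : ℤ) (h : m * d + (w + k * d) = j),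
      M.act h (hpow g m) x = 0 := by
  constructor
  · intro hx
    obtain ⟨j, hj, h⟩ := frac_eq_zero _ _ _ _ _ hx
    refine ⟨j - k, ?_⟩
    intro l h'
    obtain rfl : w + j * d = l := by rw [← h']; push_cast [Nat.cast_sub hj]; ring
    exact h
  · rintro ⟨m, h⟩
    rw [← frac_step g M w (Nat.le_add_right k m)]
    have := h (w + (k + m : ℕ) * d) (by push_cast; ring)
    rw [← map_zero (frac g M w (k + m)), ← this]
    congr 1
    exact M.act_congr _ _ _ _ (by simp) x

lemma toLoc_eq_zero_iff (M : GrMod 𝒜) (w : ℤ) (x : M.X w) :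
    ev ((toLoc g).app M) w x = 0 ↔ ∃ m : ℕ, ∀ (j : ℤ) (h : m * d + w = j),
      M.act h (hpow g m) x = 0 := by
  rw [ev_toLoc, frac_zero_iff]
  refine exists_congr fun m => forall_congr' fun j => ?_
  constructor
  · intro h h'
    rw [← h (by simpa using h')]
    exact (M.act_act _ _ _ _ _ _ (by simp) x).symm
  · intro h h'
    rw [← h (by simpa using h')]
    exact M.act_act _ _ _ _ _ _ (by simp) x

/-- Multiplying x / g^k by g^k gives x / 1. Together with `toLoc_eq_zero_iff` this says that the
kernel and the cokernel of M → M_g are g-power torsion. -/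
lemma exists_toLoc_eq (M : GrMod 𝒜) (w : ℤ) (y : (locObj g M).X w) :
    ∃ k : ℕ, ∀ (j : ℤ) (h : k * d + w = j), ∃ x : M.X j,
      ev ((toLoc g).app M) j x = (locObj g M).act h (hpow g k) y := by
  obtain ⟨k, y, rfl⟩ := exists_frac g M w y
  refine ⟨k, fun j h => ?_⟩
  obtain rfl : w + k * d = j := by omega
  refine ⟨y, ?_⟩
  rw [ev_toLoc, frac_act, ← frac_step g M _ (Nat.zero_le k)]
  congr 1
  exact M.act_act _ _ _ _ _ _ (by simp) y

lemma isZero_loc_iff (M : GrMod 𝒜) : IsZero (locObj g M) ↔ PowTorsion g M := by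
  rw [isZero_iff]
  constructor
  · intro h w x
    exact (toLoc_eq_zero_iff g M w x).1 (h w _)
  · intro h w x
    obtain ⟨k, x, rfl⟩ := exists_frac g M w x
    exact (frac_zero_iff g M w k x).2 (h _ x)

lemma isIso_toLoc {g : 𝒜 d} (h : MulBij g M) : IsIso ((toLoc g).app M) := by
  refine isIso_of_bijective _ fun w => ⟨?_, ?_⟩
  · rw [injective_iff_map_eq_zero]
    intro x hx
    obtain ⟨k, hk⟩ := (toLoc_eq_zero_iff g M w x).1 hx
    exact (injective_iff_map_eq_zero _).1 (h.hpow k w _ rfl).1 x (hk _ rfl)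
  · intro y
    obtain ⟨k, y, rfl⟩ := exists_frac g M w y
    obtain ⟨x, rfl⟩ := (h.hpow k w (w + k * d) (by omega)).2 y
    refine ⟨x, ?_⟩
    rw [ev_toLoc, ← frac_step g M _ (Nat.zero_le k)]
    congr 1
    exact M.act_act _ _ _ _ _ _ (by simp) x

/-- Division by `g` takes y / g^k to y / g^(k+1). If g y / g^k vanishes, then a power of `g` kills g
y, and one more factor kills y. -/
lemma mulBij_loc (M : GrMod 𝒜) : MulBij g (locObj g M) := by
  intro i j hj
  constructor
  · rw [injective_iff_map_eq_zero]
    intro y hy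
    obtain ⟨k, y, rfl⟩ := exists_frac g M i y
    rw [frac_act, frac_zero_iff] at hy
    obtain ⟨m, hm⟩ := hy
    refine (frac_zero_iff g M i k y).2 ⟨m + 1, fun l hl => ?_⟩
    rw [← hm l (by rw [← hl, ← hj]; push_cast; ring)]
    exact (M.act_act _ _ _ _ _ _ (by simp [pow_succ]) y).symm
  · intro y
    obtain ⟨k, y, rfl⟩ := exists_frac g M j y
    refine ⟨frac g M i (k + 1) (M.act (show 0 + (j + k * d) = i + (k + 1 : ℕ) * d by
      rw [← hj]; push_cast; ring) ⟨1, SetLike.GradedOne.one_mem⟩ y), ?_⟩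
    rw [frac_act, ← frac_step g M j (Nat.le_succ k)]
    congr 1
    exact M.act_act _ _ _ _ _ _ (by simp) y

lemma MulBij.loc {e : ℤ} {g : 𝒜 d} (h : 𝒜 e) (hM : MulBij g M) : MulBij g (locObj h M) := by
  intro i j hj
  constructor
  · rw [injective_iff_map_eq_zero]
    intro y hy
    obtain ⟨k, y, rfl⟩ := exists_frac h M i y
    rw [frac_act, frac_zero_iff] at hy
    obtain ⟨m, hm⟩ := hy
    refine (frac_zero_iff h M i k y).2 ⟨m, fun l hl => ?_⟩
    refine (injective_iff_map_eq_zero _).1 (hM l _ rfl).1 _ ?_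
    rw [← hm (d + l) (by omega)]
    exact act_comm _ _ _ _ _ _ _ _
  · intro y
    obtain ⟨k, y, rfl⟩ := exists_frac h M j y
    obtain ⟨x, rfl⟩ := (hM (i + k * e) (j + k * e) (by omega)).2 y
    exact ⟨frac h M i k x, frac_act _ _ _ _ _ _⟩

lemma PowTorsion.loc {e : ℤ} {g : 𝒜 d} (h : 𝒜 e) (hM : PowTorsion g M) :
    PowTorsion g (locObj h M) := by
  intro w y
  obtain ⟨k, y, rfl⟩ := exists_frac h M w y
  obtain ⟨m, hm⟩ := hM _ y
  refine ⟨m, fun j hj => ?_⟩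
  rw [frac_act, hm, map_zero]

lemma PowTorsion.of_mul {d' e : ℤ} {g : 𝒜 d} {g' : 𝒜 d'} (h : 𝒜 e) (hg : (g' : A) = h * g)
    (hd : e + d = d') (hM : PowTorsion g M) : PowTorsion g' M := by
  intro w x
  obtain ⟨k, hk⟩ := hM w x
  refine ⟨k, fun j hj => ?_⟩
  rw [← M.act_act (show k * d + w = k * d + w from rfl)
    (show k * e + (k * d + w) = j by rw [← hj, ← hd]; ring) hj (GrMod.hpow h k) (GrMod.hpow g k)
    (GrMod.hpow g' k) (by simp [hg, mul_pow]), hk, map_zero]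

/-- Multiplication by g' factors both as g followed by h and as h followed by g. The first shows
that g is injective and h surjective, the second that h is injective and g surjective. -/
lemma MulBij.mul_iff {d' e : ℤ} {g : 𝒜 d} {g' : 𝒜 d'} {h : 𝒜 e} (hg : (g' : A) = h * g)
    (hd : e + d = d') : MulBij g' M ↔ MulBij g M ∧ MulBij h M := by
  have c1 : ∀ (i j : ℤ) (hj : d' + i = j), ⇑(M.act hj g') =
      M.act (show e + (d + i) = j by omega) h ∘ M.act rfl g := fun i j hj =>
    funext fun x => (M.act_act _ _ _ _ _ _ hg x).symm
  have c2 : ∀ (i j : ℤ) (hj : d' + i = j), ⇑(M.act hj g') =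
      M.act (show d + (e + i) = j by omega) g ∘ M.act rfl h := fun i j hj =>
    funext fun x => (M.act_act _ _ _ _ _ _ (hg.trans (mul_comm _ _)) x).symm
  constructor
  · refine fun H => ⟨fun i j hj => ⟨?_, ?_⟩, fun i j hj => ⟨?_, ?_⟩⟩
    · subst hj
      exact Function.Injective.of_comp (c1 i _ rfl ▸ (H i _ rfl).1)
    -- Every weight is of the form e + i', so multiplication by `g` from any weight is the second
    -- factor of such a composite.
    · obtain ⟨i, rfl⟩ : ∃ i', i = e + i' := ⟨i - e, by omega⟩
      exact Function.Surjective.of_comp (c2 i j (by omega) ▸ (H i j (by omega)).2)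
    · subst hj
      exact Function.Injective.of_comp (c2 i _ rfl ▸ (H i _ rfl).1)
    · obtain ⟨i, rfl⟩ : ∃ i', i = d + i' := ⟨i - d, by omega⟩
      exact Function.Surjective.of_comp (c1 i j (by omega) ▸ (H i j (by omega)).2)
  · rintro ⟨H1, H2⟩ i j hj
    rw [c1 i j hj]
    exact (H2 _ _ _).comp (H1 _ _ _)

end
end GrMod
end

/-! ### Localization on the derived category and its decomposition -/

noncomputable section
namespace GrMod
open Pretriangulated DerivedCategory
variable {A : Type u} [CommRing A] {𝒜 : ℤ → AddSubgroup A} [GradedRing 𝒜]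
variable [HasDerivedCategory.{w} (GrMod 𝒜)]

section
variable (F : GrMod 𝒜 ⥤ GrMod 𝒜) [F.Additive] [F.PreservesHomology]
  (G : GrMod 𝒜 ⥤ GrMod 𝒜) [G.Additive] [G.PreservesHomology]

/-- An exact functor commutes with the homology of complexes, computed in the derived category. -/
def homologyMapIso (K : CochainComplex (GrMod 𝒜) ℤ) (n : ℤ) :
    (homologyFunctor (GrMod 𝒜) n).obj (Q.obj
      ((F.mapHomologicalComplex (ComplexShape.up ℤ)).obj K)) ≅
      F.obj ((homologyFunctor (GrMod 𝒜) n).obj (Q.obj K)) :=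
  (homologyFunctorFactors (GrMod 𝒜) n).app _ ≪≫ (K.sc n).mapHomologyIso F ≪≫
    F.mapIso ((homologyFunctorFactors (GrMod 𝒜) n).app K).symm

variable {F G}

/-- A transformation of exact functors applied degreewise to a complex acts on cohomology as the
same transformation. This computes the localization map, and later the difference map and the zeroth
projection of towers, on cohomology. -/
lemma homologyMapIso_naturality (τ : F ⟶ G) (K : CochainComplex (GrMod 𝒜) ℤ) (n : ℤ) :
    (homologyFunctor (GrMod 𝒜) n).map (Q.map
      ((NatTrans.mapHomologicalComplex τ (ComplexShape.up ℤ)).app K)) ≫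
        (homologyMapIso G K n).hom =
      (homologyMapIso F K n).hom ≫ τ.app _ := by
  have h1 := homologyFunctorFactors_hom_naturality
    ((NatTrans.mapHomologicalComplex τ (ComplexShape.up ℤ)).app K) n
  have h2 := ShortComplex.homologyMap_mapNatTrans (K.sc n) τ
  have h3 := τ.naturality ((homologyFunctorFactors (GrMod 𝒜) n).inv.app K)
  refine (Category.assoc _ _ _).symm.trans ((congrArg (· ≫ _) h1).trans ?_)
  refine (Category.assoc _ _ _).trans ((congrArg _ ?_).trans (Category.assoc _ _ _).symm)
  refine (congrArg (· ≫ _) h2).trans ?_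
  refine Eq.trans ?_ ((congrArg _ h3.symm).trans (Category.assoc _ _ _).symm)
  change (_ ≫ τ.app _ ≫ _) ≫ _ ≫ _ = _
  simp only [Category.assoc, Iso.inv_hom_id_assoc]
  rfl

end

/-- The arrows given by a natural transformation at isomorphic objects are isomorphic. -/
def arrowIsoOfIso {C D : Type*} [Category* C] [Category* D] {F G : C ⥤ D} (α : F ⟶ G)
    {X Y : C} (e : X ≅ Y) : Arrow.mk (α.app X) ≅ Arrow.mk (α.app Y) :=
  Arrow.isoMk (F.mapIso e) (G.mapIso e) (α.naturality e.hom)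

section
variable {X Y Z : DerivedCategory (GrMod 𝒜)} {a : X ⟶ Y} {b : Y ⟶ Z} {c : Z ⟶ X⟦(1 : ℤ)⟧}
  (hT : Triangle.mk a b c ∈ distTriang _)
include hT

lemma homology_exact₂ (n w : ℤ) (x) :
    ev ((homologyFunctor (GrMod 𝒜) n).map b) w x = 0 ↔
      ∃ y, ev ((homologyFunctor (GrMod 𝒜) n).map a) w y = x := by
  have h := HomologySequence.exact₂ _ hT n
  refine ⟨(exact_iff _).1 h w x, ?_⟩
  rintro ⟨y, rfl⟩
  have h0 : a ≫ b = 0 := comp_distTriang_mor_zero₁₂ _ hT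
  rw [← ev_comp, ← Functor.map_comp, h0, Functor.map_zero, ev_zero]

/-- The connecting map is returned only through its kernel and its image, in terms of elements,
which is what the diagram chases use. -/
lemma exists_homology_connecting (n₀ n₁ : ℤ) (hn : n₀ + 1 = n₁) :
    ∃ δ : (homologyFunctor (GrMod 𝒜) n₀).obj Z ⟶ (homologyFunctor (GrMod 𝒜) n₁).obj X,
      (∀ w y, ev δ w y = 0 ↔ ∃ x, ev ((homologyFunctor (GrMod 𝒜) n₀).map b) w x = y) ∧
      (∀ w x, ev ((homologyFunctor (GrMod 𝒜) n₁).map a) w x = 0 ↔ ∃ y, ev δ w y = x) := by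
  refine ⟨HomologySequence.δ (Triangle.mk a b c) n₀ n₁ hn, fun w y => ⟨(exact_iff _).1
    (HomologySequence.exact₃ _ hT n₀ n₁ hn) w y, ?_⟩, fun w x => ⟨(exact_iff _).1
    (HomologySequence.exact₁ _ hT n₀ n₁ hn) w x, ?_⟩⟩
  · rintro ⟨y, rfl⟩
    exact congrArg (fun q => ev q w y) (HomologySequence.comp_δ _ hT n₀ n₁ hn)
  · rintro ⟨y, rfl⟩
    exact congrArg (fun q => ev q w y) (HomologySequence.δ_comp _ hT n₀ n₁ hn)

end

/-- If all cohomology vanishes, the zero endomorphism induces isomorphisms on cohomology, hence is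
an isomorphism. -/
lemma isZero_iff_homology (M : DerivedCategory (GrMod 𝒜)) :
    IsZero M ↔ ∀ n, IsZero ((homologyFunctor (GrMod 𝒜) n).obj M) := by
  constructor
  · exact fun h n => Functor.map_isZero _ h
  · intro h
    have : IsIso (0 : M ⟶ M) := by
      rw [DerivedCategory.isIso_iff]
      intro n
      rw [Functor.map_zero, (h n).eq_of_src 0 (𝟙 _)]
      infer_instance
    exact (IsZero.iff_id_eq_zero M).2 (by rw [← cancel_epi (0 : M ⟶ M), zero_comp, zero_comp])

section
variable {d : ℤ} (g : 𝒜 d)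

instance : (loc g).PreservesHomology := (loc g).preservesHomology_of_map_exact (loc_exact g)

instance : (tow (𝒜 := 𝒜) d).PreservesHomology :=
  (tow d).preservesHomology_of_map_exact (tow_exact d)

/-- Localization at `g` on the derived category. -/
def locD : DerivedCategory (GrMod 𝒜) ⥤ DerivedCategory (GrMod 𝒜) :=
  descend (locC g) (locC_preserves g)

/-- The localization map on the derived category. -/
def locη : 𝟭 (DerivedCategory (GrMod 𝒜)) ⟶ locD g :=
  descendUnit (locC_preserves g) (toLocC g)

/-- The fibre of the localization map. -/
def gammaD : DerivedCategory (GrMod 𝒜) ⥤ DerivedCategory (GrMod 𝒜) :=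
  descend (coconeFunctor (toLocC g)) (PreservesQuasiIso.cocone _ id_preserves (locC_preserves g))

/-- The canonical map from the fibre of the localization map. -/
def gammaε : gammaD g ⟶ 𝟭 (DerivedCategory (GrMod 𝒜)) :=
  descendCounit (PreservesQuasiIso.cocone _ id_preserves (locC_preserves g))
    (coconeFst (toLocC g))

/-- Localization is exact, so it commutes with cohomology; as a statement about arrows, this also
identifies the map and not only its target. -/
lemma nonempty_arrow_locη (M : DerivedCategory (GrMod 𝒜)) (n : ℤ) :
    Nonempty (Arrow.mk ((homologyFunctor (GrMod 𝒜) n).map ((locη g).app M)) ≅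
      Arrow.mk ((toLoc g).app ((homologyFunctor (GrMod 𝒜) n).obj M))) := by
  obtain ⟨K, ⟨e⟩⟩ := exists_Q_iso M
  have e1 := (homologyFunctor (GrMod 𝒜) n).mapArrow.mapIso (arrowIsoOfIso (locη g) e)
  have e2 := arrowIsoOfIso (toLoc g) ((homologyFunctor (GrMod 𝒜) n).mapIso e)
  refine ⟨e1.symm ≪≫ ?_ ≪≫ e2⟩
  -- `toLocC` starts with the identification of the identity with its own degreewise extension, and
  -- this isomorphism of the source accounts for it.
  let θ : (homologyFunctor (GrMod 𝒜) n).obj (Q.obj K) ≅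
      (homologyFunctor (GrMod 𝒜) n).obj (Q.obj K) :=
    (homologyFunctor (GrMod 𝒜) n).mapIso (Q.mapIso
      ((Functor.mapHomologicalComplexIdIso (GrMod 𝒜) (ComplexShape.up ℤ)).app K)).symm ≪≫
      homologyMapIso (𝟭 _) K n
  refine Arrow.isoMk θ ((homologyFunctor (GrMod 𝒜) n).mapIso
    ((descendIso (locC_preserves g)).app K) ≪≫ homologyMapIso (loc g) K n) ?_
  have h2 := descendUnit_comp_hom (locC_preserves g) (toLocC g) K
  have h3 := homologyMapIso_naturality (toLoc g) K n
  change ((homologyFunctor (GrMod 𝒜) n).map (Q.map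
    ((Functor.mapHomologicalComplexIdIso (GrMod 𝒜) (ComplexShape.up ℤ)).inv.app K)) ≫
      (homologyMapIso (𝟭 _) K n).hom) ≫ (toLoc g).app _ =
    (homologyFunctor (GrMod 𝒜) n).map ((locη g).app (Q.obj K)) ≫
      (homologyFunctor (GrMod 𝒜) n).map ((descendIso (locC_preserves g)).hom.app K) ≫
        (homologyMapIso (loc g) K n).hom
  have h4 : (homologyFunctor (GrMod 𝒜) n).map ((locη g).app (Q.obj K)) ≫
      (homologyFunctor (GrMod 𝒜) n).map ((descendIso (locC_preserves g)).hom.app K) ≫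
        (homologyMapIso (loc g) K n).hom =
      (homologyFunctor (GrMod 𝒜) n).map (Q.map ((toLocC g).app K)) ≫
        (homologyMapIso (loc g) K n).hom :=
    (Category.assoc _ _ _).symm.trans (congrArg (· ≫ (homologyMapIso (loc g) K n).hom)
      (((homologyFunctor (GrMod 𝒜) n).map_comp _ _).symm.trans
        (congrArg (homologyFunctor (GrMod 𝒜) n).map h2)))
  rw [h4, Category.assoc, ← h3, ← Category.assoc, ← Functor.map_comp, ← Functor.map_comp]
  rfl

/-- A morphism whose kernel and cokernel are `g`-power torsion. -/
structure IsLocMap {M N : GrMod 𝒜} (φ : M ⟶ N) : Prop where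
  ker : ∀ w x, ev φ w x = 0 → ∃ k : ℕ, ∀ (j : ℤ) (h : k * d + w = j), M.act h (hpow g k) x = 0
  coker : ∀ w y, ∃ k : ℕ, ∀ (j : ℤ) (h : k * d + w = j), ∃ x, ev φ j x = N.act h (hpow g k) y

omit [HasDerivedCategory (GrMod 𝒜)] in
lemma isLocMap_toLoc (M : GrMod 𝒜) : IsLocMap g ((toLoc g).app M) :=
  ⟨fun w x => (toLoc_eq_zero_iff g M w x).1, exists_toLoc_eq g M⟩

variable {g} in
omit [HasDerivedCategory (GrMod 𝒜)] in
lemma IsLocMap.of_iso {M N M' N' : GrMod 𝒜} {φ : M ⟶ N} {ψ : M' ⟶ N'}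
    (h : IsLocMap g φ) (e₁ : M ≅ M') (e₂ : N ≅ N') (comm : φ ≫ e₂.hom = e₁.hom ≫ ψ) :
    IsLocMap g ψ := by
  have h2 : ∀ w x, ev e₂.hom w (ev φ w x) = ev ψ w (ev e₁.hom w x) := fun w x =>
    congrArg (fun q => ev q w x) comm
  have h1 : ∀ w x, ev e₂.inv w (ev ψ w x) = ev φ w (ev e₁.inv w x) := fun w x => by
    rw [← ev_hom_inv e₂ w (ev φ w _), h2, ev_inv_hom]
  constructor
  · intro w x hx
    obtain ⟨k, hk⟩ := h.ker w (ev e₁.inv w x) (by rw [← h1, hx, map_zero])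
    refine ⟨k, fun j hj => ?_⟩
    rw [← ev_inv_hom e₁ w x, ← ev_act, hk, map_zero]
  · intro w y
    obtain ⟨k, hk⟩ := h.coker w (ev e₂.inv w y)
    refine ⟨k, fun j hj => ?_⟩
    obtain ⟨x, hx⟩ := hk j hj
    exact ⟨ev e₁.hom j x, by rw [← h2, hx, ev_act, ev_inv_hom]⟩

lemma isLocMap_homology (M : DerivedCategory (GrMod 𝒜)) (n : ℤ) :
    IsLocMap g ((homologyFunctor (GrMod 𝒜) n).map ((locη g).app M)) :=
  (isLocMap_toLoc g _).of_iso
    (Arrow.leftFunc.mapIso (nonempty_arrow_locη g M n).some.symm)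
    (Arrow.rightFunc.mapIso (nonempty_arrow_locη g M n).some.symm)
    (nonempty_arrow_locη g M n).some.inv.w.symm

/-- The homology of the localization. -/
lemma nonempty_homology_locD (M : DerivedCategory (GrMod 𝒜)) (n : ℤ) :
    Nonempty ((homologyFunctor (GrMod 𝒜) n).obj ((locD g).obj M) ≅
      locObj g ((homologyFunctor (GrMod 𝒜) n).obj M)) :=
  ⟨Arrow.rightFunc.mapIso (nonempty_arrow_locη g M n).some⟩

/-- On cohomology the map is H → H_g, an isomorphism exactly when `g` acts bijectively on H. -/
lemma isIso_locη_iff (M : DerivedCategory (GrMod 𝒜)) :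
    IsIso ((locη g).app M) ↔ ∀ n, MulBij g ((homologyFunctor (GrMod 𝒜) n).obj M) := by
  rw [DerivedCategory.isIso_iff]
  refine forall_congr' fun n => ?_
  obtain ⟨e⟩ := nonempty_arrow_locη g M n
  have h := (MorphismProperty.isomorphisms (GrMod 𝒜)).arrow_iso_iff e
  refine h.trans ⟨fun (hi : IsIso ((toLoc g).app _)) => ?_, fun hi => isIso_toLoc hi⟩
  exact (mulBij_loc g _).of_iso (asIso ((toLoc g).app _)).symm

variable (𝒜) in
/-- The complexes whose cohomology is `g`-power torsion. -/
def PTor : ObjectProperty (DerivedCategory (GrMod 𝒜)) :=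
  fun M => ∀ n, PowTorsion g ((homologyFunctor (GrMod 𝒜) n).obj M)

lemma isZero_locD_iff (M : DerivedCategory (GrMod 𝒜)) : IsZero ((locD g).obj M) ↔ PTor 𝒜 g M := by
  rw [isZero_iff_homology]
  refine forall_congr' fun n => ?_
  rw [← isZero_loc_iff]
  exact (nonempty_homology_locD g M n).some.isZero_iff

instance : (PTor 𝒜 g).IsClosedUnderIsomorphisms where
  of_iso e h n := (h n).of_iso ((homologyFunctor (GrMod 𝒜) n).mapIso e)

instance : (PTor 𝒜 g).IsStableUnderShift ℤ where
  isStableUnderShiftBy a := ⟨fun M h n =>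
    (h (a + n)).of_iso ((((homologyFunctor (GrMod 𝒜) 0).shiftIso a n (a + n) rfl).app M).symm)⟩

/-- The cohomology of the fibre is an extension of the kernel of a localization map by a quotient of
the target of another one by its image; both are g-power torsion. For orthogonality, M_g → (M_g)_g
is an isomorphism, and by naturality the composite of a map N → M_g with it factors through N_g,
which vanishes for torsion N. -/
lemma isDecomposition_loc :
    (PTor 𝒜 g).IsDecomposition (gammaD g) (locD g) (gammaε g) (locη g) where
  left M n w x := by
    obtain ⟨γ, hT⟩ : ∃ γ, Triangle.mk ((gammaε g).app M) ((locη g).app M) γ ∈ distTriang _ :=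
      coconeFunctor_triangle (locC_preserves g)
        (PreservesQuasiIso.cocone (toLocC g) id_preserves (locC_preserves g)) M
    obtain ⟨δ, h1, h2⟩ := exists_homology_connecting hT (n - 1) n (by omega)
    have h3 := homology_exact₂ hT n
    -- Some g^k kills the image of x in the cohomology of M, so g^k x is the image of some y under
    -- the connecting map. A further g^m moves y into the image of the cohomology of M, where the
    -- connecting map vanishes.
    obtain ⟨k, hk⟩ := (isLocMap_homology g M n).ker w
      (ev ((homologyFunctor (GrMod 𝒜) n).map ((gammaε g).app M)) w x) ((h3 w (ev ((homologyFunctor (GrMod 𝒜) n).map ((gammaε g).app M)) w x)).2 ⟨x, rfl⟩)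
    obtain ⟨y, hy⟩ := (h2 (k * d + w) (GrMod.act _ rfl (hpow g k) x)).1
      ((ev_act ((homologyFunctor (GrMod 𝒜) n).map ((gammaε g).app M)) rfl (hpow g k) x).trans
        (hk _ rfl))
    obtain ⟨m, hm⟩ := (isLocMap_homology g M (n - 1)).coker _ y
    refine ⟨m + k, fun j hj => ?_⟩
    rw [← hpow_act g _ m k rfl (by push_cast at hj; linarith) x, ← hy, ← ev_act]
    exact (h1 _ _).2 (hm _ _)
  right M N φ hN := by
    have h1 : IsIso ((locη g).app ((locD g).obj M)) :=
      (isIso_locη_iff g _).2 fun n => (mulBij_loc g _).of_iso (nonempty_homology_locD g M n).some.symm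
    rw [← cancel_mono ((locη g).app ((locD g).obj M)), zero_comp]
    refine ((locη g).naturality φ).trans ?_
    rw [((isZero_locD_iff g N).2 hN).eq_of_src ((locD g).map φ) 0, comp_zero]
  triangle M := coconeFunctor_triangle (locC_preserves g)
    (PreservesQuasiIso.cocone _ id_preserves (locC_preserves g)) M

/-- The complexes on whose cohomology `g` acts bijectively are orthogonal to the torsion ones. -/
lemma inv_iff (M : DerivedCategory (GrMod 𝒜)) :
    (PTor 𝒜 g).rightOrthogonal M ↔ ∀ n, MulBij g ((homologyFunctor (GrMod 𝒜) n).obj M) := by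
  rw [(isDecomposition_loc g).mem_right_iff, ← (isDecomposition_loc g).isIso_unit_iff,
    isIso_locη_iff]

end
end GrMod
end

/-! ### Idempotent copointed functors -/

noncomputable section

namespace CategoryTheory.ObjectProperty
open Pretriangulated
variable {C : Type u} [Category.{v} C] [HasZeroObject C] [HasShift C ℤ] [Preadditive C]
  [∀ n : ℤ, (shiftFunctor C n).Additive] [Pretriangulated C] (P : ObjectProperty C)

/-- An idempotent copointed functor with values in `P` gives a semi-orthogonal decomposition. -/
lemma isDecomposition_of_idempotent [P.IsTriangulated] {Γ L : C ⥤ C} {ε : Γ ⟶ 𝟭 C}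
    {η : 𝟭 C ⟶ L} (hΓ : ∀ M, P (Γ.obj M)) (h₁ : ∀ M, P M → IsIso (ε.app M))
    (h₂ : ∀ M, IsIso (Γ.map (ε.app M))) (h₃ : ∀ M, ∃ δ : L.obj M ⟶ (Γ.obj M)⟦(1 : ℤ)⟧,
      Triangle.mk (ε.app M) (η.app M) δ ∈ distTriang C) : P.IsDecomposition Γ L ε η := by
  have hb : ∀ (N M : C), P N → Function.Bijective (fun φ : N ⟶ Γ.obj M => φ ≫ ε.app M) := by
    intro N M hN
    have := h₁ N hN
    -- For N in `P` the counit is invertible at N, so by naturality a map out of N is recovered from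
    -- its image under Γ, and Γ makes the counit at M invertible.
    refine ⟨fun φ ψ hφ => ?_, fun φ => ⟨inv (ε.app N) ≫ Γ.map φ, ?_⟩⟩
    · have e : Γ.map φ = Γ.map ψ := by
        rw [← cancel_mono (Γ.map (ε.app M)), ← Functor.map_comp, ← Functor.map_comp]
        exact congrArg Γ.map hφ
      rw [← cancel_epi (ε.app N)]
      exact (ε.naturality φ).symm.trans ((congrArg (· ≫ _) e).trans (ε.naturality ψ))
    · change (inv (ε.app N) ≫ Γ.map φ) ≫ ε.app M = φ
      rw [Category.assoc]
      exact (congrArg _ (ε.naturality φ)).trans (IsIso.inv_hom_id_assoc _ _)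
  obtain ⟨adj, -⟩ := P.exists_adjunction_of_counit Γ hΓ ε hb
  obtain ⟨_, _⟩ := P.exists_isTriangulated_of_counit Γ hΓ adj
  refine ⟨hΓ, fun M N φ hN => ?_, h₃⟩
  obtain ⟨δ, hδ⟩ := h₃ M
  -- Γ is now known to be triangulated, so inverting the counit at M means killing its cone L M. A
  -- map from an object of `P` to L M factors through Γ (L M), hence vanishes.
  have h0 : IsZero (Γ.obj (L.obj M)) :=
    (Triangle.isZero₃_iff_isIso₁ _ (Γ.map_distinguished _ hδ)).2 (h₂ M)
  have := h₁ N hN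
  rw [← cancel_epi (ε.app N), comp_zero]
  refine (ε.naturality φ).symm.trans ?_
  rw [h0.eq_of_tgt (Γ.map φ) 0, zero_comp]

end CategoryTheory.ObjectProperty

/-! ### Differentials and components of mapping cocones -/

namespace GrMod
open CochainComplex CochainComplex.HomComplex
section
variable {C : Type u} [Category.{v} C] [Preadditive C] [HasBinaryBiproducts C]
  {K L : CochainComplex C ℤ} (φ : K ⟶ L)

lemma cocone_hom_ext {M : C} {p q : ℤ} (hpq : p + -1 = q) {a b : M ⟶ (mappingCocone φ).X p}
    (h₁ : a ≫ (mappingCocone.fst φ).f p = b ≫ (mappingCocone.fst φ).f p)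
    (h₂ : a ≫ (mappingCocone.snd φ).v p q hpq = b ≫ (mappingCocone.snd φ).v p q hpq) :
    a = b := by
  rw [← Category.comp_id a, ← Category.comp_id b, ← mappingCocone.id_X φ p q hpq,
    Preadditive.comp_add, Preadditive.comp_add, reassoc_of% h₁, reassoc_of% h₂]

/-- In this form the general formula for the coboundary of a `descCochain` applies to the second
projection, and it yields the differential of the cocone in components. -/
lemma cocone_snd_eq : mappingCocone.snd φ =
    mappingCocone.descCochain φ 0 (Cochain.ofHom (𝟙 L)) (by omega : (-1 : ℤ) + 1 = 0) := by
  ext p q hpq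
  rw [← Category.id_comp ((mappingCocone.snd φ).v p q hpq), ← mappingCocone.id_X φ p q hpq,
    Preadditive.add_comp, Category.assoc, Category.assoc, mappingCocone.inl_v_snd_v,
    mappingCocone.inr_v_snd_v]
  conv_rhs => rw [← Category.id_comp ((mappingCocone.descCochain φ _ _ _).v p q hpq),
    ← mappingCocone.id_X φ p q hpq, Preadditive.add_comp, Category.assoc, Category.assoc,
    mappingCocone.inl_v_descCochain_v, mappingCocone.inr_v_descCochain_v]
  simp

lemma cocone_d_snd_v (p q r : ℤ) (hpq : p + -1 = q) (hpr : r + -1 = p) :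
    (mappingCocone φ).d p r ≫ (mappingCocone.snd φ).v r p hpr =
      -((mappingCocone.fst φ).f p ≫ φ.f p) - (mappingCocone.snd φ).v p q hpq ≫ L.d q p := by
  have h := mappingCocone.δ_descCochain φ 0 (Cochain.ofHom (𝟙 L))
    (by omega : (-1 : ℤ) + 1 = 0) 1 rfl
  rw [← cocone_snd_eq] at h
  have h' := congrArg (fun z : Cochain (mappingCocone φ) L 0 => z.v p p (add_zero p)) h
  simp only [δ_ofHom, Cochain.comp_zero, δ_zero, zero_add, add_zero] at h'
  rw [δ_v (-1) 0 (by omega) _ p p _ q r (by omega) (by omega)] at h'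
  simp only [Int.negOnePow_zero, one_smul, Cochain.zero_cochain_comp_v, Cochain.ofHom_v,
    Cochain.units_smul_v, HomologicalComplex.id_f,
    Category.comp_id, Int.negOnePow_neg, Int.negOnePow_one] at h'
  have h2 : (mappingCocone.fst φ).f p ≫ ((-1 : ℤˣ) • φ.f p) =
      -((mappingCocone.fst φ).f p ≫ φ.f p) := by
    simp [Units.smul_def]
  rw [← h2, ← h']
  abel

/-- A morphism into the cocone is determined by its two projections, so the formula is read off from
the differentials of the projections. -/
lemma cocone_inl_d (p r : ℤ) (hpr : p + 1 = r) :
    (mappingCocone.inl φ).v p p (add_zero p) ≫ (mappingCocone φ).d p r =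
      K.d p r ≫ (mappingCocone.inl φ).v r r (add_zero r) -
        φ.f p ≫ (mappingCocone.inr φ).1.v p r hpr := by
  refine cocone_hom_ext φ (show r + -1 = p by omega) ?_ ?_
  · rw [Category.assoc, ← (mappingCocone.fst φ).comm, mappingCocone.inl_v_fst_f_assoc,
      Preadditive.sub_comp, Category.assoc, Category.assoc, mappingCocone.inl_v_fst_f,
      mappingCocone.inr_v_fst_f]
    simp
  · rw [Category.assoc, cocone_d_snd_v φ p (p - 1) r (by omega) (by omega),
      Preadditive.comp_sub, Preadditive.comp_neg, mappingCocone.inl_v_fst_f_assoc,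
      mappingCocone.inl_v_snd_v_assoc, Preadditive.sub_comp, Category.assoc, Category.assoc,
      mappingCocone.inl_v_snd_v, mappingCocone.inr_v_snd_v]
    simp

lemma cocone_inr_d (q p r : ℤ) (hqp : q + 1 = p) (hpr : p + 1 = r) :
    (mappingCocone.inr φ).1.v q p hqp ≫ (mappingCocone φ).d p r =
      -(L.d q p ≫ (mappingCocone.inr φ).1.v p r hpr) := by
  refine cocone_hom_ext φ (show r + -1 = p by omega) ?_ ?_
  · rw [Category.assoc, ← (mappingCocone.fst φ).comm, Preadditive.neg_comp, Category.assoc,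
      mappingCocone.inr_v_fst_f, ← Category.assoc, mappingCocone.inr_v_fst_f]
    simp
  · rw [Category.assoc, cocone_d_snd_v φ p q r (by omega) (by omega),
      Preadditive.comp_sub, Preadditive.comp_neg, ← Category.assoc, mappingCocone.inr_v_fst_f,
      ← Category.assoc, mappingCocone.inr_v_snd_v, Preadditive.neg_comp, Category.assoc,
      mappingCocone.inr_v_snd_v]
    simp

lemma cocone_snd_v (p q : ℤ) (hpq : p + -1 = q) :
    (mappingCocone.snd φ).v p q hpq =
      (mappingCone.snd φ).v (p + -1) q (by omega) := by
  refine (Cochain.leftShift_v (mappingCone.snd φ) (-1) (-1) (zero_add _) p q hpq (p + -1)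
    (by omega)).trans ?_
  simp [Int.negOnePow_even 2 even_two]
  exact Category.id_comp ((mappingCone.snd φ).v (p + -1) q (by omega))

lemma cocMap_snd {K' L' : CochainComplex C ℤ} (φ' : K' ⟶ L') (a : K ⟶ K') (b : L ⟶ L')
    (comm : φ ≫ b = a ≫ φ') (p q : ℤ) (hpq : p + -1 = q) :
    (cocMap φ φ' a b comm).f p ≫ (mappingCocone.snd φ').v p q hpq =
      (mappingCocone.snd φ).v p q hpq ≫ b.f q := by
  subst hpq
  rw [cocone_snd_v, cocone_snd_v]
  have h : (mappingCone.map φ φ' a b comm).f (p + -1) ≫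
      (mappingCone.snd φ').v (p + -1) (p + -1) (by omega) =
        (mappingCone.snd φ).v (p + -1) (p + -1) (by omega) ≫ b.f (p + -1) := by
    simp [mappingCone.ext_from_iff _ (p + -1 + 1) (p + -1) (by omega), mappingCone.map]
  exact h

end
end GrMod
end

/-! ### Towers of multiplications by a homogeneous element -/

noncomputable section
namespace GrMod
section
variable {A : Type u} [CommRing A] {𝒜 : ℤ → AddSubgroup A} [GradedRing 𝒜] {d : ℤ} (g : 𝒜 d)
  (M : GrMod 𝒜)

/-- Transport of elements along an equality of degrees. -/
def cst {i j : ℤ} (h : i = j) : M.X i →+ M.X j :=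
  M.act (by rw [h, zero_add]) ⟨1, SetLike.GradedOne.one_mem⟩

@[simp] lemma cst_rfl {i : ℤ} (h : i = i) (x : M.X i) : M.cst h x = x := M.act_one _ _ rfl x

@[simp] lemma cst_cst {i j k : ℤ} (h : i = j) (h' : j = k) (x : M.X i) :
    M.cst h' (M.cst h x) = M.cst (h.trans h') x := by
  subst h h'; simp

@[simp] lemma act_cst {e i j k : ℤ} (a : 𝒜 e) (h : i = j) (h' : e + j = k) (x : M.X i) :
    M.act h' a (M.cst h x) = M.act (by rw [h, h']) a x := by
  subst h; simp

@[simp] lemma cst_act {e i j k : ℤ} (a : 𝒜 e) (h : e + i = j) (h' : j = k) (x : M.X i) :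
    M.cst h' (M.act h a x) = M.act (by rw [h, h']) a x := by
  subst h'; simp

lemma cst_congr {d w j : ℤ} (x : (towObj d M).X w) {a b : ℕ} (h : a = b) (ha : w - a * d = j)
    (hb : w - b * d = j) : M.cst ha (x a) = M.cst hb (x b) := by
  subst h; rfl

variable {M} in
lemma ev_cst {N : GrMod 𝒜} (φ : M ⟶ N) {i j : ℤ} (h : i = j) (x : M.X i) :
    ev φ j (M.cst h x) = N.cst h (ev φ i x) := ev_act φ _ _ x

/-- The shift of a tower. -/
def towShift {w w' : ℤ} (h : d + w = w') (x : (towObj d M).X w') : (towObj d M).X w :=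
  fun k => M.cst (show w' - (k + 1 : ℕ) * d = w - k * d by rw [← h]; push_cast; ring) (x (k + 1))

lemma towDiff_towShift {w w' : ℤ} (h : d + w = w') (x : (towObj d M).X w') :
    ev ((towDiff g).app M) w (M.towShift h x) =
      M.towShift h (ev ((towDiff g).app M) w' x) := by
  funext k
  change M.cst _ (x (k + 1)) - M.act _ g (M.cst _ (x (k + 1 + 1))) =
    M.cst _ (x (k + 1) - M.act _ g (x (k + 1 + 1)))
  rw [map_sub, act_cst, cst_act]

/-- Together with `towShift_act`: modulo the difference map, the shift of towers is inverse to
multiplication by `g`. Since the shift commutes with the difference map, `g` is bijective on the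
kernel and on the cokernel of the latter. -/
lemma act_towShift {w w' : ℤ} (h : d + w = w') (x : (towObj d M).X w') :
    (towObj d M).act h g (M.towShift h x) = x - ev ((towDiff g).app M) w' x := by
  funext k
  change M.act _ g (M.cst _ (x (k + 1))) = x k - (x k - M.act _ g (x (k + 1)))
  rw [act_cst, sub_sub_cancel]

lemma towShift_act {w w' : ℤ} (h : d + w = w') (x : (towObj d M).X w) :
    M.towShift h ((towObj d M).act h g x) = x - ev ((towDiff g).app M) w x := by
  funext k
  change M.cst _ (M.act _ g (x (k + 1))) = x k - (x k - M.act _ g (x (k + 1)))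
  rw [cst_act, sub_sub_cancel]

lemma towShift_zero {w w' : ℤ} (h : d + w = w') :
    M.towShift h (0 : (towObj d M).X w') = 0 := by
  funext k
  exact map_zero _

variable {g M} in
-- A tower with prescribed zeroth term and prescribed differences is found recursively: x_(k+1) is a
-- quotient of x_k - z_k by `g`.
lemma MulBij.exists_tower (hM : MulBij g M) (w : ℤ) (x : M.X w) (z : (towObj d M).X w) :
    ∃ u : (towObj d M).X w, ev ((towZero d).app M) w u = x ∧ ev ((towDiff g).app M) w u = z := by
  have h : ∀ (k : ℕ) (y : M.X (w - k * d)), ∃ y' : M.X (w - (k + 1 : ℕ) * d),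
      M.act (by push_cast; ring) g y' = y - z k := fun k y => (hM _ _ _).2 _
  choose s hs using h
  refine ⟨fun k => Nat.rec (M.cst (by simp) x) s k, ?_, ?_⟩
  · change M.cst (show w - (0 : ℕ) * d = w by simp) (M.cst _ x) = x
    rw [cst_cst, cst_rfl]
  · funext k
    exact (congrArg _ (hs k _)).trans (sub_sub_cancel _ _)

variable {g M} in
lemma MulBij.tower_eq_zero (hM : MulBij g M) (w : ℤ) (u : (towObj d M).X w)
    (h₀ : ev ((towZero d).app M) w u = 0) (h : ev ((towDiff g).app M) w u = 0) : u = 0 := by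
  funext k
  induction k with
  | zero =>
    have h₁ : M.cst (show w - (0 : ℕ) * d = w by simp) (u 0) = 0 := h₀
    have := congrArg (M.cst (show w = w - (0 : ℕ) * d by simp)) h₁
    rw [cst_cst, cst_rfl, map_zero] at this
    exact this
  | succ k ih =>
    have h1 : u k - M.act (show d + (w - (k + 1 : ℕ) * d) = w - k * d by push_cast; ring) g
      (u (k + 1)) = 0 := congrFun h k
    refine (hM _ _ (show d + (w - (k + 1 : ℕ) * d) = w - k * d by push_cast; ring)).1 ?_
    exact ((sub_eq_zero.1 h1).symm.trans ih).trans (map_zero _).symm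

/-- The map `x ↦ (x_{j+k})_{j,k}`. -/
def towDiag (d : ℤ) : tow (𝒜 := 𝒜) d ⟶ tow d ⋙ tow d where
  app M := mkHom (M := towObj d M) (N := towObj d (towObj d M))
    (fun w => AddMonoidHom.mk' (fun x j k => M.cst
        (show w - (j + k : ℕ) * d = w - j * d - k * d by push_cast; ring) (x (j + k)))
      (fun x y => by funext j k; exact map_add _ _ _))
    (fun h a x => by
      funext j k
      change M.cst _ (M.act _ a _) = M.act _ a (M.cst _ _)
      rw [cst_act, act_cst])
  naturality M N φ := by
    ext w x
    funext j k
    exact (ev_cst φ _ _).symm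

/-- Setting j = 0 or k = 0 in x_(j+k) gives back x. So the diagonal is a common section of the outer
projection here and of the inner one in `towDiag_map_towZero`. -/
lemma towDiag_towZero (d : ℤ) (M : GrMod 𝒜) :
    (towDiag d).app M ≫ (towZero d).app ((tow d).obj M) = 𝟙 _ := by
  ext w x
  funext k
  change M.cst (by push_cast; ring) (M.cst (by push_cast; ring) (x (0 + k))) = x k
  rw [cst_cst]
  exact (M.cst_congr x (zero_add k) _ rfl).trans (M.cst_rfl _ _)

lemma towDiag_map_towZero (d : ℤ) (M : GrMod 𝒜) :
    (towDiag d).app M ≫ (tow d).map ((towZero d).app M) = 𝟙 _ := by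
  ext w x
  funext k
  change M.cst (by push_cast; ring) (M.cst (by push_cast; ring) (x (k + 0))) = x k
  rw [cst_cst]
  exact M.cst_rfl _ _

/-- The index j + k grows by one whichever of j and k does. So the outer difference map here, and
the inner one in `towDiag_map_towDiff`, both restrict along the diagonal to the difference map of M.
-/
lemma towDiag_towDiff :
    (towDiag d).app M ≫ (towDiff g).app ((tow d).obj M) =
      (towDiff g).app M ≫ (towDiag d).app M := by
  ext w x
  funext j k
  have hw : ∀ m n : ℕ, w - (m + n : ℕ) * d = w - m * d - n * d := fun m n => by push_cast; ring
  change M.cst (hw j k) (x (j + k)) - M.act (by push_cast; ring) g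
      (M.cst (hw (j + 1) k) (x (j + 1 + k))) =
    M.cst (hw j k) (x (j + k) - M.act (by push_cast; ring) g (x (j + k + 1)))
  rw [map_sub, cst_act, M.cst_congr x (show j + 1 + k = j + k + 1 by omega) _
    (by push_cast; ring), act_cst]

lemma towDiag_map_towDiff :
    (towDiag d).app M ≫ (tow d).map ((towDiff g).app M) =
      (towDiff g).app M ≫ (towDiag d).app M := by
  ext w x
  funext j k
  have hw : ∀ m n : ℕ, w - (m + n : ℕ) * d = w - m * d - n * d := fun m n => by push_cast; ring
  change M.cst (hw j k) (x (j + k)) - M.act (by push_cast; ring) g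
      (M.cst (hw j (k + 1)) (x (j + (k + 1)))) =
    M.cst (hw j k) (x (j + k) - M.act (by push_cast; ring) g (x (j + k + 1)))
  rw [map_sub, cst_act, act_cst]
  rfl

end
end GrMod
end

/-! ### The telescope in components and the splitting of T(T(K, g), g) → T(K, g) -/

noncomputable section
namespace GrMod
section
open CochainComplex CochainComplex.HomComplex
variable {A : Type u} [CommRing A] {𝒜 : ℤ → AddSubgroup A} [GradedRing 𝒜] {d : ℤ} (g : 𝒜 d)
  (K : CochainComplex (GrMod 𝒜) ℤ)

variable (𝒜) in
/-- The functor `tow d`, as a definition that is not unfolded automatically. -/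
def towF (d : ℤ) : GrMod 𝒜 ⥤ GrMod 𝒜 := tow d

instance : (towF 𝒜 d).Additive := inferInstanceAs (tow d).Additive

/-- The difference map on `towF`. -/
def towDiffF : towF 𝒜 d ⟶ towF 𝒜 d := towDiff g

variable (𝒜 d) in
/-- The diagonal map on `towF`. -/
def towDiagF : towF 𝒜 d ⟶ towF 𝒜 d ⋙ towF 𝒜 d := towDiag d

variable (𝒜 d) in
/-- The projection of `towF` to the first factor. -/
def towZeroF : towF 𝒜 d ⟶ 𝟭 _ := towZero d

lemma towDiagF_towZeroF (M : GrMod 𝒜) :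
    (towDiagF 𝒜 d).app M ≫ (towZeroF 𝒜 d).app ((towF 𝒜 d).obj M) = 𝟙 _ :=
  towDiag_towZero d M

lemma towDiagF_map_towZeroF (M : GrMod 𝒜) :
    (towDiagF 𝒜 d).app M ≫ (towF 𝒜 d).map ((towZeroF 𝒜 d).app M) = 𝟙 _ :=
  towDiag_map_towZero d M

lemma towDiagF_towDiffF (M : GrMod 𝒜) :
    (towDiagF 𝒜 d).app M ≫ (towDiffF g).app ((towF 𝒜 d).obj M) =
      (towDiffF g).app M ≫ (towDiagF 𝒜 d).app M :=
  towDiag_towDiff g M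

lemma towDiagF_map_towDiffF (M : GrMod 𝒜) :
    (towDiagF 𝒜 d).app M ≫ (towF 𝒜 d).map ((towDiffF g).app M) =
      (towDiffF g).app M ≫ (towDiagF 𝒜 d).app M :=
  towDiag_map_towDiff g M

lemma towDiagF_map_map {M N : GrMod 𝒜} (φ : M ⟶ N) :
    (towDiagF 𝒜 d).app M ≫ (towF 𝒜 d).map ((towF 𝒜 d).map φ) =
      (towF 𝒜 d).map φ ≫ (towDiagF 𝒜 d).app N :=
  ((towDiag d).naturality φ).symm

/-- The projection of `T(K, g)` to `∏_k K(-k d)`. -/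
def telFst (p : ℤ) : ((telC g).obj K).X p ⟶ (towF 𝒜 d).obj (K.X p) :=
  (mappingCocone.fst ((towDiffC g).app K)).f p

/-- The projection of `T(K, g)` to the shifted copy of `∏_k K(-k d)`. -/
def telSnd (p q : ℤ) (h : p + -1 = q) : ((telC g).obj K).X p ⟶ (towF 𝒜 d).obj (K.X q) :=
  (mappingCocone.snd ((towDiffC g).app K)).v p q h

/-- The inclusion of `∏_k K(-k d)` in `T(K, g)`. -/
def telInl (p : ℤ) : (towF 𝒜 d).obj (K.X p) ⟶ ((telC g).obj K).X p :=
  (mappingCocone.inl ((towDiffC g).app K)).v p p (add_zero p)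

/-- The inclusion of the shifted copy of `∏_k K(-k d)` in `T(K, g)`. -/
def telInr (p q : ℤ) (h : p + 1 = q) : (towF 𝒜 d).obj (K.X p) ⟶ ((telC g).obj K).X q :=
  (mappingCocone.inr ((towDiffC g).app K)).1.v p q h

lemma tel_d_fst (p r : ℤ) : ((telC g).obj K).d p r ≫ telFst g K r =
    telFst g K p ≫ (towF 𝒜 d).map (K.d p r) :=
  ((mappingCocone.fst ((towDiffC g).app K)).comm p r).symm

lemma tel_d_snd (p q r : ℤ) (hpq : p + -1 = q) (hpr : r + -1 = p) :
    ((telC g).obj K).d p r ≫ telSnd g K r p hpr =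
      -(telFst g K p ≫ (towDiffF g).app (K.X p)) - telSnd g K p q hpq ≫ (towF 𝒜 d).map (K.d q p) :=
  cocone_d_snd_v ((towDiffC g).app K) p q r hpq hpr

lemma telInl_d (p r : ℤ) (hpr : p + 1 = r) : telInl g K p ≫ ((telC g).obj K).d p r =
    (towF 𝒜 d).map (K.d p r) ≫ telInl g K r - (towDiffF g).app (K.X p) ≫ telInr g K p r hpr :=
  cocone_inl_d ((towDiffC g).app K) p r hpr

lemma telInr_d (q p r : ℤ) (hqp : q + 1 = p) (hpr : p + 1 = r) :
    telInr g K q p hqp ≫ ((telC g).obj K).d p r =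
      -((towF 𝒜 d).map (K.d q p) ≫ telInr g K p r hpr) :=
  cocone_inr_d ((towDiffC g).app K) q p r hqp hpr

lemma telInl_fst (p : ℤ) : telInl g K p ≫ telFst g K p = 𝟙 _ :=
  mappingCocone.inl_v_fst_f _ _

lemma telInr_fst (p q : ℤ) (hpq : p + 1 = q) : telInr g K p q hpq ≫ telFst g K q = 0 :=
  mappingCocone.inr_v_fst_f _ _ _ _

lemma tel_id (p q : ℤ) (hpq : p + -1 = q) : telFst g K p ≫ telInl g K p +
    telSnd g K p q hpq ≫ telInr g K q p (by omega) = 𝟙 _ :=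
  mappingCocone.id_X ((towDiffC g).app K) p q hpq

lemma tel_hom_ext {M : GrMod 𝒜} {p q : ℤ} (hpq : p + -1 = q) {a b : M ⟶ ((telC g).obj K).X p}
    (h₁ : a ≫ telFst g K p = b ≫ telFst g K p)
    (h₂ : a ≫ telSnd g K p q hpq = b ≫ telSnd g K p q hpq) : a = b :=
  cocone_hom_ext _ hpq h₁ h₂

variable {K} in
lemma tel_map_fst {L : CochainComplex (GrMod 𝒜) ℤ} (φ : K ⟶ L) (p : ℤ) :
    ((telC g).map φ).f p ≫ telFst g L p = telFst g K p ≫ (towF 𝒜 d).map (φ.f p) :=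
  congrArg (fun q => HomologicalComplex.Hom.f q p) ((coconeFst (towDiffC g)).naturality φ)

variable {K} in
lemma tel_map_snd {L : CochainComplex (GrMod 𝒜) ℤ} (φ : K ⟶ L) (p q : ℤ) (h : p + -1 = q) :
    ((telC g).map φ).f p ≫ telSnd g L p q h = telSnd g K p q h ≫ (towF 𝒜 d).map (φ.f q) :=
  cocMap_snd _ _ _ _ _ p q h

lemma telZero_f (p : ℤ) :
    ((telZero g).app K).f p = telFst g K p ≫ (towZeroF 𝒜 d).app (K.X p) := by
  exact congrArg (telFst g K p ≫ ·) (Category.comp_id _)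

/-- The components of the splitting of `T(T(K, g), g) → T(K, g)` to `∏_k T(K, g)(-k d)`. -/
def telSplitFst (p : ℤ) : ((telC g).obj K).X p ⟶ (towF 𝒜 d).obj (((telC g).obj K).X p) :=
  telFst g K p ≫ (towDiagF 𝒜 d).app (K.X p) ≫ (towF 𝒜 d).map (telInl g K p) +
    telSnd g K p (p - 1) (by omega) ≫ (towDiagF 𝒜 d).app (K.X (p - 1)) ≫
      (towF 𝒜 d).map (telInr g K (p - 1) p (by omega))

/-- The components of the splitting of `T(T(K, g), g) → T(K, g)` to the shifted copy of
`∏_k T(K, g)(-k d)`. -/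
def telSplitSnd (p q : ℤ) (h : p + -1 = q) :
    ((telC g).obj K).X p ⟶ (towF 𝒜 d).obj (((telC g).obj K).X q) :=
  telSnd g K p q h ≫ (towDiagF 𝒜 d).app (K.X q) ≫ (towF 𝒜 d).map (telInl g K q)

lemma telSplitFst_eq (p q : ℤ) (h : p + -1 = q) : telSplitFst g K p =
    telFst g K p ≫ (towDiagF 𝒜 d).app (K.X p) ≫ (towF 𝒜 d).map (telInl g K p) +
      telSnd g K p q h ≫ (towDiagF 𝒜 d).app (K.X q) ≫ (towF 𝒜 d).map (telInr g K q p (by omega)) := by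
  obtain rfl : q = p - 1 := by omega
  rfl

/-- With Δ the diagonal of towers, the splitting sends (x, y) to (Δx, Δy) in the product of the T(K,
g)(-k d) and to (Δy, 0) in its shifted copy. The first pair is compatible with differentials because
Δ carries the difference map to the inner one. -/
lemma telSplitFst_comm (p r : ℤ) (hpr : p + 1 = r) :
    telSplitFst g K p ≫ (towF 𝒜 d).map (((telC g).obj K).d p r) =
      ((telC g).obj K).d p r ≫ telSplitFst g K r := by
  rw [telSplitFst_eq g K p (p - 1) (by omega), telSplitFst_eq g K r p (by omega)]
  simp only [Preadditive.add_comp, Preadditive.comp_add, Category.assoc]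
  rw [← Functor.map_comp, ← Functor.map_comp, telInl_d g K p r hpr,
    telInr_d g K (p - 1) p r (by omega) hpr, reassoc_of% tel_d_fst g K p r,
    reassoc_of% tel_d_snd g K p (p - 1) r (by omega) (by omega)]
  simp only [Functor.map_sub, Functor.map_comp, Preadditive.comp_sub, Functor.map_neg,
    Preadditive.comp_neg, Preadditive.sub_comp, Preadditive.neg_comp, Category.assoc,
    reassoc_of% (towDiagF_map_towDiffF g (K.X p)), reassoc_of% (towDiagF_map_map (d := d) (K.d p r)),
    reassoc_of% (towDiagF_map_map (d := d) (K.d (p - 1) p))]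
  abel

/-- This is the condition for the two components to define a map into the mapping cocone. The outer
difference map applied to the first pair cancels the contribution of the inner one, since both
restrict along Δ to the same map. -/
lemma telSplit_cond (p q r : ℤ) (hpq : p + -1 = q) (hpr : r + -1 = p) :
    telSplitSnd g K p q hpq ≫ (towF 𝒜 d).map (((telC g).obj K).d q p) +
      ((telC g).obj K).d p r ≫ telSplitSnd g K r p hpr +
      telSplitFst g K p ≫ (towDiffF g).app (((telC g).obj K).X p) = 0 := by
  rw [telSplitFst_eq g K p q hpq, telSplitSnd, telSplitSnd,
    reassoc_of% tel_d_snd g K p q r hpq hpr]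
  simp only [Preadditive.add_comp, Category.assoc]
  rw [← Functor.map_comp, telInl_d g K q p (by omega), (towDiffF g).naturality,
    (towDiffF g).naturality, reassoc_of% (towDiagF_towDiffF g (K.X p)),
    reassoc_of% (towDiagF_towDiffF g (K.X q))]
  simp only [Functor.map_sub, Functor.map_comp, Preadditive.comp_sub,
    Preadditive.sub_comp, Preadditive.neg_comp, Category.assoc,
    reassoc_of% (towDiagF_map_towDiffF g (K.X q)), reassoc_of% (towDiagF_map_map (d := d) (K.d q p))]
  abel

/-- The components `telSplitFst` form a morphism of complexes. -/
def telSplitFstHom : (telC g).obj K ⟶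
    ((tow d).mapHomologicalComplex (ComplexShape.up ℤ)).obj ((telC g).obj K) where
  f p := telSplitFst g K p
  comm' p r h := telSplitFst_comm g K p r h

/-- The components `telSplitSnd` form a cochain. -/
def telSplitSndCochain : Cochain ((telC g).obj K)
    (((tow d).mapHomologicalComplex (ComplexShape.up ℤ)).obj ((telC g).obj K)) (-1) :=
  Cochain.mk fun p q h => telSplitSnd g K p q h

/-- The splitting of `T(T(K, g), g) → T(K, g)`. -/
def telSplit : (telC g).obj K ⟶ (telC g).obj ((telC g).obj K) :=
  mappingCocone.lift _ (telSplitFstHom g K) (telSplitSndCochain g K) (by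
    refine Cochain.ext₀ _ _ fun p => ?_
    rw [Cochain.add_v, δ_v (-1) 0 (by omega) _ p p _ (p - 1) (p + 1) (by omega) (by omega),
      Int.negOnePow_zero, one_smul]
    exact telSplit_cond g K p (p - 1) (p + 1) (by omega) (by omega))

lemma telSplit_fst (p : ℤ) :
    (telSplit g K).f p ≫ telFst g ((telC g).obj K) p = telSplitFst g K p :=
  mappingCocone.lift_f_fst_f _ _ _ _ _

lemma telSplit_snd (p q : ℤ) (h : p + -1 = q) :
    (telSplit g K).f p ≫ telSnd g ((telC g).obj K) p q h = telSplitSnd g K p q h :=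
  mappingCocone.lift_f_snd_v _ _ _ _ _ _ _

/-- Together with `telSplit_map_telZero`: the counit at T(K, g) and the image under T of the counit
at K have a common section, already as maps of complexes. -/
lemma telSplit_telZero : telSplit g K ≫ (telZero g).app ((telC g).obj K) = 𝟙 _ := by
  ext p : 1
  refine (congrArg (_ ≫ ·) (telZero_f g ((telC g).obj K) p)).trans ?_
  refine (Category.assoc _ _ _).symm.trans ((congrArg (· ≫ _) (telSplit_fst g K p)).trans ?_)
  refine Eq.trans ?_ (tel_id g K p (p - 1) (by omega))
  rw [telSplitFst, Preadditive.add_comp]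
  simp only [Category.assoc]
  rw [(towZeroF 𝒜 d).naturality, (towZeroF 𝒜 d).naturality,
    reassoc_of% (towDiagF_towZeroF (d := d) (K.X p)),
    reassoc_of% (towDiagF_towZeroF (d := d) (K.X (p - 1)))]
  rfl

lemma telSplit_map_telZero : telSplit g K ≫ (telC g).map ((telZero g).app K) = 𝟙 _ := by
  ext p : 1
  refine tel_hom_ext g K (show p + -1 = p - 1 by omega) ?_ ?_
  · refine (Category.assoc _ _ _).trans ((congrArg (_ ≫ ·) (tel_map_fst g _ p)).trans ?_)
    refine (Category.assoc _ _ _).symm.trans ((congrArg (· ≫ _) (telSplit_fst g K p)).trans ?_)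
    refine (congrArg (fun q => _ ≫ (towF 𝒜 d).map q) (telZero_f g K p)).trans
      (Eq.trans ?_ (Category.id_comp _).symm)
    rw [telSplitFst, Preadditive.add_comp]
    simp only [Category.assoc]
    rw [← Functor.map_comp, ← Functor.map_comp, reassoc_of% (telInl_fst g K p),
      reassoc_of% (telInr_fst g K (p - 1) p (by omega)), zero_comp, Functor.map_zero, comp_zero,
      comp_zero, add_zero, towDiagF_map_towZeroF, Category.comp_id]
  · refine (Category.assoc _ _ _).trans ((congrArg (_ ≫ ·) (tel_map_snd g _ p _ _)).trans ?_)
    refine (Category.assoc _ _ _).symm.trans ((congrArg (· ≫ _) (telSplit_snd g K p _ _)).trans ?_)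
    refine (congrArg (fun q => _ ≫ (towF 𝒜 d).map q) (telZero_f g K (p - 1))).trans
      (Eq.trans ?_ (Category.id_comp _).symm)
    rw [telSplitSnd]
    simp only [Category.assoc]
    rw [← Functor.map_comp, reassoc_of% (telInl_fst g K (p - 1)), towDiagF_map_towZeroF,
      Category.comp_id]

end
end GrMod
end

/-! ### The telescope as a colocalization of the derived category -/

noncomputable section
namespace GrMod
open Pretriangulated DerivedCategory
variable {A : Type u} [CommRing A] {𝒜 : ℤ → AddSubgroup A} [GradedRing 𝒜]
variable [HasDerivedCategory.{w} (GrMod 𝒜)] {d : ℤ} (g : 𝒜 d)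

/-- The Milnor sequence in terms of elements: the cohomology of T(K, g) in degree n is an extension
of the kernel of the difference map on towers in H^n by its cokernel on towers in H^(n-1). Products
are exact here, so towers commute with cohomology. The isomorphism `e` absorbs the identification of
the identity with its degreewise extension; only its invertibility is used. -/
lemma exists_tel_homology (K : CochainComplex (GrMod 𝒜) ℤ) (n₀ n : ℤ) (hn : n₀ + 1 = n) :
    ∃ (a : (homologyFunctor (GrMod 𝒜) n).obj (Q.obj ((telC g).obj K)) ⟶
        towObj d ((homologyFunctor (GrMod 𝒜) n).obj (Q.obj K)))
      (δ : towObj d ((homologyFunctor (GrMod 𝒜) n₀).obj (Q.obj K)) ⟶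
        (homologyFunctor (GrMod 𝒜) n).obj (Q.obj ((telC g).obj K))),
      (∀ w y, ev ((towDiff g).app ((homologyFunctor (GrMod 𝒜) n).obj (Q.obj K))) w y = 0 ↔
        ∃ x, ev a w x = y) ∧
      (∀ w x, ev a w x = 0 ↔ ∃ y, ev δ w y = x) ∧
      (∀ w y, ev δ w y = 0 ↔ ∃ z,
        ev ((towDiff g).app ((homologyFunctor (GrMod 𝒜) n₀).obj (Q.obj K))) w z = y) ∧
      ∃ e : (homologyFunctor (GrMod 𝒜) n).obj (Q.obj K) ≅
          (homologyFunctor (GrMod 𝒜) n).obj (Q.obj K),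
        (homologyFunctor (GrMod 𝒜) n).map (Q.map ((telZero g).app K)) =
          a ≫ (towZero d).app ((homologyFunctor (GrMod 𝒜) n).obj (Q.obj K)) ≫ e.hom := by
  have hT := mappingCocone_triangle_distinguished ((towDiffC g).app K)
  obtain ⟨δ, h1, h2⟩ := exists_homology_connecting hT n₀ n hn
  have h3 := homology_exact₂ hT n
  have hnat : ∀ (m w : ℤ) (x), ev (homologyMapIso (tow d) K m).hom w
      (ev ((homologyFunctor (GrMod 𝒜) m).map (Q.map ((towDiffC g).app K))) w x) =
      ev ((towDiff g).app ((homologyFunctor (GrMod 𝒜) m).obj (Q.obj K))) w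
        (ev (homologyMapIso (tow d) K m).hom w x) := fun m w x =>
    congrArg (fun q => ev q w x) (homologyMapIso_naturality (towDiff g) K m)
  have hinj : ∀ (m w : ℤ), Function.Injective (ev (homologyMapIso (tow d) K m).hom w) :=
    fun m w => (bijective_of_isIso _ w).1
  have hinv : ∀ (m w : ℤ) (y), ev (homologyMapIso (tow d) K m).hom w
      (ev (homologyMapIso (tow d) K m).inv w y) = y := fun m w y => ev_inv_hom _ w y
  let a₀ : (homologyFunctor (GrMod 𝒜) n).obj (Q.obj ((telC g).obj K)) ⟶ _ :=
    (homologyFunctor (GrMod 𝒜) n).map (Q.map ((CochainComplex.mappingCocone.fst ((towDiffC g).app K))))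
  refine ⟨a₀ ≫ (homologyMapIso (tow d) K n).hom, (homologyMapIso (tow d) K n₀).inv ≫ δ,
    fun w y => ?_, fun w x => ?_, fun w y => ?_, (homologyMapIso (𝟭 _) K n).symm ≪≫
    (homologyFunctor (GrMod 𝒜) n).mapIso (Q.mapIso
      ((Functor.mapHomologicalComplexIdIso (GrMod 𝒜) (ComplexShape.up ℤ)).app K)), ?_⟩
  · rw [← hinv n w y, ← hnat, map_eq_zero_iff _ (hinj n w)]
    refine (h3 w _).trans (exists_congr fun x => ?_)
    exact (hinj n w).eq_iff.symm
  · rw [ev_comp, map_eq_zero_iff _ (hinj n w)]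
    refine (h2 w _).trans ⟨?_, ?_⟩
    · rintro ⟨y, rfl⟩
      exact ⟨ev (homologyMapIso (tow d) K n₀).hom w y, congrArg (ev δ w) (ev_hom_inv _ w y)⟩
    · rintro ⟨y, rfl⟩
      exact ⟨_, rfl⟩
  · refine (h1 w _).trans ⟨?_, ?_⟩
    · rintro ⟨x, hx⟩
      refine ⟨ev (homologyMapIso (tow d) K n₀).hom w x, ?_⟩
      exact (hnat n₀ w x).symm.trans ((congrArg _ hx).trans (hinv n₀ w y))
    · rintro ⟨z, hz⟩
      refine ⟨ev (homologyMapIso (tow d) K n₀).inv w z, hinj n₀ w ?_⟩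
      exact (hnat n₀ w _).trans ((congrArg _ (hinv n₀ w z)).trans (hz.trans (hinv n₀ w y).symm))
  · have h4 := homologyMapIso_naturality (towZero (𝒜 := 𝒜) d) K n
    have h5 : (homologyFunctor (GrMod 𝒜) n).map (Q.map
        ((NatTrans.mapHomologicalComplex (towZero d) (ComplexShape.up ℤ)).app K)) =
        (homologyMapIso (tow d) K n).hom ≫ (towZero d).app _ ≫
          (homologyMapIso (𝟭 _) K n).inv := by
      rw [← Category.assoc, ← h4]
      exact ((Category.assoc _ _ _).trans ((congrArg _ (homologyMapIso (𝟭 _) K n).hom_inv_id).trans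
        (Category.comp_id _))).symm
    have h6 : (homologyFunctor (GrMod 𝒜) n).map (Q.map ((telZero g).app K)) =
        a₀ ≫ (homologyFunctor (GrMod 𝒜) n).map (Q.map
          ((NatTrans.mapHomologicalComplex (towZero d) (ComplexShape.up ℤ)).app K)) ≫
        (homologyFunctor (GrMod 𝒜) n).map (Q.map
          ((Functor.mapHomologicalComplexIdIso (GrMod 𝒜) (ComplexShape.up ℤ)).hom.app K)) := by
      refine (congrArg (homologyFunctor (GrMod 𝒜) n).map (Q.map_comp (X := (telC g).obj K)
        (CochainComplex.mappingCocone.fst ((towDiffC g).app K)) _)).trans ?_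
      refine ((homologyFunctor (GrMod 𝒜) n).map_comp _ _).trans (congrArg (a₀ ≫ ·) ?_)
      exact (congrArg (homologyFunctor (GrMod 𝒜) n).map (Q.map_comp _ _)).trans
        ((homologyFunctor (GrMod 𝒜) n).map_comp _ _)
    rw [h6, h5]
    exact (congrArg (a₀ ≫ ·) ((Category.assoc _ _ _).trans (congrArg _ (Category.assoc _ _ _)))).trans
      (Category.assoc _ _ _).symm

/-- A five-lemma chase along the Milnor sequence: at both ends `g` is inverted by the shift of
towers. -/
lemma mulBij_tel (K : CochainComplex (GrMod 𝒜) ℤ) (n : ℤ) :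
    MulBij g ((homologyFunctor (GrMod 𝒜) n).obj (Q.obj ((telC g).obj K))) := by
  obtain ⟨a, δ, h1, h2, h3, -⟩ := exists_tel_homology g K (n - 1) n (by omega)
  intro i j h
  constructor
  · rw [injective_iff_map_eq_zero]
    intro x hx
    have e1 : ev ((towDiff g).app _) i (ev a i x) = 0 := (h1 i _).2 ⟨x, rfl⟩
    have e2 : (towObj d _).act h g (ev a i x) = 0 := by rw [← ev_act, hx, map_zero]
    have e3 : ev a i x = 0 := by
      have := towShift_act g _ h (ev a i x)
      rw [e1, e2, towShift_zero, sub_zero] at this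
      exact this.symm
    obtain ⟨z, rfl⟩ := (h2 i x).1 e3
    rw [← ev_act] at hx
    obtain ⟨u, hu⟩ := (h3 _ _).1 hx
    -- Shifting the relation that writes g z as the difference of u gives z minus its own difference
    -- on one side and the difference of the shift of u on the other.
    refine (h3 _ _).2 ⟨z + GrMod.towShift _ h u, ?_⟩
    rw [map_add, towDiff_towShift, hu, towShift_act, add_sub_cancel]
  · intro x
    have e1 : ev ((towDiff g).app _) j (ev a j x) = 0 := (h1 j _).2 ⟨x, rfl⟩
    -- The shift of a(x) is a quotient of a(x) by `g` within the kernel of the difference map, and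
    -- x' lifts it. The error x - g x' is δ z for some z, and δ of the shift of z is a quotient of
    -- it by `g`.
    obtain ⟨x', hx'⟩ := (h1 i (GrMod.towShift _ h (ev a j x))).1 (by
      rw [towDiff_towShift, e1, towShift_zero])
    obtain ⟨z, hz⟩ := (h2 j (x - GrMod.act _ h g x')).1 (by
      rw [map_sub, ev_act, hx', act_towShift, e1, sub_zero, sub_self])
    refine ⟨x' + ev δ i (GrMod.towShift _ h z), ?_⟩
    rw [map_add, ← ev_act, act_towShift, map_sub, hz, (h3 j _).2 ⟨z, rfl⟩, sub_zero,
      add_sub_cancel]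

variable {g} in
-- When `g` is bijective on cohomology, a tower is determined by its zeroth term and its
-- differences, which can be prescribed freely. In the Milnor sequence the cokernel vanishes and the
-- kernel is the zeroth term.
lemma isIso_Q_map_telZero {K : CochainComplex (GrMod 𝒜) ℤ}
    (hK : ∀ n, MulBij g ((homologyFunctor (GrMod 𝒜) n).obj (Q.obj K))) :
    IsIso (Q.map ((telZero g).app K)) := by
  rw [DerivedCategory.isIso_iff]
  intro n
  obtain ⟨a, δ, h1, h2, h3, θ, h4⟩ := exists_tel_homology g K (n - 1) n (by omega)
  refine isIso_of_bijective _ fun w => ⟨?_, fun x => ?_⟩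
  · rw [injective_iff_map_eq_zero]
    intro x hx
    rw [h4] at hx
    have e : ev a w x = 0 := (hK n).tower_eq_zero w _ ((bijective_of_isIso θ.hom w).1
      (hx.trans (map_zero _).symm)) ((h1 _ _).2 ⟨x, rfl⟩)
    obtain ⟨z, rfl⟩ := (h2 w x).1 e
    obtain ⟨u, -, hu⟩ := (hK (n - 1)).exists_tower w 0 z
    exact (h3 w z).2 ⟨u, hu⟩
  · obtain ⟨u, hu, hu'⟩ := (hK n).exists_tower w (ev θ.inv w x) 0
    obtain ⟨y, rfl⟩ := (h1 w u).1 hu'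
    exact ⟨y, by rw [h4]; exact (congrArg (ev θ.hom w) hu).trans (ev_inv_hom θ w x)⟩

/-- The counit at T(K, g) is invertible, since `g` is bijective on the cohomology there. Hence so is
the common section `telSplit`, and with it the other map that it splits. -/
lemma isIso_Q_map_telC_map_telZero (K : CochainComplex (GrMod 𝒜) ℤ) :
    IsIso (Q.map ((telC g).map ((telZero g).app K))) := by
  have h1 : IsIso (Q.map ((telZero g).app ((telC g).obj K))) :=
    isIso_Q_map_telZero (mulBij_tel g K)
  have h2 : Q.map (telSplit g K) ≫ Q.map ((telZero g).app ((telC g).obj K)) = 𝟙 _ :=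
    (Q.map_comp _ _).symm.trans ((congrArg _ (telSplit_telZero g K)).trans (Q.map_id _))
  have h3 : Q.map (telSplit g K) ≫ Q.map ((telC g).map ((telZero g).app K)) = 𝟙 _ :=
    (Q.map_comp _ _).symm.trans ((congrArg _ (telSplit_map_telZero g K)).trans (Q.map_id _))
  have h4 : IsIso (Q.map (telSplit g K)) := isIso_of_comp_hom_eq_id _ h2
  exact isIso_of_hom_comp_eq_id _ h3

/-- The canonical map `T(M, g) → M` on the derived category. -/
def telε : tel g ⟶ 𝟭 (DerivedCategory (GrMod 𝒜)) := descendCounit (telC_preserves g) (telZero g)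

/-- The cone of the canonical map `T(M, g) → M`. -/
def telCone : DerivedCategory (GrMod 𝒜) ⥤ DerivedCategory (GrMod 𝒜) :=
  descend (coneFunctor (telZero g)) (PreservesQuasiIso.cone _ (telC_preserves g) id_preserves)

/-- The canonical map to the cone of `T(M, g) → M`. -/
def telη : 𝟭 (DerivedCategory (GrMod 𝒜)) ⟶ telCone g :=
  descendUnit (PreservesQuasiIso.cone _ (telC_preserves g) id_preserves) (coneInr (telZero g))

/-- T(-, g) takes values in the objects on which `g` is invertible, its counit is invertible on
them, and T(-, g) inverts its counit; this is the idempotence required by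
`isDecomposition_of_idempotent`. -/
lemma isDecomposition_tel :
    (PTor 𝒜 g).rightOrthogonal.IsDecomposition (tel g) (telCone g) (telε g) (telη g) := by
  have : (PTor 𝒜 g).rightOrthogonal.IsTriangulated := inferInstance
  refine ObjectProperty.isDecomposition_of_idempotent _ (fun M => ?_) (fun M hM => ?_)
    (fun M => ?_) (fun M => coneFunctor_triangle (telC_preserves g)
      (PreservesQuasiIso.cone (telZero g) (telC_preserves g) id_preserves) M)
  · obtain ⟨K, ⟨e⟩⟩ := exists_Q_iso M
    rw [inv_iff]
    exact fun n => (mulBij_tel g K n).of_iso ((homologyFunctor (GrMod 𝒜) n).mapIso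
      (((descendIso (telC_preserves g)).app K).symm ≪≫ (tel g).mapIso e))
  · obtain ⟨K, ⟨e⟩⟩ := exists_Q_iso M
    rw [inv_iff] at hM
    have h1 := isIso_Q_map_telZero (g := g) (K := K)
      fun n => (hM n).of_iso ((homologyFunctor (GrMod 𝒜) n).mapIso e.symm)
    have h2 : IsIso ((telε g).app (Q.obj K)) := by
      have h3 : (telε g).app (Q.obj K) = _ := descendCounit_app (telC_preserves g) (telZero g) K
      rw [h3]
      exact IsIso.comp_isIso' (Iso.isIso_hom ((descendIso (telC_preserves g)).app K)) h1
    exact isIso_app_of_iso _ e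
  · obtain ⟨K, ⟨e⟩⟩ := exists_Q_iso M
    have h1 := isIso_Q_map_telC_map_telZero g K
    have h2 : IsIso ((tel g).map ((telε g).app (Q.obj K))) := by
      have h3 : (telε g).app (Q.obj K) = _ := descendCounit_app (telC_preserves g) (telZero g) K
      rw [h3]
      have h4 : IsIso ((Q ⋙ tel g).map ((telZero g).app K)) :=
        (NatIso.isIso_map_iff (descendIso (telC_preserves g)) ((telZero g).app K)).2 h1
      refine (congrArg IsIso ((tel g).map_comp ((descendIso (telC_preserves g)).hom.app K) _)).mpr ?_
      exact IsIso.comp_isIso' (Functor.map_isIso _ _) h4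
    have h5 : IsIso ((Functor.whiskerRight (telε g) (tel g)).app (Q.obj K)) := h2
    exact isIso_app_of_iso (Functor.whiskerRight (telε g) (tel g)) e

end GrMod
end

/-! ### Comparing localizations and telescopes at two elements -/

noncomputable section
namespace CategoryTheory.ObjectProperty.IsDecomposition
open Pretriangulated
variable {C : Type u} [Category.{v} C] [HasZeroObject C] [HasShift C ℤ] [Preadditive C]
  [∀ n : ℤ, (shiftFunctor C n).Additive] [Pretriangulated C] {P P₁ P₂ : ObjectProperty C}
  [P.IsClosedUnderIsomorphisms]
  [P.IsStableUnderShift ℤ] [P₁.IsStableUnderShift ℤ] [P₂.IsStableUnderShift ℤ]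
  {Γ L Γ₁ L₁ Γ₂ L₂ : C ⥤ C} {ε : Γ ⟶ 𝟭 C} {η : 𝟭 C ⟶ L} {ε₁ : Γ₁ ⟶ 𝟭 C} {η₁ : 𝟭 C ⟶ L₁}
  {ε₂ : Γ₂ ⟶ 𝟭 C} {η₂ : 𝟭 C ⟶ L₂}

/-- If the right part of the third decomposition is the intersection of those of the first two,
then the canonical map between the second and third localizations is inverted by the first. -/
lemma isIso_right_map (h : P.IsDecomposition Γ L ε η) (h₁ : P₁.IsDecomposition Γ₁ L₁ ε₁ η₁)
    (h₂ : P₂.IsDecomposition Γ₂ L₂ ε₂ η₂)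
    (hP : ∀ N, P₂.rightOrthogonal N ↔ P.rightOrthogonal N ∧ P₁.rightOrthogonal N) {M : C}
    (φ : L₁.obj M ⟶ L₂.obj M) (hφ : η₁.app M ≫ φ = η₂.app M)
    (hX : P₁.rightOrthogonal (L.obj (L₁.obj M))) : IsIso (L.map φ) := by
  -- φ extends to ψ : L (L₁ M) → L₂ M. In the other direction χ exists because L (L₁ M) lies in both
  -- right orthogonals, and uniqueness of factorizations makes ψ and χ inverse. So φ is the unit η
  -- followed by an isomorphism, and L inverts η.
  obtain ⟨ψ, hψ⟩ := (h.bijective_unit ((hP _).1 (h₂.right M)).1 (L₁.obj M)).2 φ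
  obtain ⟨χ, hχ⟩ := (h₂.bijective_unit ((hP _).2 ⟨h.right (L₁.obj M), hX⟩) M).2
    (η₁.app M ≫ η.app (L₁.obj M))
  dsimp only at hψ hχ
  have e₁ : χ ≫ ψ = 𝟙 _ := (h₂.bijective_unit (h₂.right M) M).1 (by
    dsimp only
    rw [← Category.assoc, hχ, Category.assoc, hψ, hφ, Category.comp_id])
  have e₂ : φ ≫ χ = η.app (L₁.obj M) := (h₁.bijective_unit hX M).1 (by
    dsimp only
    rw [← Category.assoc, hφ, hχ])
  have e₃ : ψ ≫ χ = 𝟙 _ := (h.bijective_unit (h.right _) _).1 (by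
    dsimp only
    rw [← Category.assoc, hψ, e₂, Category.comp_id])
  have : IsIso ψ := ⟨χ, e₃, e₁⟩
  have : IsIso (L.map (η.app (L₁.obj M))) := h.isIso_map_unit _
  rw [← hψ, L.map_comp]
  infer_instance

/-- If the left part of the third decomposition is the intersection of those of the first two,
then the canonical map between the third and second colocalizations is inverted by the first. -/
lemma isIso_left_map (h : P.IsDecomposition Γ L ε η) (h₁ : P₁.IsDecomposition Γ₁ L₁ ε₁ η₁)
    (h₂ : P₂.IsDecomposition Γ₂ L₂ ε₂ η₂) (hP : ∀ N, P₂ N ↔ P N ∧ P₁ N) {M : C}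
    (φ : Γ₂.obj M ⟶ Γ₁.obj M) (hφ : φ ≫ ε₁.app M = ε₂.app M)
    (hX : P₁ (Γ.obj (Γ₁.obj M))) : IsIso (Γ.map φ) := by
  -- Dually, φ lifts to an isomorphism Γ₂ M ≅ Γ (Γ₁ M), followed by the counit, which Γ inverts.
  obtain ⟨ψ, hψ⟩ := (h.bijective_counit ((hP _).1 (h₂.left M)).1 (Γ₁.obj M)).2 φ
  obtain ⟨χ, hχ⟩ := (h₂.bijective_counit ((hP _).2 ⟨h.left (Γ₁.obj M), hX⟩) M).2
    (ε.app (Γ₁.obj M) ≫ ε₁.app M)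
  dsimp only at hψ hχ
  have e₁ : ψ ≫ χ = 𝟙 _ := (h₂.bijective_counit (h₂.left M) M).1 (by
    dsimp only
    rw [Category.assoc, hχ, ← Category.assoc, hψ, hφ, Category.id_comp])
  have e₂ : χ ≫ φ = ε.app (Γ₁.obj M) := (h₁.bijective_counit hX M).1 (by
    dsimp only
    rw [Category.assoc, hφ, hχ])
  have e₃ : χ ≫ ψ = 𝟙 _ := (h.bijective_counit (h.left _) _).1 (by
    dsimp only
    rw [Category.assoc, hψ, e₂, Category.id_comp])
  have : IsIso ψ := ⟨χ, e₁, e₃⟩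
  have : IsIso (Γ.map (ε.app (Γ₁.obj M))) := h.isIso_map_counit _
  rw [← hψ, Γ.map_comp]
  infer_instance

end CategoryTheory.ObjectProperty.IsDecomposition

namespace GrMod
open Pretriangulated DerivedCategory
variable {A : Type u} [CommRing A] {𝒜 : ℤ → AddSubgroup A} [GradedRing 𝒜]
variable [HasDerivedCategory.{w} (GrMod 𝒜)]

section
variable {F G : CochainComplex (GrMod 𝒜) ℤ ⥤ CochainComplex (GrMod 𝒜) ℤ}
  (hF : PreservesQuasiIso F) (hG : PreservesQuasiIso G)

lemma descendUnit_descendMap {u : 𝟭 _ ⟶ F} {v : 𝟭 _ ⟶ G} {α : F ⟶ G} (h : u ≫ α = v)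
    (K : CochainComplex (GrMod 𝒜) ℤ) :
    (descendUnit hF u).app (Q.obj K) ≫ (descendMap hF hG α).app (Q.obj K) =
      (descendUnit hG v).app (Q.obj K) := by
  refine (congrArg₂ (· ≫ ·) (descendUnit_app hF u K) (descendMap_app hF hG α K)).trans
    (Eq.trans ?_ (descendUnit_app hG v K).symm)
  refine (Category.assoc _ _ _).trans ((congrArg _ (Iso.inv_hom_id_assoc
    ((descendIso hF).app K) _)).trans ?_)
  refine (Category.assoc _ _ _).symm.trans (congrArg (· ≫ _) ?_)
  exact (Q.map_comp _ _).symm.trans (congrArg (fun q => Q.map (NatTrans.app q K)) h)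

lemma descendMap_descendCounit {u : F ⟶ 𝟭 _} {v : G ⟶ 𝟭 _} {α : F ⟶ G} (h : α ≫ v = u)
    (K : CochainComplex (GrMod 𝒜) ℤ) :
    (descendMap hF hG α).app (Q.obj K) ≫ (descendCounit hG v).app (Q.obj K) =
      (descendCounit hF u).app (Q.obj K) := by
  refine (congrArg₂ (· ≫ ·) (descendMap_app hF hG α K) (descendCounit_app hG v K)).trans
    (Eq.trans ?_ (descendCounit_app hF u K).symm)
  refine (Category.assoc _ _ _).trans (congrArg _ ?_)
  refine (Category.assoc _ _ _).trans ((congrArg _ (Iso.inv_hom_id_assoc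
    ((descendIso hG).app K) _)).trans ?_)
  exact (Q.map_comp _ _).symm.trans (congrArg (fun q => Q.map (NatTrans.app q K)) h)

lemma isIso_map_Q_map_iff (Ψ : DerivedCategory (GrMod 𝒜) ⥤ DerivedCategory (GrMod 𝒜))
    (α : F ⟶ G) (K : CochainComplex (GrMod 𝒜) ℤ) :
    IsIso (Ψ.map (Q.map (α.app K))) ↔ IsIso (Ψ.map ((descendMap hF hG α).app (Q.obj K))) := by
  have e : Arrow.mk ((descendMap hF hG α).app (Q.obj K)) ≅ Arrow.mk (Q.map (α.app K)) :=
    Arrow.isoMk ((descendIso hF).app K) ((descendIso hG).app K) (by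
      refine Eq.symm ((congrArg (· ≫ _) (descendMap_app hF hG α K)).trans ?_)
      refine (Category.assoc _ _ _).trans (congrArg _ ((Category.assoc _ _ _).trans ?_))
      exact (congrArg _ (Iso.inv_hom_id ((descendIso hG).app K))).trans (Category.comp_id _))
  exact ((MorphismProperty.isomorphisms _).arrow_mk_iso_iff (Ψ.mapArrow.mapIso e)).symm

end

variable {d d' e : ℤ} {g : 𝒜 d} {g' : 𝒜 d'} {h : 𝒜 e}

lemma inv_mul_iff (hg : (g' : A) = h * g) (hd : e + d = d') (M : DerivedCategory (GrMod 𝒜)) :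
    (PTor 𝒜 g').rightOrthogonal M ↔
      (PTor 𝒜 h).rightOrthogonal M ∧ (PTor 𝒜 g).rightOrthogonal M := by
  rw [inv_iff, inv_iff, inv_iff, ← forall_and]
  exact forall_congr' fun n => (MulBij.mul_iff hg hd).trans and_comm

lemma pTor_le_mul (hg : (g' : A) = h * g) (hd : e + d = d') : PTor 𝒜 g ≤ PTor 𝒜 g' :=
  fun _ hM n => (hM n).of_mul h hg hd

lemma pTor_locD (h : 𝒜 e) {M : DerivedCategory (GrMod 𝒜)} (hM : PTor 𝒜 g M) :
    PTor 𝒜 g ((locD h).obj M) :=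
  fun n => ((hM n).loc h).of_iso (nonempty_homology_locD h M n).some.symm

lemma inv_locD (h : 𝒜 e) {M : DerivedCategory (GrMod 𝒜)} (hM : (PTor 𝒜 g).rightOrthogonal M) :
    (PTor 𝒜 g).rightOrthogonal ((locD h).obj M) := by
  rw [inv_iff] at hM ⊢
  exact fun n => ((hM n).loc h).of_iso (nonempty_homology_locD h M n).some.symm

/-- By adjunction: a map from a g-torsion N to T(M, h) extends to N_h, since `h` is invertible on
the target. N_h is still g-torsion, so the composite to M vanishes, and maps N_h → T(M, h) are
determined by that composite. -/
lemma inv_tel (h : 𝒜 e) {M : DerivedCategory (GrMod 𝒜)} (hM : (PTor 𝒜 g).rightOrthogonal M) :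
    (PTor 𝒜 g).rightOrthogonal ((tel h).obj M) := by
  intro N φ hN
  obtain ⟨ψ, rfl⟩ := ((isDecomposition_loc h).bijective_unit ((isDecomposition_tel h).left M) N).2 φ
  have e0 : ψ ≫ (telε h).app M = 0 := hM _ (pTor_locD h hN)
  have : ψ = 0 := ((isDecomposition_tel h).bijective_counit ((isDecomposition_loc h).right N) M).1
    (e0.trans zero_comp.symm)
  dsimp only
  rw [this, comp_zero]

variable {e' : ℤ} {k : 𝒜 e'}

/-- Inverting g' amounts to inverting g and k, so M_g → M_g' becomes an isomorphism once k is
inverted. The factors `h` and `k` are kept apart because their degrees may be presented differently: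
in the application `h` is a product over (S ∪ {i}) \ S and `k` is f_i. -/
lemma isIso_locD_map_locTrans (hd : e + d = d') (hg : (g' : A) = h * g) (hd' : e' + d = d')
    (hg' : (g' : A) = k * g) (K : CochainComplex (GrMod 𝒜) ℤ) :
    IsIso ((locD k).map (Q.map ((NatTrans.mapHomologicalComplex (locTrans g g' h hd hg)
      (ComplexShape.up ℤ)).app K))) := by
  rw [isIso_map_Q_map_iff (locC_preserves g) (locC_preserves g')]
  refine (isDecomposition_loc k).isIso_right_map (isDecomposition_loc g) (isDecomposition_loc g')
    (inv_mul_iff hg' hd') _ (descendUnit_descendMap _ _ ?_ K)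
    (inv_locD k ((isDecomposition_loc g).right _))
  unfold toLocC
  rw [← toLoc_comp g g' h hd hg, NatTrans.mapHomologicalComplex_comp, Category.assoc]

lemma isIso_tel_map_telTrans (hd : e + d = d') (hg : (g' : A) = h * g) (hd' : e' + d = d')
    (hg' : (g' : A) = k * g) (K : CochainComplex (GrMod 𝒜) ℤ) :
    IsIso ((tel k).map (Q.map ((telTrans g g' h hd hg).app K))) := by
  rw [isIso_map_Q_map_iff (telC_preserves g') (telC_preserves g)]
  exact (isDecomposition_tel k).isIso_left_map (isDecomposition_tel g) (isDecomposition_tel g')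
    (inv_mul_iff hg' hd') _ (descendMap_descendCounit _ _ (telTrans_zero g g' h hd hg) K)
    (inv_tel k ((isDecomposition_tel g).left _))

end GrMod
end

/-! ### Truncations of diagrams and induction over columns -/

noncomputable section
namespace GrMod
variable {A : Type u} [CommRing A] {𝒜 : ℤ → AddSubgroup A} [GradedRing 𝒜]

section
/-- `M` if `p` holds and `0` otherwise. -/
def resObj (p : Prop) (M : GrMod 𝒜) : GrMod 𝒜 := piObj fun _ : PLift p => M

variable (𝒜) in
/-- The functor which is the identity if `p` holds and `0` otherwise. -/
def resF (p : Prop) : GrMod 𝒜 ⥤ GrMod 𝒜 where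
  obj M := resObj p M
  map {M N} φ := piLift (F := fun _ : PLift p => N) fun h => piProj (fun _ : PLift p => M) h ≫ φ

instance (p : Prop) : (resF 𝒜 p).Additive where

variable (𝒜) in
/-- The canonical map between the functors `resF`. -/
def resTrans {p q : Prop} (h : q → p) : resF 𝒜 p ⟶ resF 𝒜 q where
  app M := piLift (F := fun _ : PLift q => M) fun hq => piProj (fun _ : PLift p => M) ⟨h hq.down⟩

instance {p q : Prop} (h : q → p) (M : GrMod 𝒜) : Epi ((resTrans 𝒜 h).app M) := by
  refine Preadditive.epi_of_cancel_zero _ fun {N} φ hφ => hom_ext fun w x => ?_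
  classical
  let y : (resObj p M).X w := fun _ => if hq : q then x ⟨hq⟩ else 0
  have hy : ev ((resTrans 𝒜 h).app M) w y = x := by
    funext hq
    exact dif_pos hq.down
  rw [← hy]
  exact congrArg (fun q => ev q w y) hφ

lemma isIso_resTrans {p q : Prop} (h : q → p) (h' : p → q) : IsIso (resTrans 𝒜 h) :=
  ⟨resTrans 𝒜 h', rfl, rfl⟩

lemma isZero_resF {p : Prop} (h : ¬p) (M : GrMod 𝒜) : IsZero ((resF 𝒜 p).obj M) :=
  isZero_iff.2 fun _ _ => funext fun hp => absurd hp.down h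

/-- The functor `resF` is the identity if `p` holds. -/
def resIso {p : Prop} (h : p) : resF 𝒜 p ≅ 𝟭 _ where
  hom := { app := fun M => piProj (fun _ : PLift p => M) ⟨h⟩ }
  inv := { app := fun M => piLift (F := fun _ : PLift p => M) fun _ => 𝟙 M }

end

section
variable {J : Type} [SmallCategory J]

/-- The truncation of a diagram to a down-closed set of objects. -/
def trunc (D : Set J) (hD : ∀ {S T : J}, (S ⟶ T) → T ∈ D → S ∈ D) :
    (J ⥤ CochainComplex (GrMod 𝒜) ℤ) ⥤ (J ⥤ CochainComplex (GrMod 𝒜) ℤ) where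
  obj X :=
    { obj := fun S => ((resF 𝒜 (S ∈ D)).mapHomologicalComplex (ComplexShape.up ℤ)).obj (X.obj S)
      map := fun {S T} f =>
        ((resF 𝒜 (S ∈ D)).mapHomologicalComplex (ComplexShape.up ℤ)).map (X.map f) ≫
          (NatTrans.mapHomologicalComplex (resTrans 𝒜 (hD f)) (ComplexShape.up ℤ)).app (X.obj T)
      map_id := fun S => by
        rw [X.map_id, CategoryTheory.Functor.map_id, Category.id_comp]
        rfl
      map_comp := fun {S T U} f g => by
        rw [X.map_comp, Functor.map_comp]
        rfl }
  map α :=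
    { app := fun S =>
        ((resF 𝒜 (S ∈ D)).mapHomologicalComplex (ComplexShape.up ℤ)).map (α.app S)
      naturality := fun {S T} f => by
        rw [Category.assoc, ← NatTrans.naturality, ← Category.assoc, ← Category.assoc,
          ← Functor.map_comp, ← Functor.map_comp, α.naturality] }

/-- The map from a truncation of a diagram to a smaller one. -/
def truncMap {D D' : Set J} (hD : ∀ {S T : J}, (S ⟶ T) → T ∈ D → S ∈ D)
    (hD' : ∀ {S T : J}, (S ⟶ T) → T ∈ D' → S ∈ D') (h : D' ⊆ D) :
    trunc (𝒜 := 𝒜) D hD ⟶ trunc D' hD' where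
  app X :=
    { app := fun S => (NatTrans.mapHomologicalComplex
        (resTrans 𝒜 (fun hS : S ∈ D' => h hS)) (ComplexShape.up ℤ)).app (X.obj S) }

instance {D D' : Set J} (hD : ∀ {S T : J}, (S ⟶ T) → T ∈ D → S ∈ D)
    (hD' : ∀ {S T : J}, (S ⟶ T) → T ∈ D' → S ∈ D') (h : D' ⊆ D)
    (X : J ⥤ CochainComplex (GrMod 𝒜) ℤ) : Epi ((truncMap hD hD' h).app X) := by
  have : ∀ S, Epi (((truncMap hD hD' h).app X).app S) := fun S =>
    HomologicalComplex.epi_of_epi_f _ fun n =>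
      inferInstanceAs (Epi ((resTrans 𝒜 (fun hS : S ∈ D' => h hS)).app ((X.obj S).X n)))
  exact NatTrans.epi_of_epi_app _

variable {D D' : Set J} (hD : ∀ {S T : J}, (S ⟶ T) → T ∈ D → S ∈ D)
  (hD' : ∀ {S T : J}, (S ⟶ T) → T ∈ D' → S ∈ D') (h : D' ⊆ D)

lemma isZero_trunc {S : J} (hS : S ∉ D) (X : J ⥤ CochainComplex (GrMod 𝒜) ℤ) :
    IsZero (((trunc D hD).obj X).obj S) := by
  rw [IsZero.iff_id_eq_zero]
  ext n : 1
  exact (isZero_resF hS ((X.obj S).X n)).eq_of_src _ _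

/-- A truncation of a diagram does not change the objects of the subset. -/
def truncIso {S : J} (hS : S ∈ D) :
    trunc (𝒜 := 𝒜) D hD ⋙ (evaluation J _).obj S ≅ (evaluation J _).obj S :=
  NatIso.ofComponents (fun X => (NatIso.mapHomologicalComplex (resIso hS)
      (ComplexShape.up ℤ)).app (X.obj S) ≪≫
        (Functor.mapHomologicalComplexIdIso (GrMod 𝒜) (ComplexShape.up ℤ)).app (X.obj S))
    (fun {X Y} α => by
      ext n : 1
      rfl)

lemma isIso_truncMap_app {S : J} (hS : S ∈ D → S ∈ D') (X : J ⥤ CochainComplex (GrMod 𝒜) ℤ) :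
    IsIso (((truncMap hD hD' h).app X).app S) := by
  have : ∀ n, IsIso ((((truncMap hD hD' h).app X).app S).f n) := fun n =>
    have := isIso_resTrans (𝒜 := 𝒜) (fun hS : S ∈ D' => h hS) hS
    inferInstanceAs (IsIso ((resTrans 𝒜 (fun hS : S ∈ D' => h hS)).app ((X.obj S).X n)))
  exact HomologicalComplex.Hom.isIso_of_components _

/-- The kernel of the map between two truncations. -/
def truncKer (X : J ⥤ CochainComplex (GrMod 𝒜) ℤ) :
    ShortComplex (J ⥤ CochainComplex (GrMod 𝒜) ℤ) :=
  ShortComplex.mk (kernel.ι ((truncMap hD hD' h).app X)) ((truncMap hD hD' h).app X)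
    (kernel.condition _)

/-- The functoriality of `truncKer`. -/
def truncKerMap {X Y : J ⥤ CochainComplex (GrMod 𝒜) ℤ} (α : X ⟶ Y) :
    truncKer hD hD' h X ⟶ truncKer hD hD' h Y where
  τ₁ := kernel.map _ _ ((trunc D hD).map α) ((trunc D' hD').map α)
    ((truncMap hD hD' h).naturality α).symm
  τ₂ := (trunc D hD).map α
  τ₃ := (trunc D' hD').map α
  comm₁₂ := kernel.lift_ι _ _ _
  comm₂₃ := (truncMap hD hD' h).naturality α

lemma shortExact_truncKer (X : J ⥤ CochainComplex (GrMod 𝒜) ℤ) :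
    (truncKer hD hD' h X).ShortExact where
  exact := ShortComplex.exact_kernel ((truncMap hD hD' h).app X)
  mono_f := equalizer.ι_mono
  epi_g := inferInstanceAs (Epi ((truncMap hD hD' h).app X))

/-- Away from D \ D' the map of truncations is an isomorphism, so its kernel is concentrated on D \
D'. -/
lemma isZero_truncKer {S : J} (hS : S ∈ D → S ∈ D') (X : J ⥤ CochainComplex (GrMod 𝒜) ℤ) :
    IsZero ((truncKer hD hD' h X).X₁.obj S) :=
  (((shortExact_truncKer hD hD' h X).map_of_exact ((evaluation J _).obj S)).isIso_g_iff).1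
    (isIso_truncMap_app hD hD' h hS X)

/-- On D \ D' the smaller truncation vanishes, so the kernel there is the whole column, naturally in
the diagram. -/
lemma nonempty_arrow_truncKer {S : J} (hS : S ∈ D) (hS' : S ∉ D')
    {X Y : J ⥤ CochainComplex (GrMod 𝒜) ℤ} (α : X ⟶ Y) :
    Nonempty (Arrow.mk ((truncKerMap hD hD' h α).τ₁.app S) ≅ Arrow.mk (α.app S)) := by
  have hi : ∀ X : J ⥤ CochainComplex (GrMod 𝒜) ℤ,
      IsIso ((truncKer hD hD' h X).f.app S) := fun X =>
    (((shortExact_truncKer hD hD' h X).map_of_exact ((evaluation J _).obj S)).isIso_f_iff).2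
      (isZero_trunc hD' hS' X)
  have e₁ : Arrow.mk ((truncKerMap hD hD' h α).τ₁.app S) ≅
      Arrow.mk (((trunc D hD).map α).app S) :=
    Arrow.isoMk (@asIso _ _ _ _ _ (hi X)) (@asIso _ _ _ _ _ (hi Y))
      (congrArg (fun q => NatTrans.app q S) (truncKerMap hD hD' h α).comm₁₂.symm)
  exact ⟨e₁ ≪≫ Arrow.isoMk ((truncIso hD hS).app X) ((truncIso hD hS).app Y)
    ((truncIso hD hS).hom.naturality α).symm⟩

end

section
open Pretriangulated DerivedCategory
variable [HasDerivedCategory.{w} (GrMod 𝒜)]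
variable {J : Type} [SmallCategory J] [Finite J]

/-- Induction over the columns of a total complex. -/
theorem mem_of_columns (F : (J ⥤ CochainComplex (GrMod 𝒜) ℤ) ⥤ CochainComplex (GrMod 𝒜) ℤ)
    [F.PreservesZeroMorphisms]
    (hF : ∀ S : ShortComplex (J ⥤ CochainComplex (GrMod 𝒜) ℤ), S.ShortExact → (S.map F).ShortExact)
    (hF' : ∀ S, ∃ c : ℤ, ∀ {X Y : J ⥤ CochainComplex (GrMod 𝒜) ℤ} (α : X ⟶ Y),
      (∀ T ≠ S, IsZero (X.obj T)) → (∀ T ≠ S, IsZero (Y.obj T)) →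
      Nonempty (Arrow.mk (F.map α) ≅ Arrow.mk ((α.app S)⟦c⟧')))
    (rk : J → ℕ) (hrk : ∀ {S T : J}, (S ⟶ T) → S = T ∨ rk S < rk T)
    (W : MorphismProperty (DerivedCategory (GrMod 𝒜))) [W.RespectsIso]
    (h₀ : ∀ {M N : DerivedCategory (GrMod 𝒜)} (φ : M ⟶ N), IsZero M → IsZero N → W φ)
    (hs : ∀ {M N : DerivedCategory (GrMod 𝒜)} (φ : M ⟶ N) (c : ℤ), W φ → W (φ⟦c⟧'))
    (ht : ∀ {T T' : Triangle (DerivedCategory (GrMod 𝒜))} (φ : T ⟶ T'), T ∈ distTriang _ →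
      T' ∈ distTriang _ → W φ.hom₁ → W φ.hom₃ → W φ.hom₂)
    {X Y : J ⥤ CochainComplex (GrMod 𝒜) ℤ} (α : X ⟶ Y) (hα : ∀ S, W (Q.map (α.app S))) :
    W (Q.map (F.map α)) := by
  classical
  -- Induction on the size of a down-closed set D, by removing an object of maximal rank.
  have key : ∀ (n : ℕ) (D : Finset J) (hD : ∀ {S T : J}, (S ⟶ T) → T ∈ (D : Set J) → S ∈ (D : Set J)),
      D.card = n → W (Q.map (F.map ((trunc (D : Set J) hD).map α))) := by
    intro n
    induction n with
    | zero =>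
      intro D hD hn
      obtain rfl := Finset.card_eq_zero.1 hn
      have hz : ∀ X : J ⥤ CochainComplex (GrMod 𝒜) ℤ,
          IsZero (Q.obj (F.obj ((trunc ((∅ : Finset J) : Set J) hD).obj X))) := fun X =>
        Q.map_isZero (F.map_isZero ((IsZero.iff_id_eq_zero _).2 (NatTrans.ext (funext fun S =>
          (isZero_trunc hD (by simp) X).eq_of_src _ _))))
      exact h₀ _ (hz X) (hz Y)
    | succ n ih =>
      intro D hD hn
      obtain ⟨S, hS, hmax⟩ := D.exists_max_image rk (Finset.card_pos.1 (by omega))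
      -- A nonidentity morphism out of S would lead to an object of larger rank, so D without S is
      -- still down-closed.
      have hD' : ∀ {T U : J}, (T ⟶ U) → U ∈ ((D.erase S : Finset J) : Set J) →
          T ∈ ((D.erase S : Finset J) : Set J) := by
        intro T U f hU
        have hU' := Finset.mem_erase.1 (Finset.mem_coe.1 hU)
        refine Finset.mem_coe.2 (Finset.mem_erase.2 ⟨?_, hD f hU'.2⟩)
        rintro rfl
        rcases hrk f with rfl | hlt
        · exact hU'.1 rfl
        · exact absurd (hmax U hU'.2) (not_le.2 hlt)
      have hle : ((D.erase S : Finset J) : Set J) ⊆ (D : Set J) :=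
        Finset.coe_subset.2 (Finset.erase_subset _ _)
      have hX := hF _ (shortExact_truncKer hD hD' hle X)
      have hY := hF _ (shortExact_truncKer hD hD' hle Y)
      -- The kernel of the truncation map has the single column S, where `hF'` identifies F with a
      -- shift of that column; the quotient is the induction hypothesis.
      refine ht (triangleOfSES.map hX hY (F.mapShortComplex.map (truncKerMap hD hD' hle α)))
        (triangleOfSES_distinguished hX) (triangleOfSES_distinguished hY) ?_
        (ih (D.erase S) hD' (by rw [Finset.card_erase_of_mem hS, hn]; rfl))
      obtain ⟨c, hc⟩ := hF' S
      have hz : ∀ (X : J ⥤ CochainComplex (GrMod 𝒜) ℤ) (T) (_ : T ≠ S),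
          IsZero ((truncKer hD hD' hle X).X₁.obj T) := fun X T hT =>
        isZero_truncKer hD hD' hle (fun h => Finset.mem_coe.2 (Finset.mem_erase.2 ⟨hT, h⟩)) X
      obtain ⟨e⟩ := hc (truncKerMap hD hD' hle α).τ₁ (hz X) (hz Y)
      obtain ⟨e'⟩ := nonempty_arrow_truncKer hD hD' hle hS (fun h => (Finset.mem_erase.1 (Finset.mem_coe.1 h)).1 rfl) α
      have e₂ := Q.mapArrow.mapIso (e ≪≫ (shiftFunctor _ c).mapArrow.mapIso e')
      have e₃ : Arrow.mk (Q.map ((α.app S)⟦c⟧')) ≅ Arrow.mk ((Q.map (α.app S))⟦c⟧') :=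
        Arrow.isoMk ((Q.commShiftIso c).app _) ((Q.commShiftIso c).app _)
          ((Q.commShiftIso c).hom.naturality (α.app S)).symm
      exact (W.arrow_mk_iso_iff (e₂ ≪≫ e₃)).2 (hs _ c (hα S))
  have := Fintype.ofFinite J
  have hu : ∀ {S T : J}, (S ⟶ T) → T ∈ ((Finset.univ : Finset J) : Set J) →
    S ∈ ((Finset.univ : Finset J) : Set J) := fun _ _ => by simp
  have e : trunc (𝒜 := 𝒜) ((Finset.univ : Finset J) : Set J) hu ≅ 𝟭 _ :=
    NatIso.ofComponents (fun X => NatIso.ofComponents (fun S => (truncIso hu (by simp)).app X)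
      (fun {S T} f => by
        ext n : 1
        rfl))
      (fun {X Y} α => by
        ext S : 2
        exact (truncIso hu (by simp)).hom.naturality α)
  have e₁ : Arrow.mk ((trunc _ hu).map α) ≅ Arrow.mk α :=
    Arrow.isoMk (e.app X) (e.app Y) (e.hom.naturality α).symm
  exact (W.arrow_mk_iso_iff ((F ⋙ Q).mapArrow.mapIso e₁)).1 (key _ Finset.univ hu rfl)

end

end GrMod
end

/-! ### Total complexes: exactness, single columns, closure properties -/

noncomputable section
namespace GrMod
variable {A : Type u} [CommRing A] {𝒜 : ℤ → AddSubgroup A} [GradedRing 𝒜]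

/-- Products of short exact sequences of graded modules are short exact. -/
lemma shortExact_pi {ι : Type} {X Y Z : ι → GrMod 𝒜} (φ : ∀ j, X j ⟶ Y j) (ψ : ∀ j, Y j ⟶ Z j)
    (h : ∀ j, ∃ w : φ j ≫ ψ j = 0, (ShortComplex.mk (φ j) (ψ j) w).ShortExact)
    (S : ShortComplex (GrMod 𝒜)) (h₁ : S.X₁ = piObj X) (h₂ : S.X₂ = piObj Y)
    (h₃ : S.X₃ = piObj Z)
    (hf : S.f = eqToHom h₁ ≫ piLift (fun j => piProj X j ≫ φ j) ≫ eqToHom h₂.symm)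
    (hg : S.g = eqToHom h₂ ≫ piLift (fun j => piProj Y j ≫ ψ j) ≫ eqToHom h₃.symm) :
    S.ShortExact := by
  obtain ⟨f, g, w⟩ := S
  -- The terms of `S` are related to the products by equations, so that in the applications, where
  -- they are products by definition, all these hypotheses are `rfl`.
  dsimp only at h₁ h₂ h₃
  subst h₁ h₂ h₃
  simp only [eqToHom_refl, Category.id_comp, Category.comp_id] at hf hg
  subst hf hg
  choose w h using h
  have hm : ∀ j, Mono (φ j) := fun j => (h j).mono_f
  have he : ∀ j, Epi (ψ j) := fun j => (h j).epi_g
  refine @ShortComplex.ShortExact.mk _ _ _ _ ((exact_iff _).2 fun i x hx => ?_) ?_ ?_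
  · have := fun j => (exact_iff _).1 (h j).exact i (x j) (congrFun hx j)
    choose y hy using this
    exact ⟨y, funext hy⟩
  · refine Preadditive.mono_of_cancel_zero _ fun {N} θ hθ => hom_ext fun i x => funext fun j => ?_
    refine injective_of_mono (φ j) i (Eq.trans ?_ (map_zero _).symm)
    exact congrFun (congrArg (fun q => ev q i x) hθ) j
  · refine Preadditive.epi_of_cancel_zero _ fun {N} θ hθ => hom_ext fun i x => ?_
    choose y hy using fun j => surjective_of_epi (ψ j) i (x j)
    refine Eq.trans ?_ (congrArg (fun q => ev q i y) hθ)
    exact congrArg (ev θ i) (funext fun j => (hy j).symm)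

section
variable {J : Type} [SmallCategory J]

lemma shortExact_eval {S : ShortComplex (J ⥤ CochainComplex (GrMod 𝒜) ℤ)} (hS : S.ShortExact)
    (j : J) (q : ℤ) : ∃ w : (S.f.app j).f q ≫ (S.g.app j).f q = 0,
      (ShortComplex.mk ((S.f.app j).f q) ((S.g.app j).f q) w).ShortExact :=
  ⟨congrArg (fun φ : S.X₁ ⟶ S.X₃ => (NatTrans.app φ j).f q) S.zero,
    (hS.map_of_exact ((evaluation J _).obj j)).map_of_exact
      (HomologicalComplex.eval (GrMod 𝒜) (ComplexShape.up ℤ) q)⟩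

end

variable {r : ℕ}

instance : (totFunctor 𝒜 r).PreservesZeroMorphisms where
  map_zero X Y := by
    ext n : 1
    exact totExt fun S hS q hq => rfl

instance : (cotFunctor 𝒜 r).PreservesZeroMorphisms where
  map_zero X Y := by
    ext n : 1
    exact cotExt fun S hS q hq => rfl

lemma shortExact_tot (S : ShortComplex (NSub r ⥤ CochainComplex (GrMod 𝒜) ℤ))
    (hS : S.ShortExact) : (S.map (totFunctor 𝒜 r)).ShortExact :=
  HomologicalComplex.shortExact_of_degreewise_shortExact _ fun n =>
    shortExact_pi (fun p : TotIdx r n => (S.f.app p.1.1).f p.1.2)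
      (fun p : TotIdx r n => (S.g.app p.1.1).f p.1.2) (fun _ => shortExact_eval hS _ _) _
      rfl rfl rfl rfl rfl

lemma shortExact_cot (S : ShortComplex ((NSub r)ᵒᵖ ⥤ CochainComplex (GrMod 𝒜) ℤ))
    (hS : S.ShortExact) : (S.map (cotFunctor 𝒜 r)).ShortExact :=
  HomologicalComplex.shortExact_of_degreewise_shortExact _ fun n =>
    shortExact_pi (fun p : CotIdx r n => (S.f.app (Opposite.op p.1.1)).f p.1.2)
      (fun p : CotIdx r n => (S.g.app (Opposite.op p.1.1)).f p.1.2)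
      (fun _ => shortExact_eval hS _ _) _ rfl rfl rfl rfl rfl

/-- The projection of a total complex to a column, when the other columns vanish. -/
def totCol (X : NSub r ⥤ CochainComplex (GrMod 𝒜) ℤ) (S : NSub r)
    (hX : ∀ T ≠ S, IsZero (X.obj T)) : tot X ⟶ (X.obj S)⟦(1 - S.1.card : ℤ)⟧ where
  f n := totProj X n S.1 S.2 (n + (1 - S.1.card)) (by omega)
  comm' n m (hnm : n + 1 = m) := by
    have e := totD_proj X n m hnm S.1 S.2 (m + (1 - S.1.card)) (n + (1 - S.1.card)) (by omega)
      (by omega)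
    rw [Finset.sum_eq_zero, zero_add] at e
    · refine Eq.trans ?_ ((congrArg (· ≫ totProj X m S.1 S.2 (m + (1 - S.1.card)) (by omega))
        (tot_d X n m hnm)).trans e).symm
      change totProj X n S.1 S.2 (n + (1 - S.1.card)) _ ≫
        ((1 - S.1.card : ℤ).negOnePow • (X.obj S).d _ _) = _
      rw [Units.smul_def, Preadditive.comp_zsmul]
      congr 1
      rw [← Int.coe_negOnePow_natCast]
      -- The shift contributes the sign (-1)^(1 - |S|) and the total differential (-1)^(|S| + 1);
      -- the exponents differ by -2|S|.
      exact congrArg _ ((Int.negOnePow_eq_iff _ _).2 ⟨-S.1.card, by push_cast; ring⟩)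
    · intro i _
      split_ifs with h
      · have h0 := hX ⟨S.1.erase i, h.2⟩ (fun e => Finset.erase_eq_self.1
          (congrArg Subtype.val e) h.1)
        rw [totEnt, h0.eq_of_src (X.map _) 0, HomologicalComplex.zero_f, comp_zero, smul_zero]
      · rfl

lemma isIso_of_pi {ι : Type} {F : ι → GrMod 𝒜} (j : ι) (h : ∀ k ≠ j, IsZero (F k)) :
    IsIso (piProj F j) := by
  classical
  refine isIso_of_bijective _ fun w => ⟨fun x y hxy => funext fun k => ?_, fun x => ?_⟩
  · by_cases hk : k = j
    · subst hk
      exact hxy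
    · exact (isZero_iff.1 (h k hk) w (x k)).trans (isZero_iff.1 (h k hk) w (y k)).symm
  · exact ⟨Pi.single (M := fun k => (F k).X w) j x, 
      by exact Pi.single_eq_same (M := fun k => (F k).X w) j x⟩

lemma isZero_X {K : CochainComplex (GrMod 𝒜) ℤ} (h : IsZero K) (n : ℤ) : IsZero (K.X n) :=
  (HomologicalComplex.eval (GrMod 𝒜) (ComplexShape.up ℤ) n).map_isZero h

lemma isIso_totCol (X : NSub r ⥤ CochainComplex (GrMod 𝒜) ℤ) (S : NSub r)
    (hX : ∀ T ≠ S, IsZero (X.obj T)) : IsIso (totCol X S hX) := by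
  have : ∀ n, IsIso ((totCol X S hX).f n) := fun n => by
    refine isIso_of_pi (F := fun p : TotIdx r n => (X.obj p.1.1).X p.1.2)
      ⟨(S, n + (1 - S.1.card)), by dsimp only; omega⟩ fun k hk => isZero_X (hX _ ?_) _
    rintro rfl
    exact hk (Subtype.ext (Prod.ext rfl (by have := k.2; dsimp only; omega)))
  exact HomologicalComplex.Hom.isIso_of_components _

/-- The projection of a total complex to a column, when the other columns vanish. -/
def cotCol (X : (NSub r)ᵒᵖ ⥤ CochainComplex (GrMod 𝒜) ℤ) (S : (NSub r)ᵒᵖ)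
    (hX : ∀ T ≠ S, IsZero (X.obj T)) : cot X ⟶ (X.obj S)⟦(S.unop.1.card - 1 : ℤ)⟧ where
  f n := cotProj X n S.unop.1 S.unop.2 (n + (S.unop.1.card - 1)) (by omega)
  comm' n m (hnm : n + 1 = m) := by
    have e := cotD_proj X n m hnm S.unop.1 S.unop.2 (m + (S.unop.1.card - 1))
      (n + (S.unop.1.card - 1)) (by omega) (by omega)
    rw [Finset.sum_eq_zero, zero_add] at e
    · refine Eq.trans ?_ ((congrArg (· ≫ cotProj X m S.unop.1 S.unop.2
        (m + (S.unop.1.card - 1)) (by omega)) (cot_d X n m hnm)).trans e).symm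
      change cotProj X n S.unop.1 S.unop.2 (n + (S.unop.1.card - 1)) _ ≫
        ((S.unop.1.card - 1 : ℤ).negOnePow • (X.obj S).d _ _) = _
      rw [Units.smul_def, Preadditive.comp_zsmul]
      congr 1
      rw [← Int.coe_negOnePow_natCast]
      -- Here the exponents |S| - 1 and |S| + 1 differ by -2.
      exact congrArg _ ((Int.negOnePow_eq_iff _ _).2 ⟨-1, by push_cast; ring⟩)
    · intro i _
      by_cases h : i ∉ S.unop.1
      · have h0 := hX (Opposite.op ⟨insert i S.unop.1, Finset.insert_nonempty _ _⟩) (fun e => h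
          (by rw [← congrArg (fun q => q.unop.1) e]; exact Finset.mem_insert_self _ _))
        rw [dif_pos h, cotEnt, h0.eq_of_src (X.map _) 0, HomologicalComplex.zero_f, comp_zero,
          smul_zero]
      · rw [dif_neg h]

lemma isIso_cotCol (X : (NSub r)ᵒᵖ ⥤ CochainComplex (GrMod 𝒜) ℤ) (S : (NSub r)ᵒᵖ)
    (hX : ∀ T ≠ S, IsZero (X.obj T)) : IsIso (cotCol X S hX) := by
  have : ∀ n, IsIso ((cotCol X S hX).f n) := fun n => by
    refine isIso_of_pi (F := fun p : CotIdx r n => (X.obj (Opposite.op p.1.1)).X p.1.2)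
      ⟨(S.unop, n + (S.unop.1.card - 1)), by dsimp only; omega⟩
      fun k hk => isZero_X (hX _ ?_) _
    rintro rfl
    exact hk (Subtype.ext (Prod.ext rfl (by have := k.2; dsimp only; omega)))
  exact HomologicalComplex.Hom.isIso_of_components _

lemma nonempty_arrow_tot {X Y : NSub r ⥤ CochainComplex (GrMod 𝒜) ℤ} (α : X ⟶ Y) (S : NSub r)
    (hX : ∀ T ≠ S, IsZero (X.obj T)) (hY : ∀ T ≠ S, IsZero (Y.obj T)) :
    Nonempty (Arrow.mk ((totFunctor 𝒜 r).map α) ≅ Arrow.mk ((α.app S)⟦(1 - S.1.card : ℤ)⟧')) :=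
  ⟨Arrow.isoMk (@asIso _ _ _ _ _ (isIso_totCol X S hX)) (@asIso _ _ _ _ _ (isIso_totCol Y S hY))
    rfl⟩

lemma nonempty_arrow_cot {X Y : (NSub r)ᵒᵖ ⥤ CochainComplex (GrMod 𝒜) ℤ} (α : X ⟶ Y)
    (S : (NSub r)ᵒᵖ) (hX : ∀ T ≠ S, IsZero (X.obj T)) (hY : ∀ T ≠ S, IsZero (Y.obj T)) :
    Nonempty (Arrow.mk ((cotFunctor 𝒜 r).map α) ≅
      Arrow.mk ((α.app S)⟦(S.unop.1.card - 1 : ℤ)⟧')) :=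
  ⟨Arrow.isoMk (@asIso _ _ _ _ _ (isIso_cotCol X S hX)) (@asIso _ _ _ _ _ (isIso_cotCol Y S hY))
    rfl⟩

lemma eq_or_card_lt {S T : NSub r} (h : S ⟶ T) : S = T ∨ S.1.card < T.1.card := by
  by_cases e : S = T
  · exact Or.inl e
  · exact Or.inr (Finset.card_lt_card (lt_of_le_of_ne (leOfHom h) fun h' => e (Subtype.ext h')))

lemma eq_or_card_lt_op {S T : (NSub r)ᵒᵖ} (h : S ⟶ T) :
    S = T ∨ r - S.unop.1.card < r - T.unop.1.card := by
  rcases eq_or_card_lt h.unop with e | e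
  · exact Or.inl (congrArg Opposite.op e.symm)
  · exact Or.inr (Nat.sub_lt_sub_left (e.trans_le (card_finset_fin_le _)) e)

section
open Pretriangulated DerivedCategory
variable [HasDerivedCategory.{w} (GrMod 𝒜)]
variable (W : MorphismProperty (DerivedCategory (GrMod 𝒜))) [W.RespectsIso]
    (h₀ : ∀ {M N : DerivedCategory (GrMod 𝒜)} (φ : M ⟶ N), IsZero M → IsZero N → W φ)
    (hs : ∀ {M N : DerivedCategory (GrMod 𝒜)} (φ : M ⟶ N) (c : ℤ), W φ → W (φ⟦c⟧'))
    (ht : ∀ {T T' : Triangle (DerivedCategory (GrMod 𝒜))} (φ : T ⟶ T'), T ∈ distTriang _ →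
      T' ∈ distTriang _ → W φ.hom₁ → W φ.hom₃ → W φ.hom₂)
include h₀ hs ht

/-- The induction over columns is run for a property of morphisms so as to serve twice: with
`between P` it shows that a total complex belongs to `P`, and with the morphisms inverted by a
functor Ψ it shows that a map of total complexes is inverted. -/
lemma mem_tot {X Y : NSub r ⥤ CochainComplex (GrMod 𝒜) ℤ} (α : X ⟶ Y)
    (hα : ∀ S, W (Q.map (α.app S))) : W (Q.map ((totFunctor 𝒜 r).map α)) :=
  mem_of_columns _ shortExact_tot (fun S => ⟨_, fun α hX hY => nonempty_arrow_tot α S hX hY⟩)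
    (fun S => S.1.card) eq_or_card_lt W h₀ hs ht α hα

lemma mem_cot {X Y : (NSub r)ᵒᵖ ⥤ CochainComplex (GrMod 𝒜) ℤ} (α : X ⟶ Y)
    (hα : ∀ S, W (Q.map (α.app S))) : W (Q.map ((cotFunctor 𝒜 r).map α)) :=
  mem_of_columns _ shortExact_cot (fun S => ⟨_, fun α hX hY => nonempty_arrow_cot α S hX hY⟩)
    (fun S => r - S.unop.1.card) eq_or_card_lt_op W h₀ hs ht α hα

end

section
open Pretriangulated DerivedCategory
variable [HasDerivedCategory.{w} (GrMod 𝒜)]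
variable (P : ObjectProperty (DerivedCategory (GrMod 𝒜))) [P.IsTriangulated]
  [P.IsClosedUnderIsomorphisms]

/-- The morphisms between objects of `P`. -/
def between : MorphismProperty (DerivedCategory (GrMod 𝒜)) := fun M N _ => P M ∧ P N

instance : (between P).RespectsIso :=
  MorphismProperty.RespectsIso.of_respects_arrow_iso _ fun _ _ e h =>
    ⟨P.prop_of_iso (Arrow.leftFunc.mapIso e) h.1, P.prop_of_iso (Arrow.rightFunc.mapIso e) h.2⟩

omit [P.IsTriangulated] [P.IsClosedUnderIsomorphisms] in
lemma between_shift [P.IsStableUnderShift ℤ] {M N : DerivedCategory (GrMod 𝒜)} (φ : M ⟶ N) (c : ℤ)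
    (h : between P φ) : between P (φ⟦c⟧') :=
  ⟨P.le_shift c _ h.1, P.le_shift c _ h.2⟩

lemma between_triangle {T T' : Triangle (DerivedCategory (GrMod 𝒜))} (φ : T ⟶ T')
    (hT : T ∈ distTriang _) (hT' : T' ∈ distTriang _) (h₁ : between P φ.hom₁)
    (h₃ : between P φ.hom₃) : between P φ.hom₂ :=
  ⟨P.ext_of_isTriangulatedClosed₂ _ hT h₁.1 h₃.1, P.ext_of_isTriangulatedClosed₂ _ hT' h₁.2 h₃.2⟩

/-- The object is encoded by its identity morphism, for which `between P` just means membership in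
`P`. -/
lemma prop_tot (X : NSub r ⥤ CochainComplex (GrMod 𝒜) ℤ) (hX : ∀ S, P (Q.obj (X.obj S))) :
    P (Q.obj ((totFunctor 𝒜 r).obj X)) :=
  (mem_tot (between P) (fun _ h h' => ⟨P.prop_of_isZero h, P.prop_of_isZero h'⟩) (between_shift P)
    (between_triangle P) (𝟙 X) fun S => ⟨hX S, hX S⟩).1

lemma prop_cot (X : (NSub r)ᵒᵖ ⥤ CochainComplex (GrMod 𝒜) ℤ) (hX : ∀ S, P (Q.obj (X.obj S))) :
    P (Q.obj ((cotFunctor 𝒜 r).obj X)) :=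
  (mem_cot (between P) (fun _ h h' => ⟨P.prop_of_isZero h, P.prop_of_isZero h'⟩) (between_shift P)
    (between_triangle P) (𝟙 X) fun S => ⟨hX S, hX S⟩).1

end

section
open Pretriangulated DerivedCategory
variable [HasDerivedCategory.{w} (GrMod 𝒜)]
variable (Ψ : DerivedCategory (GrMod 𝒜) ⥤ DerivedCategory (GrMod 𝒜)) [Ψ.CommShift ℤ]
  [Ψ.IsTriangulated]

omit [Ψ.IsTriangulated] in
lemma isIso_map_shift {M N : DerivedCategory (GrMod 𝒜)} (φ : M ⟶ N) (c : ℤ)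
    (h : IsIso (Ψ.map φ)) : IsIso (Ψ.map (φ⟦c⟧')) :=
  (NatIso.isIso_map_iff (Ψ.commShiftIso c) φ).2 (Functor.map_isIso (shiftFunctor _ c) (Ψ.map φ))

lemma isIso_map_triangle {T T' : Triangle (DerivedCategory (GrMod 𝒜))} (φ : T ⟶ T')
    (hT : T ∈ distTriang _) (hT' : T' ∈ distTriang _) (h₁ : IsIso (Ψ.map φ.hom₁))
    (h₃ : IsIso (Ψ.map φ.hom₃)) : IsIso (Ψ.map φ.hom₂) :=
  isIso₂_of_isIso₁₃ (Ψ.mapTriangle.map φ) (Ψ.map_distinguished _ hT) (Ψ.map_distinguished _ hT')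
    h₁ h₃

omit [Ψ.CommShift ℤ] [Ψ.IsTriangulated] in
lemma isIso_map_zero {M N : DerivedCategory (GrMod 𝒜)} (φ : M ⟶ N) (h : IsZero M)
    (h' : IsZero N) : IsIso (Ψ.map φ) :=
  have : IsIso φ := ⟨0, h.eq_of_src _ _, h'.eq_of_src _ _⟩
  inferInstance

/-- The morphisms inverted by a triangulated functor are stable under shifts and, by the five lemma,
under extensions. -/
lemma isIso_tot {X Y : NSub r ⥤ CochainComplex (GrMod 𝒜) ℤ} (α : X ⟶ Y)
    (hα : ∀ S, IsIso (Ψ.map (Q.map (α.app S)))) :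
    IsIso (Ψ.map (Q.map ((totFunctor 𝒜 r).map α))) :=
  mem_tot ((MorphismProperty.isomorphisms _).inverseImage Ψ) (isIso_map_zero Ψ)
    (isIso_map_shift Ψ) (isIso_map_triangle Ψ) α hα

lemma isIso_cot {X Y : (NSub r)ᵒᵖ ⥤ CochainComplex (GrMod 𝒜) ℤ} (α : X ⟶ Y)
    (hα : ∀ S, IsIso (Ψ.map (Q.map (α.app S)))) :
    IsIso (Ψ.map (Q.map ((cotFunctor 𝒜 r).map α))) :=
  mem_cot ((MorphismProperty.isomorphisms _).inverseImage Ψ) (isIso_map_zero Ψ)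
    (isIso_map_shift Ψ) (isIso_map_triangle Ψ) α hα

end

end GrMod
end

/-! ### Contraction of total complexes whose columns depend only on S ∪ {i} -/

noncomputable section
namespace GrMod
variable {A : Type u} [CommRing A] {𝒜 : ℤ → AddSubgroup A} [GradedRing 𝒜]

/-- A split contraction makes both of its maps quasi-isomorphisms. -/
lemma quasiIso_of_contraction {K L : CochainComplex (GrMod 𝒜) ℤ} (a : K ⟶ L) (b : L ⟶ K)
    (hab : a ≫ b = 𝟙 K) (s : ∀ n m : ℤ, n + 1 = m → (L.X m ⟶ L.X n))
    (hs : ∀ (l n m : ℤ) (h : l + 1 = n) (h' : n + 1 = m),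
      s l n h ≫ L.d l n + L.d n m ≫ s n m h' + b.f n ≫ a.f n = 𝟙 _) :
    QuasiIso a ∧ QuasiIso b := by
  have ha : QuasiIso a := by
    refine (quasiIso_iff a).2 fun p q r hp hq i x y hx hy => ?_
    have hb : ∀ n x, ev (b.f n) i (ev (a.f n) i x) = x := fun n x =>
      congrArg (fun φ : K ⟶ K => ev (φ.f n) i x) hab
    -- The element y - a(b(y)) is killed by the differential and by b, so on it the homotopy
    -- identity says that s gives a preimage under the differential.
    refine ⟨ev (b.f q) i y, ev (s p q hp) i (y - ev (a.f q) i (ev (b.f q) i y)), ?_, ?_⟩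
    · exact (congrArg (fun φ => ev φ i y) (b.comm q r)).trans
        ((congrArg (ev (b.f r) i) hy.symm).trans (hb r x))
    · have h := congrArg (fun φ => ev φ i (y - ev (a.f q) i (ev (b.f q) i y))) (hs p q r hp hq)
      change ev (L.d p q) i (ev (s p q hp) i _) + ev (s q r hq) i (ev (L.d q r) i _) +
        ev (a.f q) i (ev (b.f q) i _) = _ at h
      have h1 : ev (L.d q r) i (y - ev (a.f q) i (ev (b.f q) i y)) = 0 := by
        have e : ev (L.d q r) i (ev (a.f q) i (ev (b.f q) i y)) = ev (a.f r) i (ev (K.d q r) i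
          (ev (b.f q) i y)) := congrArg (fun φ => ev φ i (ev (b.f q) i y)) (a.comm q r)
        have e' : ev (K.d q r) i (ev (b.f q) i y) = x :=
          (congrArg (fun φ => ev φ i y) (b.comm q r)).trans
            ((congrArg (ev (b.f r) i) hy.symm).trans (hb r x))
        rw [map_sub, e, e', hy, sub_self]
      have h2 : ev (b.f q) i (y - ev (a.f q) i (ev (b.f q) i y)) = 0 := by
        rw [map_sub, hb, sub_self]
      rw [h1, h2, map_zero, map_zero, add_zero, add_zero] at h
      rw [h]
      exact add_sub_cancel _ _
  refine ⟨ha, ?_⟩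
  have : QuasiIso (a ≫ b) := by rw [hab]; infer_instance
  exact quasiIso_of_comp_left a b

variable {r : ℕ}

/-- The functor `S ↦ S ∪ {i}`. -/
def insI (i : Fin r) : NSub r ⥤ NSub r where
  obj S := ⟨insert i S.1, Finset.insert_nonempty _ _⟩
  map h := homOfLE (Finset.insert_subset_insert i (leOfHom h))

/-- The inclusion of `S` in `S ∪ {i}`. -/
def toInsI (i : Fin r) : 𝟭 _ ⟶ insI i where
  app S := homOfLE (Finset.subset_insert i S.1)

lemma sgn_mul_self (i : Fin r) (S : Finset (Fin r)) : sgn i S * sgn i S = 1 := by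
  rw [sgn, ← pow_add, ← two_mul, pow_mul]
  simp

lemma sgn_cancel {i j : Fin r} {S : Finset (Fin r)} (hi : i ∈ S) (hj : j ∈ S) (h : i ≠ j) :
    sgn i (S.erase j) * sgn j S + sgn j (S.erase i) * sgn i S = 0 := by
  have e := sgn_erase hi hj h
  linear_combination e

section
variable {Y : NSub r ⥤ CochainComplex (GrMod 𝒜) ℤ} {i : Fin r}
  (ρ : ∀ S T : NSub r, T.1 ⊆ insert i S.1 → (Y.obj T ⟶ Y.obj S))

/-- The component `Y_T → Y_S` on the total complex, for `T ⊆ S ∪ {i}`. -/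
def insEnt (n : ℤ) (T : Finset (Fin r)) (S : NSub r) (q : ℤ) : totX Y n ⟶ (Y.obj S).X q :=
  if h : T.Nonempty ∧ T ⊆ insert i S.1 ∧ q + T.card = n + 1 then
    totProj Y n T h.1 q h.2.2 ≫ (ρ S ⟨T, h.1⟩ h.2.1).f q
  else 0

lemma insEnt_eq (n : ℤ) (T : Finset (Fin r)) (S : NSub r) (q : ℤ) (hT : T.Nonempty)
    (h : T ⊆ insert i S.1) (hq : q + T.card = n + 1) :
    insEnt ρ n T S q = totProj Y n T hT q hq ≫ (ρ S ⟨T, hT⟩ h).f q :=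
  dif_pos ⟨hT, h, hq⟩

variable (hρ : ∀ (S T U : NSub r) (h : T.1 ⊆ insert i S.1) (h' : U.1 ⊆ insert i T.1)
    (h'' : U.1 ⊆ insert i S.1), ρ T U h' ≫ ρ S T h = ρ S U h'')
  (hY : ∀ {S T : NSub r} (h : T ⟶ S),
    Y.map h = ρ S T (Finset.Subset.trans (leOfHom h) (Finset.subset_insert _ _)))

include hY in
lemma insEnt_self (n : ℤ) (S : NSub r) (q : ℤ)
    (hq : q + S.1.card = n + 1) : insEnt ρ n S.1 S q = totProj Y n S.1 S.2 q hq := by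
  rw [insEnt_eq ρ n S.1 S q S.2 (Finset.subset_insert _ _) hq, ← hY (𝟙 S), Y.map_id]
  exact Category.comp_id _

include hρ hY in
-- `ρ` extends the functoriality of `Y` from T ⊆ S to T ⊆ S ∪ {i}, and `hρ` lets the maps of the
-- differential be composed with it. Since `insEnt` is zero for an empty index, the sum runs over
-- all of T without side conditions.
lemma totD_insEnt (n m : ℤ) (hnm : n + 1 = m) (T : Finset (Fin r)) (S : NSub r) (hT : T.Nonempty)
    (h : T ⊆ insert i S.1) (q q' : ℤ) (hq' : q' + 1 = q) (hq : q + T.card = m + 1) :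
    totD Y n m hnm ≫ insEnt ρ m T S q =
      ∑ j ∈ T, sgn j T • insEnt ρ n (T.erase j) S q +
        (-1 : ℤ) ^ (T.card + 1) • insEnt ρ n T S q' ≫ (Y.obj S).d q' q := by
  rw [insEnt_eq ρ m T S q hT h hq, ← Category.assoc, totD_proj _ n m hnm T hT q q' hq' hq,
    Preadditive.add_comp, Preadditive.sum_comp, Preadditive.zsmul_comp]
  congr 1
  · rw [← Finset.sum_subset (Finset.subset_univ T)]
    · refine Finset.sum_congr rfl fun j hj => ?_
      have hc := Finset.card_erase_add_one hj
      by_cases hne : (T.erase j).Nonempty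
      · rw [dif_pos ⟨hj, hne⟩, Preadditive.zsmul_comp, totEnt, Category.assoc,
          insEnt_eq ρ n _ S q hne ((Finset.erase_subset _ _).trans h) (by omega),
          ← HomologicalComplex.comp_f, hY, hρ]
      · rw [dif_neg fun h => hne h.2, zero_comp, insEnt, dif_neg fun h => hne h.1, smul_zero]
    · intro j _ hj
      rw [dif_neg fun h => hj h.1, zero_comp]
  · rw [insEnt_eq ρ n T S q' hT h (by omega), Category.assoc, Category.assoc,
      HomologicalComplex.Hom.comm]

/-- The contracting homotopy of the total complex. -/
def insH (n m : ℤ) : totX Y m ⟶ totX Y n :=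
  totLift fun S hS q _ => if i ∉ S then sgn i S • insEnt ρ m (insert i S) ⟨S, hS⟩ q else 0

include hρ in
-- Nonemptiness of T has to be kept: for empty T the left side is zero by convention, while the
-- entry at {i} need not vanish. This is what produces the augmentation term in the homotopy
-- identity.
lemma insH_ent (n m : ℤ) (hnm : n + 1 = m) (T : Finset (Fin r)) (S : NSub r) (q : ℤ) :
    insH ρ n m ≫ insEnt ρ n T S q =
      if i ∉ T ∧ T.Nonempty then sgn i T • insEnt ρ m (insert i T) S q else 0 := by
  by_cases h : T.Nonempty ∧ T ⊆ insert i S.1 ∧ q + T.card = n + 1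
  · rw [insEnt_eq ρ n T S q h.1 h.2.1 h.2.2, ← Category.assoc, insH, totLift_proj]
    by_cases hi : i ∉ T
    · have hc := Finset.card_insert_of_notMem hi
      have h1 : insert i T ⊆ insert i S.1 :=
        Finset.insert_subset (Finset.mem_insert_self _ _) h.2.1
      rw [if_pos hi, if_pos ⟨hi, h.1⟩, Preadditive.zsmul_comp,
        insEnt_eq ρ m _ S q (Finset.insert_nonempty _ _) h1 (by omega),
        insEnt_eq ρ m _ ⟨T, h.1⟩ q (Finset.insert_nonempty _ _) (Finset.Subset.refl _)
          (by dsimp only; omega), Category.assoc, ← HomologicalComplex.comp_f, hρ]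
    · rw [if_neg hi, if_neg fun h => hi h.1, zero_comp]
  · rw [insEnt, dif_neg h, comp_zero]
    split_ifs with h'
    · have hc := Finset.card_insert_of_notMem h'.1
      rw [insEnt, dif_neg, smul_zero]
      rintro ⟨-, h2, h3⟩
      exact h ⟨h'.2, (Finset.subset_insert _ _).trans h2, by omega⟩
    · rfl

include hρ hY in
/-- If `Y_S → Y_{S ∪ {i}}` is invertible for all `S`, then the total complex is `Y_{i}`. -/
lemma quasiIso_insAug (κ : ∀ S, Y.obj ⟨{i}, Finset.singleton_nonempty i⟩ ⟶ Y.obj S)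
    (hκ : ∀ {S T : NSub r} (h : S ⟶ T), κ S ≫ Y.map h = κ T)
    (hκ' : ∀ S, κ S = ρ S ⟨{i}, Finset.singleton_nonempty i⟩ (by simp)) :
    QuasiIso (totAug κ hκ) := by
  let I : NSub r := ⟨{i}, Finset.singleton_nonempty i⟩
  -- The projection to the column of {i} is a map of complexes, because no smaller nonempty set maps
  -- into that column.
  let b : tot Y ⟶ Y.obj I :=
    { f := fun n => totProj Y n I.1 I.2 n (by simp [I])
      comm' := fun n m (hnm : n + 1 = m) => by
        rw [tot_d _ n m hnm]
        change totProj Y n I.1 I.2 n _ ≫ (Y.obj I).d n m = totD Y n m hnm ≫ totProj Y m I.1 I.2 m _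
        rw [← insEnt_self ρ hY m I m, ← insEnt_self ρ hY n I n,
          totD_insEnt ρ hρ hY n m hnm I.1 I I.2 (Finset.subset_insert _ _) m n hnm (by simp [I]),
          Finset.sum_singleton, show insEnt ρ n (I.1.erase i) I m = 0 from dif_neg (by simp [I]),
          smul_zero, zero_add, show (-1 : ℤ) ^ (I.1.card + 1) = 1 by simp [I], one_smul] }
  refine (quasiIso_of_contraction (totAug κ hκ) b ?_ (fun n m _ => insH ρ n m) ?_).1
  · ext n : 1
    refine (totAugF_proj κ n {i} I.2 (by simp) (by simp)).trans ?_
    rw [hκ', ← hY (𝟙 I), Y.map_id]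
  · intro l n m hl hm
    rw [tot_d _ l n hl, tot_d _ n m hm]
    refine totExt fun S hS q hq => ?_
    have hc := hS.card_pos
    change (insH ρ l n ≫ totD Y l n hl + totD Y n m hm ≫ insH ρ n m +
      totProj Y n I.1 I.2 n (by simp [I]) ≫ totAugF κ n) ≫ totProj Y n S hS q hq =
        𝟙 (totX Y n) ≫ totProj Y n S hS q hq
    rw [Preadditive.add_comp, Preadditive.add_comp, Category.id_comp]
    have e3 : (totProj Y n I.1 I.2 n (by simp [I]) ≫ totAugF κ n) ≫ totProj Y n S hS q hq =
        if S.card = 1 then insEnt ρ n {i} ⟨S, hS⟩ q else 0 := by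
      rw [Category.assoc]
      split_ifs with h1
      · obtain rfl : q = n := by rw [h1] at hq; push_cast at hq; omega
        rw [totAugF_proj κ q S hS h1, hκ', insEnt_eq ρ q _ _ q I.2 (by simp [I]) (by simp [I])]
      · rw [totAugF_proj_zero κ n S hS h1, comp_zero]
    have e1 : (insH ρ l n ≫ totD Y l n hl) ≫ totProj Y n S hS q hq =
        ∑ j ∈ S, sgn j S • (if i ∉ S.erase j ∧ (S.erase j).Nonempty then
          sgn i (S.erase j) • insEnt ρ n (insert i (S.erase j)) ⟨S, hS⟩ q else 0) +
        (-1 : ℤ) ^ (S.card + 1) • (if i ∉ S then sgn i S • insEnt ρ n (insert i S) ⟨S, hS⟩ (q - 1)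
          else 0) ≫ (Y.obj ⟨S, hS⟩).d (q - 1) q := by
      rw [← insEnt_self ρ hY n ⟨S, hS⟩ q hq, Category.assoc, totD_insEnt ρ hρ hY l n hl S _ hS
        (Finset.subset_insert _ _) q (q - 1) (by omega) hq, Preadditive.comp_add,
        Preadditive.comp_sum, Preadditive.comp_zsmul, ← Category.assoc, insH_ent ρ hρ l n hl]
      simp only [Preadditive.comp_zsmul, insH_ent ρ hρ l n hl, hS, and_true]
    have e2 : (totD Y n m hm ≫ insH ρ n m) ≫ totProj Y n S hS q hq =
        if i ∉ S then sgn i S • (∑ j ∈ insert i S, sgn j (insert i S) •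
          insEnt ρ n ((insert i S).erase j) ⟨S, hS⟩ q + (-1 : ℤ) ^ (S.card + 2) •
            insEnt ρ n (insert i S) ⟨S, hS⟩ (q - 1) ≫ (Y.obj ⟨S, hS⟩).d (q - 1) q) else 0 := by
      rw [Category.assoc, insH, totLift_proj]
      split_ifs with hi
      · rw [comp_zero]
      · have hc := Finset.card_insert_of_notMem hi
        rw [Preadditive.comp_zsmul, totD_insEnt ρ hρ hY n m hm (insert i S) _
          (Finset.insert_nonempty _ _) (Finset.Subset.refl _) q (q - 1) (by omega) (by omega), hc]
    rw [e1, e2, e3, ← insEnt_self ρ hY n ⟨S, hS⟩ q hq]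
    -- For i ∈ S only the term that removes i and puts it back survives. It is missing for S = {i},
    -- where the augmentation supplies it.
    by_cases hi : i ∈ S
    · have hs : ∀ j ∈ S, j ≠ i → ¬(i ∉ S.erase j ∧ (S.erase j).Nonempty) := fun j _ hij h =>
        h.1 (Finset.mem_erase.2 ⟨hij.symm, hi⟩)
      rw [if_neg (not_not.2 hi), if_neg (not_not.2 hi), zero_comp, smul_zero, add_zero, add_zero,
        Finset.sum_eq_single i (fun j hj hij => by rw [if_neg (hs j hj hij), smul_zero])
          (fun h => (h hi).elim), Finset.insert_erase hi]
      have hce := Finset.card_erase_add_one hi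
      by_cases h1 : S.card = 1
      · rw [if_neg (fun h => by have := h.2.card_pos; omega), if_pos h1, smul_zero, zero_add]
        obtain ⟨k, rfl⟩ := Finset.card_eq_one.1 h1
        obtain rfl := Finset.mem_singleton.1 hi
        rfl
      · rw [if_pos ⟨Finset.notMem_erase _ _, Finset.card_pos.1 (by omega)⟩, if_neg h1, add_zero,
          smul_smul]
        have := sgn_insert i (S.erase i)
        rw [Finset.insert_erase hi] at this
        rw [← this, sgn_mul_self, one_smul]
    -- For i ∉ S, adding i and removing it again gives the identity; the remaining terms cancel in
    -- pairs, as do the terms with the differential of the column.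
    · have hS' := sgn_insert i S
      have hs : ∀ j ∈ S, sgn i S * sgn j (insert i S) = -(sgn j S * sgn i (S.erase j)) := by
        intro j hj
        have hij : i ≠ j := fun e => hi (e ▸ hj)
        have h := sgn_cancel (Finset.mem_insert_self i S) (Finset.mem_insert_of_mem hj) hij
        rw [Finset.erase_insert hi, Finset.erase_insert_of_ne hij, sgn_insert, sgn_insert] at h
        linear_combination sgn j S * sgn j (insert i S) * h -
          sgn j S * sgn i (S.erase j) * sgn_mul_self j (insert i S) -
          sgn i S * sgn j (insert i S) * sgn_mul_self j S
      rw [if_pos hi, if_pos hi, Finset.sum_insert hi, Finset.erase_insert hi, hS', smul_add,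
        smul_add, smul_smul, sgn_mul_self, one_smul, Preadditive.zsmul_comp, smul_smul, smul_smul,
        Finset.smul_sum]
      have hd : (-1 : ℤ) ^ (S.card + 1) * sgn i S + sgn i S * (-1 : ℤ) ^ (S.card + 2) = 0 := by
        ring
      have hD := congrArg (· • (insEnt ρ n (insert i S) ⟨S, hS⟩ (q - 1) ≫
        (Y.obj ⟨S, hS⟩).d (q - 1) q)) hd
      rw [add_smul, zero_smul] at hD
      have hT : ∑ j ∈ S, sgn j S • (if i ∉ S.erase j ∧ (S.erase j).Nonempty then
          sgn i (S.erase j) • insEnt ρ n (insert i (S.erase j)) ⟨S, hS⟩ q else 0) +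
          ∑ j ∈ S, sgn i S • sgn j (insert i S) • insEnt ρ n ((insert i S).erase j) ⟨S, hS⟩ q +
          (if S.card = 1 then insEnt ρ n {i} ⟨S, hS⟩ q else 0) = 0 := by
        -- For S = {k}, removing k leaves the empty set, so one of the two sums loses its only term;
        -- the augmentation at {i} takes its place with the right sign.
        by_cases h1 : S.card = 1
        · obtain ⟨k, rfl⟩ := Finset.card_eq_one.1 h1
          have hik : i ≠ k := fun e => hi (e ▸ Finset.mem_singleton_self k)
          have h := hs k (Finset.mem_singleton_self k)
          rw [Finset.sum_singleton, Finset.sum_singleton, if_neg (by simp), if_pos h1, smul_zero,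
            zero_add, smul_smul, h, Finset.erase_insert_of_ne hik, sgn_singleton,
            Finset.erase_singleton, show sgn i ∅ = 1 by simp [sgn], insert_empty_eq]
          simp
        · rw [if_neg h1, add_zero, ← Finset.sum_add_distrib]
          refine Finset.sum_eq_zero fun j hj => ?_
          have hij : i ≠ j := fun e => hi (e ▸ hj)
          have := Finset.card_erase_add_one hj
          rw [if_pos ⟨fun h => hi (Finset.mem_of_mem_erase h), Finset.card_pos.1 (by omega)⟩,
            smul_smul, smul_smul, hs j hj, Finset.erase_insert_of_ne hij, neg_smul,
            add_neg_cancel]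
      linear_combination (norm := module) hT + hD

end

section
variable {Y : (NSub r)ᵒᵖ ⥤ CochainComplex (GrMod 𝒜) ℤ} {i : Fin r}
  (ρ : ∀ S T : NSub r, S.1 ⊆ insert i T.1 → (Y.obj (Opposite.op T) ⟶ Y.obj (Opposite.op S)))

/-- The component `Y_T → Y_S` on the total complex, for `S ⊆ T ∪ {i}`. -/
def delEnt (n : ℤ) (T : Finset (Fin r)) (S : NSub r) (q : ℤ) :
    cotX Y n ⟶ (Y.obj (Opposite.op S)).X q :=
  if h : T.Nonempty ∧ S.1 ⊆ insert i T ∧ q + 1 = n + T.card then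
    cotProj Y n T h.1 q h.2.2 ≫ (ρ S ⟨T, h.1⟩ h.2.1).f q
  else 0

lemma delEnt_eq (n : ℤ) (T : Finset (Fin r)) (S : NSub r) (q : ℤ) (hT : T.Nonempty)
    (h : S.1 ⊆ insert i T) (hq : q + 1 = n + T.card) :
    delEnt ρ n T S q = cotProj Y n T hT q hq ≫ (ρ S ⟨T, hT⟩ h).f q :=
  dif_pos ⟨hT, h, hq⟩

lemma delEnt_empty (n : ℤ) (S : NSub r) (q : ℤ) : delEnt ρ n ∅ S q = 0 :=
  dif_neg fun h => Finset.not_nonempty_empty h.1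

variable (hρ : ∀ (S T U : NSub r) (h : S.1 ⊆ insert i T.1) (h' : T.1 ⊆ insert i U.1)
    (h'' : S.1 ⊆ insert i U.1), ρ T U h' ≫ ρ S T h = ρ S U h'')
  (hY : ∀ {S T : NSub r} (h : S ⟶ T),
    Y.map h.op = ρ S T (Finset.Subset.trans (leOfHom h) (Finset.subset_insert _ _)))

include hY in
lemma delEnt_self (n : ℤ) (S : NSub r) (q : ℤ)
    (hq : q + 1 = n + S.1.card) : delEnt ρ n S.1 S q = cotProj Y n S.1 S.2 q hq := by
  rw [delEnt_eq ρ n S.1 S q S.2 (Finset.subset_insert _ _) hq, ← hY (𝟙 S), op_id, Y.map_id]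
  exact Category.comp_id _

include hρ hY in
-- The contravariant version of `totD_insEnt`: elements are now added to T, so the sum runs over the
-- complement.
lemma cotD_delEnt (n m : ℤ) (hnm : n + 1 = m) (T : Finset (Fin r)) (S : NSub r) (hT : T.Nonempty)
    (h : S.1 ⊆ insert i T) (q q' : ℤ) (hq' : q' + 1 = q) (hq : q + 1 = m + T.card) :
    cotD Y n m hnm ≫ delEnt ρ m T S q =
      ∑ j ∈ Tᶜ, sgn j (insert j T) • delEnt ρ n (insert j T) S q +
        (-1 : ℤ) ^ (T.card + 1) • delEnt ρ n T S q' ≫ (Y.obj (Opposite.op S)).d q' q := by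
  rw [delEnt_eq ρ m T S q hT h hq, ← Category.assoc, cotD_proj _ n m hnm T hT q q' hq' hq,
    Preadditive.add_comp, Preadditive.sum_comp, Preadditive.zsmul_comp]
  congr 1
  · rw [← Finset.sum_subset (Finset.subset_univ Tᶜ)]
    · refine Finset.sum_congr rfl fun j hj => ?_
      have hj' := Finset.mem_compl.1 hj
      have hc := Finset.card_insert_of_notMem hj'
      rw [dif_pos hj', Preadditive.zsmul_comp, cotEnt, Category.assoc,
        delEnt_eq ρ n _ S q (Finset.insert_nonempty _ _)
          (h.trans (Finset.insert_subset_insert _ (Finset.subset_insert _ _))) (by omega),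
        ← HomologicalComplex.comp_f, hY, hρ]
    · intro j _ hj
      rw [dif_neg fun h => hj (Finset.mem_compl.2 h), zero_comp]
  · rw [delEnt_eq ρ n T S q' hT h (by omega), Category.assoc, Category.assoc,
      HomologicalComplex.Hom.comm]

/-- The contracting homotopy of the total complex. -/
def delH (n m : ℤ) : cotX Y m ⟶ cotX Y n :=
  cotLift fun S hS q _ => if i ∈ S then sgn i S • delEnt ρ m (S.erase i) ⟨S, hS⟩ q else 0

include hρ in
lemma delH_ent (n m : ℤ) (hnm : n + 1 = m) (T : Finset (Fin r)) (S : NSub r) (q : ℤ) :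
    delH ρ n m ≫ delEnt ρ n T S q =
      if i ∈ T then sgn i T • delEnt ρ m (T.erase i) S q else 0 := by
  by_cases h : T.Nonempty ∧ S.1 ⊆ insert i T ∧ q + 1 = n + T.card
  · rw [delEnt_eq ρ n T S q h.1 h.2.1 h.2.2, ← Category.assoc, delH, cotLift_proj]
    by_cases hi : i ∈ T
    · have hc := Finset.card_erase_add_one hi
      rw [if_pos hi, if_pos hi, Preadditive.zsmul_comp]
      by_cases hne : (T.erase i).Nonempty
      · have h1 : S.1 ⊆ insert i (T.erase i) := by
          rw [Finset.insert_erase hi]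
          exact h.2.1.trans (Finset.insert_subset hi (Finset.Subset.refl _))
        rw [delEnt_eq ρ m _ S q hne h1 (by omega), delEnt_eq ρ m _ ⟨T, h.1⟩ q hne
          (Finset.insert_erase hi).ge (by omega), Category.assoc, ← HomologicalComplex.comp_f, hρ]
      · rw [Finset.not_nonempty_iff_eq_empty.1 hne, delEnt_empty, delEnt_empty, zero_comp]
    · rw [if_neg hi, if_neg hi, zero_comp]
  · rw [delEnt, dif_neg h, comp_zero]
    split_ifs with h'
    · have hc := Finset.card_erase_add_one h'
      rw [delEnt, dif_neg, smul_zero]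
      rintro ⟨-, h2, h3⟩
      exact h ⟨⟨i, h'⟩, h2.trans (Finset.insert_subset_insert _ (Finset.erase_subset _ _)),
        by omega⟩
    · rfl

/-- The inclusion of the column of `{i}`. -/
def delColF (n : ℤ) : (Y.obj (Opposite.op ⟨{i}, Finset.singleton_nonempty i⟩)).X n ⟶ cotX Y n :=
  cotLift fun S hS q hq => if h : S = {i} then
    (HomologicalComplex.XIsoOfEq _ (show n = q by subst h; simp at hq; omega)).hom ≫
      (ρ ⟨S, hS⟩ ⟨{i}, Finset.singleton_nonempty i⟩ (by subst h; simp)).f q else 0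

lemma delColF_proj_ne (n : ℤ) (S : Finset (Fin r)) (hS : S.Nonempty) (q : ℤ)
    (hq : q + 1 = n + S.card) (h : S ≠ {i}) : delColF ρ n ≫ cotProj Y n S hS q hq = 0 := by
  rw [delColF, cotLift_proj, dif_neg h]

include hY in
lemma delColF_proj (n : ℤ) (hS : ({i} : Finset (Fin r)).Nonempty)
    (hq : n + 1 = n + ({i} : Finset (Fin r)).card) : delColF ρ n ≫ cotProj Y n {i} hS n hq = 𝟙 _ := by
  rw [delColF, cotLift_proj, dif_pos rfl, ← hY (𝟙 _), op_id, Y.map_id,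
    HomologicalComplex.XIsoOfEq_rfl]
  exact Category.comp_id _

include hρ hY in
/-- If `Y_{S ∪ {i}} → Y_S` is invertible for all `S`, then the total complex is `Y_{i}`. -/
lemma quasiIso_delAug
    (κ : ∀ S, Y.obj S ⟶ Y.obj (Opposite.op ⟨{i}, Finset.singleton_nonempty i⟩))
    (hκ : ∀ {S T : (NSub r)ᵒᵖ} (h : S ⟶ T), Y.map h ≫ κ T = κ S)
    (hκ' : ∀ S, κ S = ρ ⟨{i}, Finset.singleton_nonempty i⟩ S.unop (by simp)) :
    QuasiIso (cotAug κ hκ) := by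
  let I : NSub r := ⟨{i}, Finset.singleton_nonempty i⟩
  have hA : ∀ n, cotAugF κ n = ∑ j : Fin r, delEnt ρ n {j} I n := fun n => by
    unfold cotAugF
    refine Finset.sum_congr rfl fun j _ => ?_
    rw [hκ', delEnt_eq ρ n {j} I n (Finset.singleton_nonempty j) (by simp [I]) (by simp)]
  -- The differential lowers S, and no nonempty set lies strictly below {i}; so here the column of
  -- {i} is a subcomplex, and it is included rather than projected to.
  let a : Y.obj (Opposite.op I) ⟶ cot Y :=
    { f := fun n => delColF ρ n
      comm' := fun n m (hnm : n + 1 = m) => by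
        rw [cot_d _ n m hnm]
        change delColF ρ n ≫ cotD Y n m hnm = (Y.obj (Opposite.op I)).d n m ≫ delColF ρ m
        refine cotExt fun S hS q hq => ?_
        rw [Category.assoc, Category.assoc, cotD_proj Y n m hnm S hS q (q - 1) (by omega) hq,
          Preadditive.comp_add, Preadditive.comp_zsmul, Preadditive.comp_sum,
          Finset.sum_eq_zero, zero_add]
        · by_cases h : S = {i}
          · subst h
            obtain rfl : q = m := by simp at hq; omega
            obtain rfl : n = q - 1 := by omega
            rw [delColF_proj ρ hY, ← Category.assoc, delColF_proj ρ hY]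
            refine (congrArg (· • _) (by simp)).trans ((one_smul ℤ _).trans ?_)
            rw [Category.id_comp, Category.comp_id]
          · rw [delColF_proj_ne ρ _ _ _ _ _ h, ← Category.assoc, delColF_proj_ne ρ _ _ _ _ _ h,
              zero_comp, comp_zero, smul_zero]
        · intro j _
          split_ifs with h
          · rw [comp_zero]
          · have hc := Finset.card_insert_of_notMem h
            have hc' := hS.card_pos
            rw [Preadditive.comp_zsmul, cotEnt, ← Category.assoc, delColF_proj_ne, zero_comp,
              smul_zero]
            intro e
            have := congrArg Finset.card e
            rw [Finset.card_singleton] at this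
            omega }
  refine (quasiIso_of_contraction a (cotAug κ hκ) ?_ (fun n m _ => delH ρ n m) ?_).2
  · ext n : 1
    change delColF ρ n ≫ cotAugF κ n = 𝟙 _
    rw [cotAugF, Preadditive.comp_sum, Finset.sum_eq_single i, ← Category.assoc,
      delColF_proj ρ hY, Category.id_comp, hκ']
    · exact (congrArg (fun φ => HomologicalComplex.Hom.f φ n) ((hY (𝟙 I)).symm.trans
        (Y.map_id _)))
    · intro j _ hj
      rw [← Category.assoc, delColF_proj_ne ρ _ _ _ _ _ (by simpa using hj), zero_comp]
    · exact fun h => (h (Finset.mem_univ i)).elim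
  · intro l n m hl hm
    rw [cot_d _ l n hl, cot_d _ n m hm]
    refine cotExt fun S hS q hq => ?_
    have hc := hS.card_pos
    change (delH ρ l n ≫ cotD Y l n hl + cotD Y n m hm ≫ delH ρ n m +
      cotAugF κ n ≫ delColF ρ n) ≫ cotProj Y n S hS q hq = 𝟙 (cotX Y n) ≫ cotProj Y n S hS q hq
    rw [Preadditive.add_comp, Preadditive.add_comp, Category.id_comp]
    have e3 : (cotAugF κ n ≫ delColF ρ n) ≫ cotProj Y n S hS q hq =
        if S = {i} then ∑ j : Fin r, delEnt ρ n {j} ⟨S, hS⟩ q else 0 := by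
      rw [Category.assoc]
      split_ifs with h1
      · subst h1
        obtain rfl : q = n := by simp at hq; omega
        rw [delColF_proj ρ hY, Category.comp_id, hA]
      · rw [delColF_proj_ne ρ _ _ _ _ _ h1, comp_zero]
    have e1 : (delH ρ l n ≫ cotD Y l n hl) ≫ cotProj Y n S hS q hq =
        ∑ j ∈ Sᶜ, sgn j (insert j S) • (if i ∈ insert j S then
          sgn i (insert j S) • delEnt ρ n ((insert j S).erase i) ⟨S, hS⟩ q else 0) +
        (-1 : ℤ) ^ (S.card + 1) • (if i ∈ S then sgn i S • delEnt ρ n (S.erase i) ⟨S, hS⟩ (q - 1)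
          else 0) ≫ (Y.obj (Opposite.op ⟨S, hS⟩)).d (q - 1) q := by
      rw [← delEnt_self ρ hY n ⟨S, hS⟩ q hq, Category.assoc, cotD_delEnt ρ hρ hY l n hl S _ hS
        (Finset.subset_insert _ _) q (q - 1) (by omega) hq, Preadditive.comp_add,
        Preadditive.comp_sum, Preadditive.comp_zsmul, ← Category.assoc, delH_ent ρ hρ l n hl]
      simp only [Preadditive.comp_zsmul, delH_ent ρ hρ l n hl]
    have e2 : (cotD Y n m hm ≫ delH ρ n m) ≫ cotProj Y n S hS q hq =
        if i ∈ S ∧ (S.erase i).Nonempty then sgn i S • (∑ j ∈ (S.erase i)ᶜ,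
          sgn j (insert j (S.erase i)) • delEnt ρ n (insert j (S.erase i)) ⟨S, hS⟩ q +
            (-1 : ℤ) ^ S.card • delEnt ρ n (S.erase i) ⟨S, hS⟩ (q - 1) ≫
              (Y.obj (Opposite.op ⟨S, hS⟩)).d (q - 1) q) else 0 := by
      rw [Category.assoc, delH, cotLift_proj]
      by_cases hi : i ∈ S
      · have hc := Finset.card_erase_add_one hi
        rw [if_pos hi, Preadditive.comp_zsmul]
        by_cases hne : (S.erase i).Nonempty
        · rw [if_pos ⟨hi, hne⟩, cotD_delEnt ρ hρ hY n m hm (S.erase i) _ hne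
            (Finset.insert_erase hi).ge q (q - 1) (by omega) (by omega), hc]
        · rw [if_neg fun h => hne h.2, Finset.not_nonempty_iff_eq_empty.1 hne, delEnt_empty,
            comp_zero, smul_zero]
      · rw [if_neg hi, if_neg fun h => hi h.1, comp_zero]
    rw [e1, e2, e3, ← delEnt_self ρ hY n ⟨S, hS⟩ q hq]
    -- For i ∈ S, removing i and adding it back gives the identity and all other terms cancel; for i
    -- ∉ S the only surviving term adds i and removes it.
    by_cases hi : i ∈ S
    · have hs : ∀ j ∈ Sᶜ, sgn j (insert j S) * sgn i (insert j S) +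
          sgn i S * sgn j (insert j (S.erase i)) = 0 := by
        intro j hj
        have hj' := Finset.mem_compl.1 hj
        have hij : i ≠ j := fun e => hj' (e ▸ hi)
        have h := sgn_cancel (Finset.mem_insert_of_mem hi) (Finset.mem_insert_self j S) hij
        rw [Finset.erase_insert hj', Finset.erase_insert_of_ne hij.symm] at h
        linear_combination sgn i S * sgn i (insert j S) * h -
          sgn j (insert j S) * sgn i (insert j S) * sgn_mul_self i S -
          sgn i S * sgn j (insert j (S.erase i)) * sgn_mul_self i (insert j S)
      have hset : ∀ j ∈ Sᶜ, (insert j S).erase i = insert j (S.erase i) := fun j hj =>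
        Finset.erase_insert_of_ne fun e => Finset.mem_compl.1 hj (e ▸ hi)
      rw [if_pos hi]
      have hsum : ∑ j ∈ Sᶜ, sgn j (insert j S) • (if i ∈ insert j S then
          sgn i (insert j S) • delEnt ρ n ((insert j S).erase i) ⟨S, hS⟩ q else 0) =
          -∑ j ∈ Sᶜ, sgn i S • sgn j (insert j (S.erase i)) •
            delEnt ρ n (insert j (S.erase i)) ⟨S, hS⟩ q := by
        rw [← Finset.sum_neg_distrib]
        refine Finset.sum_congr rfl fun j hj => ?_
        rw [if_pos (Finset.mem_insert_of_mem hi), hset j hj, smul_smul, smul_smul, ← neg_smul,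
          eq_neg_of_add_eq_zero_left (hs j hj)]
      rw [hsum]
      -- For S = {i} the index i cannot be removed. Instead the augmentation sums over all
      -- singletons {j}, and its terms with j ≠ i cancel the sum over the complement.
      by_cases h1 : S = {i}
      · subst h1
        rw [if_pos rfl, if_neg fun h => by simp at h, Finset.erase_singleton, delEnt_empty,
          smul_zero, zero_comp, smul_zero, add_zero, add_zero, sgn_singleton,
          ← Finset.sum_add_sum_compl {i}, Finset.sum_singleton, neg_add_eq_sub]
        simp [sgn_singleton]
      · have hne : (S.erase i).Nonempty := by
          rw [Finset.erase_nonempty hi]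
          exact (Finset.nontrivial_iff_ne_singleton hi).2 h1
        rw [if_neg h1, if_pos ⟨hi, hne⟩, Finset.compl_erase, Finset.sum_insert (by simpa using hi),
          Finset.insert_erase hi, smul_add, smul_add, smul_smul, sgn_mul_self, one_smul,
          Finset.smul_sum, Preadditive.zsmul_comp]
        module
    · have hs : ∀ j ∈ Sᶜ, j ≠ i → i ∉ insert j S := fun j _ hij h =>
        hi (Finset.mem_of_mem_insert_of_ne h hij.symm)
      rw [if_neg hi, if_neg fun h => hi h.1, if_neg fun h => hi (by simp [h]),
        zero_comp, smul_zero, add_zero, add_zero, add_zero,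
        Finset.sum_eq_single i (fun j hj hij => by rw [if_neg (hs j hj hij), smul_zero])
          (fun h => (h (Finset.mem_compl.2 hi)).elim), if_pos (Finset.mem_insert_self _ _),
        smul_smul, sgn_mul_self, one_smul, Finset.erase_insert hi]

end
end GrMod
end

/-! ### Functors that invert the augmentations -/

noncomputable section
namespace GrMod
variable {A : Type u} [CommRing A] {𝒜 : ℤ → AddSubgroup A} [GradedRing 𝒜] {r : ℕ}
open Pretriangulated DerivedCategory
variable [HasDerivedCategory.{w} (GrMod 𝒜)]
variable (Ψ : DerivedCategory (GrMod 𝒜) ⥤ DerivedCategory (GrMod 𝒜)) [Ψ.CommShift ℤ]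
  [Ψ.IsTriangulated]

omit [Ψ.CommShift ℤ] [Ψ.IsTriangulated] in
lemma map_Q_map_comm {K L M N : CochainComplex (GrMod 𝒜) ℤ} {a : K ⟶ L} {b : L ⟶ N} {c : K ⟶ M}
    {d : M ⟶ N} (e : a ≫ b = c ≫ d) : Ψ.map (Q.map a) ≫ Ψ.map (Q.map b) =
      Ψ.map (Q.map c) ≫ Ψ.map (Q.map d) :=
  ((Q ⋙ Ψ).map_comp a b).symm.trans
    ((congrArg (Q ⋙ Ψ).map e).trans ((Q ⋙ Ψ).map_comp c d))

/-- If `Ψ` inverts `K → X_{i}` and the maps `X_S → X_{S ∪ {i}}`, it inverts the augmentation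
`K → tot X`. -/
lemma isIso_map_totAug {X : NSub r ⥤ CochainComplex (GrMod 𝒜) ℤ} {K : CochainComplex (GrMod 𝒜) ℤ}
    (κ : ∀ S, K ⟶ X.obj S) (hκ : ∀ {S T : NSub r} (h : S ⟶ T), κ S ≫ X.map h = κ T) (i : Fin r)
    (h₁ : IsIso (Ψ.map (Q.map (κ ⟨{i}, Finset.singleton_nonempty i⟩))))
    (h₂ : ∀ S, IsIso (Ψ.map (Q.map (X.map ((toInsI i).app S))))) :
    IsIso (Ψ.map (Q.map (totAug κ hκ))) := by
  let I : NSub r := ⟨{i}, Finset.singleton_nonempty i⟩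
  -- `Y` has columns X_(S ∪ {i}); by `h₂` the functor Ψ inverts X → Y on each column, hence on total
  -- complexes.
  let Y := insI i ⋙ X
  let α : X ⟶ Y :=
    { app := fun S => X.map ((toInsI i).app S)
      naturality := fun S T h => (X.map_comp h ((toInsI i).app T)).symm.trans
        (X.map_comp ((toInsI i).app S) ((insI i).map h)) }
  let ρ : ∀ S T : NSub r, T.1 ⊆ insert i S.1 → (Y.obj T ⟶ Y.obj S) := fun S T h =>
    X.map (homOfLE (show (insI i).obj T ≤ (insI i).obj S from
      Finset.insert_subset (Finset.mem_insert_self _ _) h))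
  let κ' : ∀ S, Y.obj I ⟶ Y.obj S := fun S => ρ S I (by simp [I])
  have hκ' : ∀ {S T : NSub r} (h : S ⟶ T), κ' S ≫ Y.map h = κ' T := fun h =>
    (X.map_comp _ _).symm
  have hq : QuasiIso (totAug κ' hκ') :=
    quasiIso_insAug ρ (fun _ _ _ _ _ _ => (X.map_comp _ _).symm) (fun _ => rfl) κ' hκ'
      fun _ => rfl
  -- The composite K → tot X → tot Y is also K → Y_{i} → tot Y, whose second map is a
  -- quasi-isomorphism by the contraction; so Ψ inverts three sides of the square.
  have e := totAug_naturality κ hκ κ' hκ' (κ I ≫ X.map ((toInsI i).app I)) α fun S => by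
    rw [hκ]
    exact (hκ _).trans (hκ _).symm
  have h₃ := isIso_tot Ψ α h₂
  have h₄ : IsIso (Ψ.map (Q.map (totAug κ' hκ'))) :=
    @Functor.map_isIso _ _ _ _ _ _ Ψ _ ((isIso_Q_map_iff_quasiIso _ _).2 hq)
  have h₅ : IsIso (Ψ.map (Q.map (κ I ≫ X.map ((toInsI i).app I)))) := by
    rw [Q.map_comp, Ψ.map_comp]
    exact @IsIso.comp_isIso _ _ _ _ _ _ _ h₁ (h₂ I)
  exact @IsIso.of_isIso_fac_right _ _ _ _ _ _ _ _ h₃ (@IsIso.comp_isIso _ _ _ _ _ _ _ h₅ h₄)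
    (map_Q_map_comm Ψ e).symm

/-- If `Ψ` inverts `X_{i} → K` and the maps `X_{S ∪ {i}} → X_S`, it inverts the augmentation
`cot X → K`. -/
lemma isIso_map_cotAug {X : (NSub r)ᵒᵖ ⥤ CochainComplex (GrMod 𝒜) ℤ}
    {K : CochainComplex (GrMod 𝒜) ℤ} (κ : ∀ S, X.obj S ⟶ K)
    (hκ : ∀ {S T : (NSub r)ᵒᵖ} (h : S ⟶ T), X.map h ≫ κ T = κ S) (i : Fin r)
    (h₁ : IsIso (Ψ.map (Q.map (κ (Opposite.op ⟨{i}, Finset.singleton_nonempty i⟩)))))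
    (h₂ : ∀ S, IsIso (Ψ.map (Q.map (X.map ((toInsI i).app S).op)))) :
    IsIso (Ψ.map (Q.map (cotAug κ hκ))) := by
  let I : NSub r := ⟨{i}, Finset.singleton_nonempty i⟩
  let Y := (insI i).op ⋙ X
  let α : Y ⟶ X :=
    { app := fun S => X.map ((toInsI i).app S.unop).op
      naturality := fun S T h => (X.map_comp ((insI i).map h.unop).op
        ((toInsI i).app T.unop).op).symm.trans (X.map_comp ((toInsI i).app S.unop).op h) }
  let ρ : ∀ S T : NSub r, S.1 ⊆ insert i T.1 → (Y.obj (Opposite.op T) ⟶ Y.obj (Opposite.op S)) :=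
    fun S T h => X.map (homOfLE (show (insI i).obj S ≤ (insI i).obj T from
      Finset.insert_subset (Finset.mem_insert_self _ _) h)).op
  let κ' : ∀ S, Y.obj S ⟶ Y.obj (Opposite.op I) := fun S => ρ I S.unop (by simp [I])
  have hκ' : ∀ {S T : (NSub r)ᵒᵖ} (h : S ⟶ T), Y.map h ≫ κ' T = κ' S := fun h =>
    (X.map_comp _ _).symm
  have hq : QuasiIso (cotAug κ' hκ') :=
    quasiIso_delAug ρ (fun _ _ _ _ _ _ => (X.map_comp _ _).symm) (fun _ => rfl) κ' hκ'
      fun _ => rfl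
  have e := cotAug_naturality κ' hκ' κ hκ (X.map ((toInsI i).app I).op ≫ κ (Opposite.op I)) α
    fun S => (congrArg (κ' S ≫ ·) (hκ _)).trans
      ((hκ (S := (insI i).op.obj S) (T := (insI i).op.obj (Opposite.op I)) _).trans
        (hκ _).symm)
  have h₃ := isIso_cot Ψ α fun S => h₂ S.unop
  have h₄ : IsIso (Ψ.map (Q.map (cotAug κ' hκ'))) :=
    @Functor.map_isIso _ _ _ _ _ _ Ψ _ ((isIso_Q_map_iff_quasiIso _ _).2 hq)
  have h₅ : IsIso (Ψ.map (Q.map (X.map ((toInsI i).app I).op ≫ κ (Opposite.op I)))) := by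
    rw [Q.map_comp, Ψ.map_comp]
    exact @IsIso.comp_isIso _ _ _ _ _ _ _ (h₂ I) h₁
  exact @IsIso.of_isIso_fac_left _ _ _ _ _ _ _ _ h₃ (@IsIso.comp_isIso _ _ _ _ _ _ _ h₄ h₅)
    (map_Q_map_comm Ψ e)

end GrMod
end

/-! ### Torsion with respect to the ideal and the two global decompositions -/

noncomputable section
namespace GrMod
variable {A : Type u} [CommRing A] {𝒜 : ℤ → AddSubgroup A} [GradedRing 𝒜]

lemma zero_act (M : GrMod 𝒜) {i j k : ℤ} (h : i + j = k) (x : M.X j) : M.act h (0 : 𝒜 i) x = 0 := by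
  have e := M.add_act h 0 0 x
  rwa [add_zero, left_eq_add] at e

/-- The annihilator of all homogeneous components acting on a homogeneous element. -/
def homogeneousAnn (M : GrMod 𝒜) {w : ℤ} (x : M.X w) : Ideal A where
  carrier := {b | ∀ i : ℤ, M.act (rfl : i + w = i + w) (DirectSum.decompose 𝒜 b i) x = 0}
  zero_mem' i := by
    rw [DirectSum.decompose_zero, DirectSum.zero_apply]
    exact zero_act M _ x
  add_mem' {a b} ha hb i := by
    rw [DirectSum.decompose_add, DirectSum.add_apply]
    exact (M.add_act _ _ _ x).trans
      ((congrArg₂ (· + ·) (ha i) (hb i)).trans (add_zero _))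
  smul_mem' c b hb := by
    induction c using DirectSum.Decomposition.inductionOn 𝒜 with
    | zero =>
      intro i
      rw [zero_smul, DirectSum.decompose_zero, DirectSum.zero_apply]
      exact zero_act M _ x
    | add c c' hc hc' =>
      intro i
      rw [add_smul, DirectSum.decompose_add, DirectSum.add_apply]
      exact (M.add_act _ _ _ x).trans
        ((congrArg₂ (· + ·) (hc i) (hc' i)).trans (add_zero _))
    | @homogeneous j c =>
      intro i
      -- Multiplication by a homogeneous element of degree j carries the component of degree k to
      -- the component of degree j + k.
      obtain ⟨k, rfl⟩ : ∃ k, i = j + k := ⟨i - j, by omega⟩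
      have e : (DirectSum.decompose 𝒜 ((c : A) • b) (j + k) : A) = c * DirectSum.decompose 𝒜 b k :=
        DirectSum.coe_decompose_mul_add_of_left_mem 𝒜 c.2
      rw [← M.act_act (rfl : k + w = k + w) (by ring : j + (k + w) = j + k + w) _ _ _ _ e, hb k,
        map_zero]

lemma mem_homogeneousAnn_iff (M : GrMod 𝒜) {w : ℤ} (x : M.X w) {n : ℤ} (b : 𝒜 n) :
    (b : A) ∈ homogeneousAnn M x ↔ M.act (rfl : n + w = n + w) b x = 0 := by
  constructor
  · intro h
    have := h n
    rwa [DirectSum.decompose_coe, DirectSum.of_eq_same] at this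
  · intro h i
    by_cases hi : n = i
    · subst hi
      rwa [DirectSum.decompose_coe, DirectSum.of_eq_same]
    · rw [DirectSum.decompose_coe, DirectSum.of_eq_of_ne _ _ _ (Ne.symm hi)]
      exact zero_act M _ x

lemma IsTorsion.powTorsion {I : Ideal A} {M : GrMod 𝒜} (h : IsTorsion I M) {n : ℤ} (g : 𝒜 n)
    (hg : (g : A) ∈ I) : PowTorsion g M := by
  intro w x
  obtain ⟨k, -, hk⟩ := h w x g hg
  refine ⟨k, fun j hj => ?_⟩
  subst hj
  exact (mem_homogeneousAnn_iff M x (hpow g k)).1 hk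

lemma IsTorsion.of_iso {I : Ideal A} {M N : GrMod 𝒜} (h : IsTorsion I M) (e : M ≅ N) :
    IsTorsion I N := by
  intro w x a ha
  obtain ⟨k, hk, h'⟩ := h w (ev e.inv w x) a ha
  refine ⟨k, hk, fun i => ?_⟩
  rw [← ev_inv_hom e w x, ← ev_act, h' i, map_zero]

/-- The elements all of whose components kill x form an ideal. Its radical contains the generators,
hence the ideal generated by them, so that elements that are not homogeneous are covered as well. -/
lemma isTorsion_of_powTorsion {ι : Type*} {d : ι → ℤ} (f : ∀ i, 𝒜 (d i)) {M : GrMod 𝒜}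
    (h : ∀ i, PowTorsion (f i) M) : IsTorsion (Ideal.span (Set.range fun i => (f i : A))) M := by
  intro w x a ha
  have hr : Ideal.span (Set.range fun i => (f i : A)) ≤ (homogeneousAnn M x).radical := by
    rw [Ideal.span_le]
    rintro _ ⟨i, rfl⟩
    obtain ⟨k, hk⟩ := h i w x
    exact ⟨k, (mem_homogeneousAnn_iff M x (hpow (f i) k)).2 (hk _ rfl)⟩
  obtain ⟨n, hn⟩ := hr ha
  -- The extra factor of `a` makes the exponent positive.
  exact ⟨n + 1, n.succ_pos, by rw [pow_succ']; exact Ideal.mul_mem_left _ a hn⟩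

section
variable {r : ℕ} {d : Fin r → ℤ} (f : ∀ i, 𝒜 (d i))

lemma fprod_insert {S : Finset (Fin r)} {i : Fin r} (hi : i ∉ S) :
    (fprod f (insert i S) : A) = f i * fprod f S := Finset.prod_insert hi

lemma fprod_mem {S : Finset (Fin r)} (hS : S.Nonempty) :
    (fprod f S : A) ∈ Ideal.span (Set.range fun i => (f i : A)) := by
  obtain ⟨i, hi⟩ := hS
  rw [coe_fprod, ← Finset.mul_prod_erase _ _ hi]
  exact Ideal.mul_mem_right _ _ (Ideal.subset_span ⟨i, rfl⟩)

end

open Pretriangulated DerivedCategory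
variable [HasDerivedCategory.{w} (GrMod 𝒜)]

lemma dTor_le_pTor {I : Ideal A} {n : ℤ} {g : 𝒜 n} (hg : (g : A) ∈ I) :
    DTor 𝒜 I ≤ PTor 𝒜 g :=
  fun _ h m => (h m).powTorsion g hg

lemma dTor_span_iff {ι : Type*} {d : ι → ℤ} (f : ∀ i, 𝒜 (d i)) (M : DerivedCategory (GrMod 𝒜)) :
    DTor 𝒜 (Ideal.span (Set.range fun i => (f i : A))) M ↔ ∀ i, PTor 𝒜 (f i) M :=
  ⟨fun h i => dTor_le_pTor (g := f i) (Ideal.subset_span (Set.mem_range_self i)) M h,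
    fun h n => isTorsion_of_powTorsion f fun i => h i n⟩

/-- The fibre of M → M_g is g-torsion, hence k-torsion, and is killed by inverting k. -/
lemma isIso_locD_map_locη {n n' : ℤ} {g : 𝒜 n} {k : 𝒜 n'} (h : PTor 𝒜 g ≤ PTor 𝒜 k)
    (M : DerivedCategory (GrMod 𝒜)) : IsIso ((locD k).map ((locη g).app M)) := by
  obtain ⟨_, _⟩ := (isDecomposition_loc k).exists_isTriangulated_right
  obtain ⟨δ, hδ⟩ := (isDecomposition_loc g).triangle M
  exact (Triangle.isZero₁_iff_isIso₂ _ ((locD k).map_distinguished _ hδ)).1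
    ((isZero_locD_iff k _).2 (h _ ((isDecomposition_loc g).left M)))

/-- Objects on which k is invertible are also g-invertible, because the inclusion of torsion classes
reverses on orthogonals. So the cone of T(M, g) → M receives no maps from k-invertible objects and
T(-, k) kills it. -/
lemma isIso_tel_map_telε {n n' : ℤ} {g : 𝒜 n} {k : 𝒜 n'} (h : PTor 𝒜 g ≤ PTor 𝒜 k)
    (M : DerivedCategory (GrMod 𝒜)) : IsIso ((tel k).map ((telε g).app M)) := by
  obtain ⟨_, _⟩ := (isDecomposition_tel k).exists_isTriangulated_left
  obtain ⟨δ, hδ⟩ := (isDecomposition_tel g).triangle M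
  refine (Triangle.isZero₃_iff_isIso₁ _ ((tel k).map_distinguished _ hδ)).1
    (((isDecomposition_tel k).mem_right_iff _).1 fun N φ hN => ?_)
  exact (isDecomposition_tel g).right M φ fun L ψ hL => hN ψ (h _ hL)

section
variable {F : CochainComplex (GrMod 𝒜) ℤ ⥤ CochainComplex (GrMod 𝒜) ℤ} (hF : PreservesQuasiIso F)
  (Ψ : DerivedCategory (GrMod 𝒜) ⥤ DerivedCategory (GrMod 𝒜))

lemma isIso_map_descendUnit (α : 𝟭 _ ⟶ F) (K : CochainComplex (GrMod 𝒜) ℤ) :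
    IsIso (Ψ.map ((descendUnit hF α).app (Q.obj K))) ↔ IsIso (Ψ.map (Q.map (α.app K))) := by
  have e : Arrow.mk ((descendUnit hF α).app (Q.obj K)) ≅ Arrow.mk (Q.map (α.app K)) :=
    Arrow.isoMk (Iso.refl _) ((descendIso hF).app K)
      ((Category.id_comp _).trans (descendUnit_comp_hom hF α K).symm)
  exact (MorphismProperty.isomorphisms _).arrow_mk_iso_iff (Ψ.mapArrow.mapIso e)

lemma isIso_map_descendCounit (α : F ⟶ 𝟭 _) (K : CochainComplex (GrMod 𝒜) ℤ) :
    IsIso (Ψ.map ((descendCounit hF α).app (Q.obj K))) ↔ IsIso (Ψ.map (Q.map (α.app K))) := by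
  have e : Arrow.mk ((descendCounit hF α).app (Q.obj K)) ≅ Arrow.mk (Q.map (α.app K)) :=
    Arrow.isoMk ((descendIso hF).app K) (Iso.refl _)
      ((descendCounit_app hF α K).symm.trans (Category.comp_id _).symm)
  exact (MorphismProperty.isomorphisms _).arrow_mk_iso_iff (Ψ.mapArrow.mapIso e)

end

variable {r : ℕ} {d : Fin r → ℤ} (f : ∀ i, 𝒜 (d i))

/-- The product over {i} equals f_i but lives in a degree written as a sum over {i}; multiplication
by 1 relates the two. -/
lemma pTor_fprod_singleton_le (i : Fin r) : PTor 𝒜 (fprod f {i}) ≤ PTor 𝒜 (f i) :=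
  pTor_le_mul (h := ⟨1, SetLike.GradedOne.one_mem⟩) (by simp) (by simp)

lemma inv_fprod_le {S : Finset (Fin r)} {i : Fin r} (hi : i ∈ S) :
    (PTor 𝒜 (fprod f S)).rightOrthogonal ≤ (PTor 𝒜 (f i)).rightOrthogonal := fun M hM =>
  ((inv_mul_iff (h := fprod f (S.erase i)) ((Finset.prod_erase_mul _ _ hi).symm)
    (Finset.sum_erase_add _ _ hi) M).1 hM).2

lemma isIso_toInsI_app {S : NSub r} {i : Fin r} (hi : i ∈ S.1) : IsIso ((toInsI i).app S) :=
  ⟨homOfLE (Finset.insert_subset hi (Finset.Subset.refl _)), rfl, rfl⟩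

/-- After inverting f_i, the columns of S and S ∪ {i} agree and M agrees with its localization at
f_i, so the augmented Čech complex becomes contractible. -/
lemma isIso_locD_map_cechη (i : Fin r) (M : DerivedCategory (GrMod 𝒜)) :
    IsIso ((locD (f i)).map ((cechη f).app M)) := by
  obtain ⟨K, ⟨e⟩⟩ := exists_Q_iso M
  obtain ⟨_, _⟩ := (isDecomposition_loc (f i)).exists_isTriangulated_right
  have h : IsIso ((Functor.whiskerRight (cechη f) (locD (f i))).app (Q.obj K)) := by
    refine (isIso_map_descendUnit (cechC_preserves f) (locD (f i)) (cechAug f) K).2 ?_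
    refine isIso_map_totAug (locD (f i)) (X := (locSys f).flip.obj K) _
      (fun h => toLocC_map f h K) i ?_ fun S => ?_
    · exact (isIso_map_descendUnit (locC_preserves _) (locD (f i)) (toLocC _) K).1
        (isIso_locD_map_locη (pTor_fprod_singleton_le f i) _)
    · by_cases hi : i ∈ S.1
      · have := isIso_toInsI_app hi
        infer_instance
      · exact isIso_locD_map_locTrans _ _ (Finset.sum_insert hi).symm (fprod_insert f hi) K
  exact isIso_app_of_iso (Functor.whiskerRight (cechη f) (locD (f i))) e

/-- The dual statement: T(-, f_i) inverts T(M, f_i) → M and identifies the telescope at f_i f_S with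
the one at f_S when i ∉ S. -/
lemma isIso_tel_map_dualCechη (i : Fin r) (M : DerivedCategory (GrMod 𝒜)) :
    IsIso ((tel (f i)).map ((dualCechη f).app M)) := by
  obtain ⟨K, ⟨e⟩⟩ := exists_Q_iso M
  obtain ⟨_, _⟩ := (isDecomposition_tel (f i)).exists_isTriangulated_left
  have h : IsIso ((Functor.whiskerRight (dualCechη f) (tel (f i))).app (Q.obj K)) := by
    refine (isIso_map_descendCounit (dualC_preserves f) (tel (f i)) (dualAug f) K).2 ?_
    refine isIso_map_cotAug (tel (f i)) (X := (telSys f).flip.obj K) _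
      (fun {S T} h => congrArg (fun q => q.app K) (telTrans_zero (fprod f T.unop.1)
        (fprod f S.unop.1) (fprod f (S.unop.1 \ T.unop.1)) (Finset.sum_sdiff (leOfHom h.unop))
        (fprod_sdiff f (leOfHom h.unop)))) i ?_ fun S => ?_
    · exact (isIso_map_descendCounit (telC_preserves _) (tel (f i)) (telZero _) K).1
        (isIso_tel_map_telε (pTor_fprod_singleton_le f i) _)
    · by_cases hi : i ∈ S.1
      · have := isIso_toInsI_app hi
        infer_instance
      · exact isIso_tel_map_telTrans _ (fprod_sdiff f (Finset.subset_insert _ _))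
          (Finset.sum_insert hi).symm (fprod_insert f hi) K
  exact isIso_app_of_iso (Functor.whiskerRight (dualCechη f) (tel (f i))) e

section
variable (P : ObjectProperty (DerivedCategory (GrMod 𝒜))) [P.IsTriangulated]
  [P.IsClosedUnderIsomorphisms]

/-- The Čech complex is built from the localizations. -/
lemma prop_cech (M : DerivedCategory (GrMod 𝒜))
    (h : ∀ S : NSub r, P ((locD (fprod f S.1)).obj M)) : P ((cech f).obj M) := by
  obtain ⟨K, ⟨e⟩⟩ := exists_Q_iso M
  refine P.prop_of_iso ((cech f).mapIso e) (P.prop_of_iso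
    ((descendIso (cechC_preserves f)).app K).symm (prop_tot P ((locSys f).flip.obj K) fun S => ?_))
  exact P.prop_of_iso ((descendIso (locC_preserves (fprod f S.1))).app K)
    (P.prop_of_iso ((locD (fprod f S.1)).mapIso e.symm) (h S))

/-- The dual Čech complex is built from the telescopes. -/
lemma prop_dualCech (M : DerivedCategory (GrMod 𝒜))
    (h : ∀ S : NSub r, P ((tel (fprod f S.1)).obj M)) : P ((dualCech f).obj M) := by
  obtain ⟨K, ⟨e⟩⟩ := exists_Q_iso M
  refine P.prop_of_iso ((dualCech f).mapIso e) (P.prop_of_iso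
    ((descendIso (dualC_preserves f)).app K).symm (prop_cot P ((telSys f).flip.obj K) fun S => ?_))
  exact P.prop_of_iso ((descendIso (telC_preserves (fprod f S.unop.1))).app K)
    (P.prop_of_iso ((tel (fprod f S.unop.1)).mapIso e.symm) (h S.unop))

end

instance (I : Ideal A) : (DTor 𝒜 I).IsClosedUnderIsomorphisms where
  of_iso e h n := (h n).of_iso ((homologyFunctor (GrMod 𝒜) n).mapIso e)

instance (I : Ideal A) : (DTor 𝒜 I).IsStableUnderShift ℤ where
  isStableUnderShiftBy a := ⟨fun M h n =>
    (h (a + n)).of_iso ((((homologyFunctor (GrMod 𝒜) 0).shiftIso a n (a + n) rfl).app M).symm)⟩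

lemma rightOrthogonal_dTor {I : Ideal A} {n : ℤ} {g : 𝒜 n} (hg : (g : A) ∈ I)
    {M : DerivedCategory (GrMod 𝒜)} (hM : (PTor 𝒜 g).rightOrthogonal M) :
    (DTor 𝒜 I).rightOrthogonal M :=
  fun _ φ hN => hM φ (dTor_le_pTor hg _ hN)

/-- Inverting any f_i kills the fibre RΓ_I(M), so its cohomology is torsion for each generator,
hence for I. The Čech complex is built by finitely many extensions from the localizations at the
f_S; these elements lie in I, so localizations at them receive no maps from torsion objects. -/
lemma isDecomposition_cech :
    (DTor 𝒜 (Ideal.span (Set.range fun i => (f i : A)))).IsDecomposition (RGamma f) (cech f)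
      (RGammaε f) (cechη f) where
  left M := by
    rw [dTor_span_iff]
    intro i
    obtain ⟨_, _⟩ := (isDecomposition_loc (f i)).exists_isTriangulated_right
    obtain ⟨δ, hδ⟩ : ∃ δ, Triangle.mk ((RGammaε f).app M) ((cechη f).app M) δ ∈ distTriang _ :=
      coconeFunctor_triangle (cechC_preserves f) (gammaC_preserves f) M
    exact (isZero_locD_iff (f i) _).1 ((Triangle.isZero₁_iff_isIso₂ _
      ((locD (f i)).map_distinguished _ hδ)).2 (isIso_locD_map_cechη f i M))
  right M := prop_cech f _ M fun S =>
    rightOrthogonal_dTor (fprod_mem f S.2) ((isDecomposition_loc (fprod f S.1)).right M)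
  triangle := coconeFunctor_triangle (cechC_preserves f) (gammaC_preserves f)

/-- Objects orthogonal to torsion objects have no maps to objects with vanishing telescopes. -/
lemma eq_zero_of_forall_fprod {N Z : DerivedCategory (GrMod 𝒜)}
    (hN : (DTor 𝒜 (Ideal.span (Set.range fun i => (f i : A)))).rightOrthogonal N)
    (hZ : ∀ S : NSub r, (PTor 𝒜 (fprod f S.1)).rightOrthogonal.rightOrthogonal Z) (φ : N ⟶ Z) :
    φ = 0 := by
  -- The left orthogonal of `R` is triangulated because `R` is stable under shifts, so `prop_cech`
  -- reduces the orthogonality of Č_I(N) to that of the localizations of N.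
  let R : ObjectProperty (DerivedCategory (GrMod 𝒜)) := fun Z =>
    ∀ S : NSub r, (PTor 𝒜 (fprod f S.1)).rightOrthogonal.rightOrthogonal Z
  have : R.IsStableUnderShift ℤ :=
    ⟨fun a => ⟨fun Z h S => ObjectProperty.le_shift _ a _ (h S)⟩⟩
  have h : R.leftOrthogonal ((cech f).obj N) := prop_cech f _ N fun S _ ψ hT =>
    hT S ψ ((isDecomposition_loc (fprod f S.1)).right N)
  -- The torsion part of N vanishes, so N is isomorphic to its Čech complex.
  have := ((isDecomposition_cech f).isIso_unit_iff N).2 (((isDecomposition_cech f).mem_right_iff N).1 hN)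
  exact R.leftOrthogonal.prop_of_iso (asIso ((cechη f).app N)).symm h φ hZ

/-- E_I(M) is built from telescopes at the f_S ∈ I, which are orthogonal to torsion. Since T(-, f_i)
inverts E_I(M) → M, it kills the cone LΛ_I(M); so LΛ_I(M) receives no maps from f_i-invertible
objects, in particular none from f_S-invertible ones with i ∈ S, and `eq_zero_of_forall_fprod`
applies. -/
lemma isDecomposition_dualCech :
    (DTor 𝒜 (Ideal.span (Set.range fun i => (f i : A)))).rightOrthogonal.IsDecomposition
      (dualCech f) (LLambda f) (dualCechη f) (LLambdaε f) where
  left M := prop_dualCech f _ M fun S =>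
    rightOrthogonal_dTor (fprod_mem f S.2) ((isDecomposition_tel (fprod f S.1)).left M)
  right M := by
    intro N φ hN
    refine eq_zero_of_forall_fprod f hN (fun S => ?_) φ
    obtain ⟨i, hi⟩ := S.2
    obtain ⟨_, _⟩ := (isDecomposition_tel (f i)).exists_isTriangulated_left
    obtain ⟨δ, hδ⟩ : ∃ δ, Triangle.mk ((dualCechη f).app M) ((LLambdaε f).app M) δ ∈ distTriang _ :=
      coneFunctor_triangle (dualC_preserves f) (lambdaC_preserves f) M
    have h := (Triangle.isZero₃_iff_isIso₁ _ ((tel (f i)).map_distinguished _ hδ)).2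
      (isIso_tel_map_dualCechη f i M)
    have h' := ((isDecomposition_tel (f i)).mem_right_iff _).2 h
    exact fun L ψ hL => h' ψ (inv_fprod_le f hi _ hL)
  triangle := coneFunctor_triangle (dualC_preserves f) (lambdaC_preserves f)

lemma dTriv_eq :
    DTriv f = (DTor 𝒜 (Ideal.span (Set.range fun i => (f i : A)))).rightOrthogonal := by
  ext M
  exact ((isDecomposition_cech f).mem_right_iff M).symm

/-- Membership in the double orthogonal needs only the vanishing of T(M, f_S) for nonempty S. It
implies vanishing for every homogeneous g ∈ I, because g-invertible objects are orthogonal to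
I-torsion. -/
lemma dComp_eq : DComp 𝒜 (Ideal.span (Set.range fun i => (f i : A))) =
    (DTor 𝒜 (Ideal.span (Set.range fun i => (f i : A)))).rightOrthogonal.rightOrthogonal := by
  ext M
  constructor
  · intro h N φ hN
    exact eq_zero_of_forall_fprod f hN (fun S => ((isDecomposition_tel _).mem_right_iff M).2
      (h _ _ (fprod_mem f S.2))) φ
  · intro h m g hg
    exact ((isDecomposition_tel g).mem_right_iff M).1 fun N φ hN =>
      h φ (rightOrthogonal_dTor hg hN)

end GrMod

end

theorem mainTheorem6 {A : Type u} [CommRing A] (𝒜 : ℤ → AddSubgroup A) [GradedRing 𝒜]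
    [HasDerivedCategory.{w} (GrMod 𝒜)]
    (I : Ideal A) {r : ℕ} (d : Fin r → ℤ) (f : ∀ i, 𝒜 (d i))
    (hI : I = Ideal.span (Set.range fun i => (f i : A))) :
    -- vanishing
    (∀ M : DerivedCategory (GrMod 𝒜),
      IsZero ((LLambda f).obj ((cech f).obj M)) ∧ IsZero ((RGamma f).obj ((dualCech f).obj M))) ∧
    (∀ M : DerivedCategory (GrMod 𝒜), IsZero ((RGamma f).obj M) ↔ IsZero ((LLambda f).obj M)) ∧
    -- all functors are exact, all subcategories are triangulated
    ((∃ _ : (RGamma f).CommShift ℤ, (RGamma f).IsTriangulated) ∧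
      (∃ _ : (LLambda f).CommShift ℤ, (LLambda f).IsTriangulated) ∧
      (∃ _ : (cech f).CommShift ℤ, (cech f).IsTriangulated) ∧
      (∃ _ : (dualCech f).CommShift ℤ, (dualCech f).IsTriangulated) ∧
      (DTor 𝒜 I).IsTriangulated ∧ (DComp 𝒜 I).IsTriangulated ∧ (DTriv f).IsTriangulated) ∧
    -- the recollement and the equivalence
    (∃ (hTor : ∀ M, DTor 𝒜 I ((RGamma f).obj M)) (hComp : ∀ M, DComp 𝒜 I ((LLambda f).obj M))
        (hCech : ∀ M, DTriv f ((cech f).obj M)) (hDual : ∀ M, DTriv f ((dualCech f).obj M)),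
      (∃ adj : (DTor 𝒜 I).ι ⊣ (DTor 𝒜 I).lift (RGamma f) hTor,
        ∀ M, adj.counit.app M = (RGammaε f).app M) ∧
      (∃ adj : (DComp 𝒜 I).lift (LLambda f) hComp ⊣ (DComp 𝒜 I).ι,
        ∀ M, adj.unit.app M = (LLambdaε f).app M) ∧
      (∃ adj : (DTriv f).lift (cech f) hCech ⊣ (DTriv f).ι,
        ∀ M, adj.unit.app M = (cechη f).app M) ∧
      (∃ adj : (DTriv f).ι ⊣ (DTriv f).lift (dualCech f) hDual,
        ∀ M, adj.counit.app M = (dualCechη f).app M) ∧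
      (∃ e : (DTor 𝒜 I).FullSubcategory ≌ (DComp 𝒜 I).FullSubcategory,
        e.functor = (DTor 𝒜 I).ι ⋙ (DComp 𝒜 I).lift (LLambda f) hComp ∧
        e.inverse = (DComp 𝒜 I).ι ⋙ (DTor 𝒜 I).lift (RGamma f) hTor) ∧
      Nonempty ((DTor 𝒜 I).lift (RGamma f) hTor ⊣
        ((DTor 𝒜 I).ι ⋙ (DComp 𝒜 I).lift (LLambda f) hComp) ⋙ (DComp 𝒜 I).ι) ∧
      Nonempty (((DComp 𝒜 I).ι ⋙ (DTor 𝒜 I).lift (RGamma f) hTor) ⋙ (DTor 𝒜 I).ι ⊣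
        (DComp 𝒜 I).lift (LLambda f) hComp)) ∧
    (∀ M, IsIso ((RGamma f).map ((LLambdaε f).app M)) ∧
      IsIso ((LLambda f).map ((RGammaε f).app M))) ∧
    -- the two semi-orthogonal decompositions
    (∀ M N : DerivedCategory (GrMod 𝒜), DTor 𝒜 I M → DTriv f N → ∀ φ : M ⟶ N, φ = 0) ∧
    (∀ M N : DerivedCategory (GrMod 𝒜), DTriv f M → DComp 𝒜 I N → ∀ φ : M ⟶ N, φ = 0) ∧
    (∃ δ : cech f ⟶ RGamma f ⋙ shiftFunctor (DerivedCategory (GrMod 𝒜)) (1 : ℤ),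
      ∀ M, Triangle.mk ((RGammaε f).app M) ((cechη f).app M) (δ.app M) ∈ distTriang _) ∧
    (∃ δ : LLambda f ⟶ dualCech f ⋙ shiftFunctor (DerivedCategory (GrMod 𝒜)) (1 : ℤ),
      ∀ M, Triangle.mk ((dualCechη f).app M) ((LLambdaε f).app M) (δ.app M) ∈ distTriang _) := by
  subst hI
  have h := isDecomposition_cech f
  have h' := isDecomposition_dualCech f
  have e₁ := dTriv_eq f
  have e₂ := dComp_eq f
  -- The two subcategories occur in the types of the lifted functors, so they are made variables
  -- before substitution. The goal then concerns the torsion subcategory and its iterated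
  -- orthogonals, and each clause is an instance of the formal results.
  generalize DTriv f = P₁ at e₁ ⊢
  generalize DComp 𝒜 (Ideal.span (Set.range fun i => (f i : A))) = P₂ at e₂ ⊢
  subst e₁ e₂
  refine ⟨fun M => ⟨(h'.mem_left_iff _).1 (h.right M), (h.mem_right_iff _).1 (h'.left M)⟩,
    fun M => (h.mem_right_iff M).symm.trans (h'.mem_left_iff M),
    ⟨h.exists_isTriangulated_left, h'.exists_isTriangulated_right, h.exists_isTriangulated_right,
      h'.exists_isTriangulated_left, h.isTriangulated, inferInstance, inferInstance⟩,
    ⟨h.left, h'.right, h.right, h'.left, h.exists_adjunction_counit, h'.exists_adjunction_unit,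
      h.exists_adjunction_unit, h'.exists_adjunction_counit, h.exists_equivalence h',
      h.nonempty_adjunction_left h', h.nonempty_adjunction_right h'⟩,
    fun M => ⟨h.isIso_left_map_unit h' M, h.isIso_right_map_counit h' M⟩,
    fun M N hM hN φ => hN φ hM, fun M N hM hN φ => hN φ hM, h.exists_natTrans, h'.exists_natTrans⟩
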